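/- **Setting.** Fix $\tau,\eta\in\mathbb C$ with $\operatorname{Im}\tau>0$ and let $\theta(t)=-\sum_{j\in\mathbb Z}e^{\pi i(j+\frac12)^2\tau+2\pi i(j+\frac12)(t+\frac12)}$. Let $V=\mathbb C e[1]\oplus\mathbb C e[-1]$, and let $R(z,\lambda)\in\operatorname{End}(V\otimes V)$ be $R=E_{11}\otimes E_{11}+E_{-1,-1}\otimes E_{-1,-1}+\alpha(z,\lambda)E_{11}\otimes E_{-1,-1}+\alpha(z,-\lambda)E_{-1,-1}\otimes E_{11}+\beta(z,\lambda)E_{1,-1}\otimes E_{-1,1}+\beta(z,-\lambda)E_{-1,1}\otimes E_{1,-1}$, with $\alpha(z,\lambda)=\frac{\theta(\lambda+2\eta)\theta(z)}{\theta(\lambda)\theta(z-2\eta)}$, $\beta(z,\lambda)=-\frac{\theta(\lambda+z)\theta(2\eta)}{\theta(\lambda)\theta(z-2\eta)}$. A module over $E_{\tau,\eta}(sl_2)$ is a vector space $W=\bigoplus_{\nu\in\mathbb C}W[\nu]$ with finite dimensional eigenspaces $W[\nu]$ of an operator $h$, together with a meromorphic family $L(z,\lambda)\in\operatorname{End}(V\otimes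 W)$ commuting with $h^{(1)}+h^{(2)}$ such that $R^{(12)}(z-w,\lambda-2\eta h^{(3)})L^{(13)}(z,\lambda)L^{(23)}(w,\lambda-2\eta h^{(1)})=L^{(23)}(w,\lambda)L^{(13)}(z,\lambda-2\eta h^{(2)})R^{(12)}(z-w,\lambda)$. Write $L(z,\lambda)(e[1]\otimes u)=e[1]\otimes a(z,\lambda)u+e[-1]\otimes c(z,\lambda)u$ and $L(z,\lambda)(e[-1]\otimes u)=e[1]\otimes b(z,\lambda)u+e[-1]\otimes d(z,\lambda)u$. On meromorphic $W$-valued functions of $\lambda$ put $(a(z)f)(\lambda)=a(z,\lambda)f(\lambda-2\eta)$, $(c(z)f)(\lambda)=c(z,\lambda)f(\lambda-2\eta)$, $(b(z)f)(\lambda)=b(z,\lambda)f(\lambda+2\eta)$, $(d(z)f)(\lambda)=d(z,\lambda)f(\lambda+2\eta)$, and $T(z)=a(z)+d(z)$. Let $m,n\ge0$ be integers, $z_1,\dots,z_n,\Lambda_1,\dots,\Lambda_n\in\mathbb C$ with $\Lambda=\sum_j\Lambda_j=2m$, and set $p_j=z_j+\eta(1-\Lambda_j)$, $q_j=z_j+\eta(1+\Lambda_j)$.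 Let $c\in\mathbb C$ and let $t_1,\dots,t_m\in\mathbb C$, pairwise distinct modulo $\mathbb Z+\tau\mathbb Z$, be a solution of the Bethe ansatz equations $$\prod_{j\ne i}\frac{\theta(t_j-t_i-2\eta)}{\theta(t_j-t_i+2\eta)}\prod_{k=1}^n\frac{\theta(t_i-q_k)}{\theta(t_i-p_k)}=e^{4\eta c},\qquad i=1,\dots,m.$$ **Statement.** There is a function $\varepsilon:\mathbb C\to\mathbb C$, with $$\varepsilon(w)=e^{-2\eta c}\prod_{j=1}^m\frac{\theta(t_j-w-2\eta)}{\theta(t_j-w)}+e^{2\eta c}\prod_{j=1}^m\frac{\theta(t_j-w+2\eta)}{\theta(t_j-w)}\prod_{k=1}^n\frac{\theta(w-p_k)}{\theta(w-q_k)}$$ whenever $w\not\equiv t_j,q_k$ modulo $\mathbb Z+\tau\mathbb Z$ for all $j,k$, such that the following hold. 1. Let $W$ be a module with a highest weight vector $v_0$ (in particular, any highest weight module), that is, a non-zero meromorphic function $v_0(\lambda)$ with values in $W[\Lambda]$ such that $c(z)v_0=0$, $a(z)v_0=v_0$ and $d(z)v_0=\frac{\theta(\lambda-2\eta\Lambda)}{\theta(\lambda)}\prod_{j}\frac{\theta(z-p_j)}{\theta(z-q_j)}\,v_0$.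 Assume that the operators $b(t_i)$ are defined (no $L$-matrix entry $b(z,\lambda)$ on a weight space has a pole along the whole line $z=t_i$). Let $v(\lambda)=e^{c\lambda}\prod_{j=1}^m\theta(\lambda-2\eta j)\,v_0(\lambda)$ and $\psi=b(t_1)\cdots b(t_m)v$. Then for generic $\mu$ (all $\mu$ outside a countable set), with $C_\mu=\mu+2\eta\mathbb Z$ and $\operatorname{Fun}_\mu(W)[0]$ the space of all functions $C_\mu\to W[0]$: the operator $T(w)$ is well-defined on $\operatorname{Fun}_\mu(W)[0]$ for all $w$ outside a countable set; $\psi$ has no poles on $C_\mu$, and $\psi|_{C_\mu}\in\operatorname{Fun}_\mu(W)[0]$ is a common eigenfunction: $T(w)\,\psi|_{C_\mu}=\varepsilon(w)\,\psi|_{C_\mu}$ for every $w$ for which $T(w)$ is well-defined on $\operatorname{Fun}_\mu(W)[0]$; and $\psi|_{C_\mu}\neq0$ unless $\psi$ is identically zero. 2. If $\theta(2\eta)\ne0$ and $W=V_{\Lambda_1}(z_1)\otimes\cdots\otimes V_{\Lambda_n}(z_n)$ is a tensor product of evaluation Verma modules with $v_0$ the product of the highest weight vectors $e_0$, then $\psi$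 is not identically zero. (Here $V_{\Lambda}(z_0)$ has basis $e_0,e_1,\dots$ with $he_k=(\Lambda-2k)e_k$, and, with $y=z-z_0$ and $N=\theta(y-(\Lambda+1)\eta)\theta(\lambda)$, $a(z,\lambda)e_k=N^{-1}\theta(y-(\Lambda+1-2k)\eta)\theta(\lambda+2k\eta)e_k$, $b(z,\lambda)e_k=-N^{-1}\theta(\lambda+y-(\Lambda-1-2k)\eta)\theta(2\eta)e_{k+1}$, $c(z,\lambda)e_k=N^{-1}\theta(y-\lambda+(\Lambda+1-2k)\eta)\frac{\theta(2(\Lambda+1-k)\eta)\theta(2k\eta)}{\theta(2\eta)}e_{k-1}$, $d(z,\lambda)e_k=N^{-1}\theta(y-(1-\Lambda+2k)\eta)\theta(\lambda-2(\Lambda-k)\eta)e_k$; the $L$-operator of a tensor product is $L_1^{(01)}(z,\lambda-2\eta\sum_{i>1}h^{(i)})\cdots L_n^{(0n)}(z,\lambda)$.) 3. (IRF models.) Let $\eta\neq0$ and $\Lambda_j=1$ for all $j$ (so $n=2m$), let $W=V^{\otimes n}$ with $L_j(z,\lambda)=R(z-z_j,\lambda)$ and $v_0=e[1]\otimes\cdots\otimes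 e[1]$. Define Boltzmann weights by $R(z,-2\eta d)\,e[c-d]\otimes e[b-c]=\sum_a w(a,b,c,d;z)\,e[b-a]\otimes e[a-d]$. For generic $\kappa$ (all $\kappa$ outside a countable set), and closed paths $a=(a_1,\dots,a_n,a_{n+1}=a_1)$ in $\kappa+\mathbb Z$ with $a_j-a_{j+1}=\pm1$, let $\Psi(a)$ be the coefficient of $\psi(-2\eta a_1)$ at $e[a_1-a_2]\otimes\cdots\otimes e[a_n-a_1]$. Then $\Psi$ is an eigenvector of the row-to-row transfer matrix: for all $w$ with $w\not\equiv q_k$ for all $k$, and all closed paths $b$, $$\sum_{a}\ \prod_{j=1}^n w(b_j,a_j,a_{j+1},b_{j+1};w-z_j)\,\Psi(a)=\varepsilon(w)\,\Psi(b),$$ the sum being over closed paths $a$ with $a_j-b_j=\pm1$ for all $j$; and $\Psi\ne0$ unless $\psi$ is identically zero. -/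

import Mathlib

open Filter Topology

noncomputable section

namespace EllipticBethe

/-! ### Theta function and dynamical R-matrix -/

/-- Jacobi's theta function
`θ(t) = -∑_{j ∈ ℤ} exp(πi (j+1/2)² τ + 2πi (j+1/2)(t+1/2))`. -/
def theta (τ t : ℂ) : ℂ :=
  -∑' j : ℤ, Complex.exp (Real.pi * Complex.I * ((j : ℂ) + 1 / 2) ^ 2 * τ
      + 2 * Real.pi * Complex.I * ((j : ℂ) + 1 / 2) * (t + 1 / 2))

/-- `α(z,λ) = θ(λ+2η)θ(z) / (θ(λ)θ(z-2η))`. -/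
def alphaFn (τ η z l : ℂ) : ℂ :=
  theta τ (l + 2 * η) * theta τ z / (theta τ l * theta τ (z - 2 * η))

/-- `β(z,λ) = -θ(λ+z)θ(2η) / (θ(λ)θ(z-2η))`. -/
def betaFn (τ η z l : ℂ) : ℂ :=
  -(theta τ (l + z) * theta τ (2 * η)) / (theta τ l * theta τ (z - 2 * η))

/-- The basis vectors `e[1]`, `e[-1]` of the two-dimensional space `V` are indexed by
`0, 1 : Fin 2`; `sgn` is the weight of `e[±1]`. -/
def sgn : Fin 2 → ℤ := ![1, -1]

/-- Matrix elements of the R-matrix: `R(z,λ) (e_α ⊗ e_β) = ∑_{γ,δ} (rMat z λ γ δ α β) e_γ ⊗ e_δ`.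
-/
def rMat (τ η z l : ℂ) (γ δ α β : Fin 2) : ℂ :=
  if γ = δ ∧ α = γ ∧ β = γ then 1
  else if γ = 0 ∧ δ = 1 ∧ α = 0 ∧ β = 1 then alphaFn τ η z l
  else if γ = 1 ∧ δ = 0 ∧ α = 1 ∧ β = 0 then alphaFn τ η z (-l)
  else if γ = 0 ∧ δ = 1 ∧ α = 1 ∧ β = 0 then betaFn τ η z l
  else if γ = 1 ∧ δ = 0 ∧ α = 0 ∧ β = 1 then betaFn τ η z (-l)
  else 0

/-! ### Meromorphic dependence on two variables

A meromorphic function is represented by a function which takes arbitrary values at its poles;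
identities between meromorphic functions are imposed at the points where everything is regular. -/

/-- `F` is meromorphic on `ℂ²`: near every point it is a quotient `f / g` of analytic functions,
where `g` does not vanish identically near that point. -/
def IsMeromorphic₂ (F : ℂ × ℂ → ℂ) : Prop :=
  ∀ p : ℂ × ℂ, ∃ f g : ℂ × ℂ → ℂ, AnalyticAt ℂ f p ∧ AnalyticAt ℂ g p ∧
    (∃ᶠ q in 𝓝 p, g q ≠ 0) ∧ ∀ᶠ q in 𝓝 p, g q ≠ 0 → F q = f q / g q

section
variable {W : Type*} [AddCommGroup W] [Module ℂ W]

/-- The matrix entry `(β, α)` of the family `L`, on the weight space `W[ν]` of `h`, is regular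
(jointly analytic) at the point `(z, λ)`. -/
def EntryRegularAt (h : Module.End ℂ W) (L : ℂ → ℂ → Fin 2 → Fin 2 → Module.End ℂ W)
    (β α : Fin 2) (ν z l : ℂ) : Prop :=
  ∀ u ∈ h.eigenspace ν, ∀ φ : Module.Dual ℂ W,
    AnalyticAt ℂ (fun p : ℂ × ℂ => φ (L p.1 p.2 β α u)) (z, l)

/-- A vector-valued function of `λ` is regular (analytic) at the point `l`. -/
def VecRegularAt (f : ℂ → W) (l : ℂ) : Prop :=
  ∀ φ : Module.Dual ℂ W, AnalyticAt ℂ (fun x => φ (f x)) l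

end

/-! ### Modules over the elliptic quantum group -/

/-- A module over `E_{τ,η}(sl₂)`: a diagonalizable `h`-module `W` with finite dimensional weight
spaces, with an `L`-operator `L(z,λ) ∈ End(V ⊗ W)`, written as a two by two matrix of operators on
`W`: `L(z,λ) (e_α ⊗ u) = ∑_β e_β ⊗ (L z λ β α) u`.  So `L z λ 0 0`, `L z λ 0 1`, `L z λ 1 0`,
`L z λ 1 1` are the coefficients of the operators `a(z)`, `b(z)`, `c(z)`, `d(z)`. -/
structure EModule (τ η : ℂ) (W : Type*) [AddCommGroup W] [Module ℂ W] where
  h : Module.End ℂ W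
  L : ℂ → ℂ → Fin 2 → Fin 2 → Module.End ℂ W
  iSup_weight : ⨆ ν : ℂ, h.eigenspace ν = ⊤
  finite_weight : ∀ ν : ℂ, FiniteDimensional ℂ (h.eigenspace ν)
  /-- `L(z,λ)` commutes with `h⁽¹⁾ + h⁽²⁾`. -/
  L_weight : ∀ (z l : ℂ) (β α : Fin 2) (ν : ℂ), ∀ u ∈ h.eigenspace ν,
    L z l β α u ∈ h.eigenspace (ν + sgn α - sgn β)
  L_merom : ∀ (β α : Fin 2) (u : W) (φ : Module.Dual ℂ W),
    IsMeromorphic₂ fun p => φ (L p.1 p.2 β α u)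
  /-- The relation
  `R⁽¹²⁾(z-w, λ-2ηh⁽³⁾) L⁽¹³⁾(z,λ) L⁽²³⁾(w, λ-2ηh⁽¹⁾)
    = L⁽²³⁾(w,λ) L⁽¹³⁾(z, λ-2ηh⁽²⁾) R⁽¹²⁾(z-w,λ)`,
  applied to `e_α ⊗ e_β ⊗ u` with `u ∈ W[ν]`, coefficient of `e_γ ⊗ e_δ`, at all points where all
  the factors are regular. -/
  rll : ∀ (z w l ν : ℂ), theta τ (z - w - 2 * η) ≠ 0 → theta τ l ≠ 0 →
    (∀ k : ℤ, theta τ (l - 2 * η * (ν + k)) ≠ 0) →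
    (∀ k ∈ ({-1, 0, 1} : Set ℤ), ∀ s ∈ ({-1, 0, 1} : Set ℤ), ∀ β α : Fin 2,
      EntryRegularAt h L β α (ν + 2 * k) z (l + 2 * η * s) ∧
      EntryRegularAt h L β α (ν + 2 * k) w (l + 2 * η * s)) →
    ∀ u ∈ h.eigenspace ν, ∀ γ δ α β : Fin 2,
      ∑ α' : Fin 2, ∑ β' : Fin 2,
          rMat τ η (z - w) (l - 2 * η * (ν + sgn α + sgn β - sgn α' - sgn β')) γ δ α' β' •
            L z l α' α (L w (l - 2 * η * sgn α) β' β u)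
        = ∑ α' : Fin 2, ∑ β' : Fin 2,
          rMat τ η (z - w) l α' β' α β •
            L w l δ β' (L z (l - 2 * η * sgn β') γ α' u)

/-! ### The parameters -/

/-- `p_j = z_j + η(1 - Λ_j)`. -/
def pPar {n : ℕ} (η : ℂ) (z Λ : Fin n → ℂ) (j : Fin n) : ℂ := z j + η * (-Λ j + 1)

/-- `q_j = z_j + η(1 + Λ_j)`. -/
def qPar {n : ℕ} (η : ℂ) (z Λ : Fin n → ℂ) (j : Fin n) : ℂ := z j + η * (Λ j + 1)

/-- The highest weight function
`D(x,λ) = θ(λ-2ηΛ)/θ(λ) ∏_j θ(x-p_j)/θ(x-q_j)`, where `Λ = ∑ Λ_j`. -/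
def highestD {n : ℕ} (τ η : ℂ) (z Λ : Fin n → ℂ) (x l : ℂ) : ℂ :=
  theta τ (l - 2 * η * ∑ j, Λ j) / theta τ l *
    ∏ j, theta τ (x - pPar η z Λ j) / theta τ (x - qPar η z Λ j)

/-- The function `e^{cλ} ∏_{j=1}^m θ(λ-2ηj)`. -/
def gFn (τ η c : ℂ) (m : ℕ) (l : ℂ) : ℂ :=
  Complex.exp (c * l) * ∏ j ∈ Finset.Icc 1 m, theta τ (l - 2 * η * j)

/-- `b(t₁) ⋯ b(t_m) v` for the difference operators `(b(t)f)(λ) = b(t,λ) f(λ+2η)`. -/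
def betheVector {W : Type*} [AddCommGroup W] [Module ℂ W] (η : ℂ)
    (b : ℂ → ℂ → Module.End ℂ W) (v : ℂ → W) : List ℂ → ℂ → W
  | [] => v
  | t :: ts => fun l => b t l (betheVector η b v ts (l + 2 * η))

/-- The Bethe ansatz equations. Since the right-hand side is not zero, they force all the theta
functions in the numerators and denominators to be non-zero. -/
def BetheEquations {n m : ℕ} (τ η : ℂ) (z Λ : Fin n → ℂ) (c : ℂ) (t : Fin m → ℂ) : Prop :=
  ∀ i, (∏ j ∈ Finset.univ.erase i,
        theta τ (t j - t i - 2 * η) / theta τ (t j - t i + 2 * η)) *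
      (∏ k, theta τ (t i - qPar η z Λ k) / theta τ (t i - pPar η z Λ k))
    = Complex.exp (4 * η * c)

/-- The eigenvalue `ε(w)`. -/
def betheEigenvalue {n m : ℕ} (τ η : ℂ) (z Λ : Fin n → ℂ) (c : ℂ) (t : Fin m → ℂ) (w : ℂ) : ℂ :=
  Complex.exp (-2 * η * c) * (∏ j, theta τ (t j - w - 2 * η) / theta τ (t j - w)) +
    Complex.exp (2 * η * c) * (∏ j, theta τ (t j - w + 2 * η) / theta τ (t j - w)) *
      ∏ k, theta τ (w - pPar η z Λ k) / theta τ (w - qPar η z Λ k)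

/-- The set `C_μ = {μ + 2ηj, j ∈ ℤ}`. -/
def latticeC (η μ : ℂ) : Set ℂ := {l | ∃ j : ℤ, l = μ + 2 * η * j}

theorem latticeC_sub {η μ l : ℂ} (hl : l ∈ latticeC η μ) : l - 2 * η ∈ latticeC η μ := by
  obtain ⟨j, rfl⟩ := hl
  exact ⟨j - 1, by push_cast; ring⟩

theorem latticeC_add {η μ l : ℂ} (hl : l ∈ latticeC η μ) : l + 2 * η ∈ latticeC η μ := by
  obtain ⟨j, rfl⟩ := hl
  exact ⟨j + 1, by push_cast; ring⟩

namespace EModule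

variable {τ η : ℂ} {W : Type*} [AddCommGroup W] [Module ℂ W] (M : EModule τ η W)

/-- `v₀ ∈ Fun(W)` is a highest weight vector of weight `(Λ, A, D)` with `A = 1` and `D` as in
`highestD`: it is a non-zero meromorphic function with values in `W[Λ]`, `Λ = ∑ Λ_j`, such that
`c(x)v₀ = 0`, `a(x)v₀ = v₀`, `d(x)v₀ = D(x,λ)v₀`, where `(a(x)f)(λ) = a(x,λ)f(λ-2η)`,
`(c(x)f)(λ) = c(x,λ)f(λ-2η)` and `(d(x)f)(λ) = d(x,λ)f(λ+2η)`. -/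
structure IsHighestWeightVector {n : ℕ} (z Λ : Fin n → ℂ) (v₀ : ℂ → W) : Prop where
  mem : ∀ l, v₀ l ∈ M.h.eigenspace (∑ j, Λ j)
  merom : ∀ φ : Module.Dual ℂ W, Meromorphic fun l => φ (v₀ l)
  ne_zero : ¬ (v₀ =ᶠ[codiscrete ℂ] 0)
  c_apply : ∀ x l, EntryRegularAt M.h M.L 1 0 (∑ j, Λ j) x l → VecRegularAt v₀ (l - 2 * η) →
    M.L x l 1 0 (v₀ (l - 2 * η)) = 0
  a_apply : ∀ x l, EntryRegularAt M.h M.L 0 0 (∑ j, Λ j) x l → VecRegularAt v₀ (l - 2 * η) →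
    VecRegularAt v₀ l → M.L x l 0 0 (v₀ (l - 2 * η)) = v₀ l
  d_apply : ∀ x l, EntryRegularAt M.h M.L 1 1 (∑ j, Λ j) x l → VecRegularAt v₀ (l + 2 * η) →
    VecRegularAt v₀ l → theta τ l ≠ 0 → (∀ j, theta τ (x - qPar η z Λ j) ≠ 0) →
    M.L x l 1 1 (v₀ (l + 2 * η)) = highestD τ η z Λ x l • v₀ l

/-- The operator `b(x)` on `Fun(W)` is defined: on each weight space, `x` is not in the singular
locus of the entry `b` for all but a discrete set of `λ`. -/
def BDefinedAt (x : ℂ) : Prop :=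
  ∀ ν : ℂ, ∀ᶠ l in codiscrete ℂ, EntryRegularAt M.h M.L 0 1 ν x l

/-- The Bethe vector `b(t₁)⋯b(t_m)v`, `v(λ) = e^{cλ} ∏_{j=1}^m θ(λ-2ηj) v₀(λ)`. -/
def bethe (v₀ : ℂ → W) (c : ℂ) {m : ℕ} (t : Fin m → ℂ) : ℂ → W :=
  betheVector η (fun x l => M.L x l 0 1) (fun l => gFn τ η c m l • v₀ l) (List.ofFn t)

/-- `Fun_μ(W)[0]`: all functions `C_μ → W[0]`. -/
abbrev FunZero (μ : ℂ) : Type _ := latticeC η μ → M.h.eigenspace (0 : ℂ)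

/-- The operator `T(w) = a(w) + d(w)` is well-defined on `Fun_μ(W)[0]`: its coefficients have no
poles at the points of `C_μ`. -/
def TransferDefinedOn (μ w : ℂ) : Prop :=
  ∀ l ∈ latticeC η μ, EntryRegularAt M.h M.L 0 0 0 w l ∧ EntryRegularAt M.h M.L 1 1 0 w l

theorem diag_mem (x l : ℂ) (α : Fin 2) (u : M.h.eigenspace (0 : ℂ)) :
    M.L x l α α u ∈ M.h.eigenspace (0 : ℂ) := by
  have := M.L_weight x l α α 0 u u.2
  simpa using this

/-- The transfer matrix `(T(w)f)(λ) = a(w,λ)f(λ-2η) + d(w,λ)f(λ+2η)` on `Fun_μ(W)[0]`. -/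
def transfer (μ w : ℂ) : Module.End ℂ (M.FunZero μ) where
  toFun f l :=
    ⟨M.L w l 0 0 (f ⟨(l : ℂ) - 2 * η, latticeC_sub l.2⟩), M.diag_mem _ _ _ _⟩ +
    ⟨M.L w l 1 1 (f ⟨(l : ℂ) + 2 * η, latticeC_add l.2⟩), M.diag_mem _ _ _ _⟩
  map_add' f g := by
    ext l
    simp only [Pi.add_apply, Submodule.coe_add, map_add]
    abel
  map_smul' r f := by
    ext l
    simp

end EModule

/-! ### Tensor products of modules with explicit bases -/

/-- The `L`-operator
`L(x,λ) = L₁⁽⁰¹⁾(x, λ-2η∑_{i>1}h⁽ⁱ⁾) ⋯ L_{n-1}⁽⁰ⁿ⁻¹⁾(x, λ-2ηh⁽ⁿ⁾) L_n⁽⁰ⁿ⁾(x,λ)` of a tensor product of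
`n` modules. All factors have bases labelled by `ι`, the `k`-th basis vector of the `j`-th factor
has weight `wt j k`, and
`L_j(x,λ)(e_α ⊗ e_k) = ∑_β (coef j x λ β α k) e_β ⊗ e_{next β α k}`.
The sum is over the values `σ` of the index of `V` between the factors. -/
def tensorL {ι : Type} {n : ℕ} (η : ℂ) (wt : Fin n → ι → ℂ) (next : Fin 2 → Fin 2 → ι → ι)
    (coef : Fin n → ℂ → ℂ → Fin 2 → Fin 2 → ι → ℂ) (x l : ℂ) (β α : Fin 2) :
    Module.End ℂ ((Fin n → ι) →₀ ℂ) :=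
  Finsupp.linearCombination ℂ fun k : Fin n → ι =>
    ∑ σ : Fin (n + 1) → Fin 2,
      if σ 0 = β ∧ σ (Fin.last n) = α then
        Finsupp.single (fun j => next (σ j.castSucc) (σ j.succ) (k j))
          (∏ j, coef j x
            (l - 2 * η * ∑ i ∈ Finset.Ioi j, wt i (next (σ i.castSucc) (σ i.succ) (k i)))
            (σ j.castSucc) (σ j.succ) (k j))
      else 0

/-- Matrix elements of the evaluation Verma module `V_Λ(z)` in the basis `e_0, e_1, e_2, …`, with
`h e_k = (Λ-2k) e_k`; here `y = x - z`. They are the coefficients of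
`a(x)e_k ∝ e_k`, `b(x)e_k ∝ e_{k+1}`, `c(x)e_k ∝ e_{k-1}`, `d(x)e_k ∝ e_k`. -/
def evalCoef (τ η Λ y l : ℂ) (β α : Fin 2) (k : ℕ) : ℂ :=
  (if β = 0 ∧ α = 0 then
    theta τ (y - (Λ + 1 - 2 * k) * η) * theta τ (l + 2 * k * η)
  else if β = 0 ∧ α = 1 then
    -(theta τ (l + y - (Λ - 1 - 2 * k) * η) * theta τ (2 * η))
  else if β = 1 ∧ α = 0 then
    theta τ (y - l + (Λ + 1 - 2 * k) * η) * theta τ (2 * (Λ + 1 - k) * η) * theta τ (2 * k * η)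
      / theta τ (2 * η)
  else
    theta τ (y - (1 - Λ + 2 * k) * η) * theta τ (l - 2 * (Λ - k) * η))
  / (theta τ (y - (Λ + 1) * η) * theta τ l)

/-- The `L`-operator of `V_{Λ_1}(z_1) ⊗ ⋯ ⊗ V_{Λ_n}(z_n)`. -/
def vermaL {n : ℕ} (τ η : ℂ) (z Λ : Fin n → ℂ) :
    ℂ → ℂ → Fin 2 → Fin 2 → Module.End ℂ ((Fin n → ℕ) →₀ ℂ) :=
  tensorL η (fun j k => Λ j - 2 * k) (fun β α k => k + (α : ℕ) - (β : ℕ))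
    (fun j x l β α k => evalCoef τ η (Λ j) (x - z j) l β α k)

/-- The Bethe vector in `V_{Λ_1}(z_1) ⊗ ⋯ ⊗ V_{Λ_n}(z_n)`, for `v₀ = e_0 ⊗ ⋯ ⊗ e_0`. -/
def vermaBethe {n m : ℕ} (τ η : ℂ) (z Λ : Fin n → ℂ) (c : ℂ) (t : Fin m → ℂ) :
    ℂ → ((Fin n → ℕ) →₀ ℂ) :=
  betheVector η (fun x l => vermaL τ η z Λ x l 0 1)
    (fun l => gFn τ η c m l • Finsupp.single 0 1) (List.ofFn t)

/-! ### Interaction-round-a-face models -/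

/-- The `L`-operator of the tensor product of the fundamental representations `V(z_j)`, for which
`L_j(x,λ) = R(x-z_j,λ)`. The matrix elements of `R` with `β ≠ α` vanish unless the second factor
goes from `e_β` to `e_α`. -/
def fundL {n : ℕ} (τ η : ℂ) (z : Fin n → ℂ) :
    ℂ → ℂ → Fin 2 → Fin 2 → Module.End ℂ ((Fin n → Fin 2) →₀ ℂ) :=
  tensorL η (fun _ k => (sgn k : ℂ)) (fun β α k => if β = α then k else α)
    (fun j x l β α k => rMat τ η (x - z j) l β (if β = α then k else α) α k)

/-- The Bethe vector in `V(z_1) ⊗ ⋯ ⊗ V(z_n)`, for `v₀ = e[1] ⊗ ⋯ ⊗ e[1]`. -/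
def fundBethe {n m : ℕ} (τ η : ℂ) (z : Fin n → ℂ) (c : ℂ) (t : Fin m → ℂ) :
    ℂ → ((Fin n → Fin 2) →₀ ℂ) :=
  betheVector η (fun x l => fundL τ η z x l 0 1)
    (fun l => gFn τ η c m l • Finsupp.single 0 1) (List.ofFn t)

/-- The index of the basis vector `e[s]`, `s = ±1`. -/
def idx (s : ℤ) : Fin 2 := if s = 1 then 0 else 1

/-- The Boltzmann weight `w(κ+a, κ+b, κ+c, κ+d; x)`, defined by
`R(x, -2η(κ+d)) e[c-d] ⊗ e[b-c] = ∑_a w(κ+a, κ+b, κ+c, κ+d; x) e[b-a] ⊗ e[a-d]`. The heights of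
the model are the numbers `κ + a` with `a ∈ ℤ`. -/
def boltzmann (τ η κ : ℂ) (a b c d : ℤ) (x : ℂ) : ℂ :=
  rMat τ η x (-2 * η * (κ + d)) (idx (b - a)) (idx (a - d)) (idx (c - d)) (idx (b - c))

/-- `(a_1, …, a_n, a_{n+1} = a_1)` is a closed path: neighbouring heights differ by `±1`. -/
def IsClosedPath {n : ℕ} (a : Fin (n + 1) → ℤ) : Prop :=
  a 0 = a (Fin.last n) ∧ ∀ j : Fin n, |a j.castSucc - a j.succ| = 1

open Classical in
/-- The row-to-row transfer matrix
`∑_a (∏_j w(b_j, a_j, a_{j+1}, b_{j+1}; x-z_j)) Ψ(a)` of the inhomogeneous IRF model. The sum is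
over the closed paths `a` with `a_j - b_j = ±1` for all `j`. -/
def irfTransfer {n : ℕ} (τ η κ : ℂ) (z : Fin n → ℂ) (x : ℂ) (Ψ : (Fin (n + 1) → ℤ) → ℂ)
    (b : Fin (n + 1) → ℤ) : ℂ :=
  ∑ s : Fin (n + 1) → Fin 2,
    let a : Fin (n + 1) → ℤ := fun j => b j + sgn (s j)
    if IsClosedPath a then
      (∏ j : Fin n, boltzmann τ η κ (b j.castSucc) (a j.castSucc) (a j.succ) (b j.succ) (x - z j))
        * Ψ a
    else 0

/-- The coefficients `Ψ(a)` of `ψ = ∑_a Ψ(a)|a⟩`, where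
`|a⟩(λ) = δ(λ+2ηa_1) e[a_1-a_2] ⊗ ⋯ ⊗ e[a_n-a_1]` and the heights are `κ + a_j`. -/
def pathCoeff {n : ℕ} (η κ : ℂ) (ψ : ℂ → ((Fin n → Fin 2) →₀ ℂ)) (a : Fin (n + 1) → ℤ) : ℂ :=
  ψ (-2 * η * (κ + a 0)) fun j => idx (a j.castSucc - a j.succ)

end EllipticBethe

end

noncomputable section

namespace EllipticBethe

/-! ### Theta functions -/

theorem theta_eq_jacobiTheta₂ (τ t : ℂ) :
    theta τ t = -(Complex.exp (Real.pi * Complex.I * (τ / 4 + (t + 1 / 2))) *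
      jacobiTheta₂ (t + 1 / 2 + τ / 2) τ) := by
  unfold theta jacobiTheta₂ jacobiTheta₂_term
  rw [← tsum_mul_left]
  congr 2
  ext j
  rw [← Complex.exp_add]
  congr 1
  ring

theorem theta_add_one (τ t : ℂ) : theta τ (t + 1) = -theta τ t := by
  rw [theta_eq_jacobiTheta₂, theta_eq_jacobiTheta₂,
    show t + 1 + 1 / 2 + τ / 2 = (t + 1 / 2 + τ / 2) + 1 by ring, jacobiTheta₂_add_left,
    show (Real.pi * Complex.I * (τ / 4 + (t + 1 + 1 / 2)) : ℂ)
      = Real.pi * Complex.I * (τ / 4 + (t + 1 / 2)) + Real.pi * Complex.I by ring,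
    Complex.exp_add, Complex.exp_pi_mul_I]
  ring

theorem theta_add_tau (τ t : ℂ) :
    theta τ (t + τ) = -(Complex.exp (-Real.pi * Complex.I * (τ + 2 * t)) * theta τ t) := by
  rw [theta_eq_jacobiTheta₂, theta_eq_jacobiTheta₂,
    show t + τ + 1 / 2 + τ / 2 = (t + 1 / 2 + τ / 2) + τ by ring, jacobiTheta₂_add_left',
    mul_neg, ← mul_assoc, ← mul_assoc, ← Complex.exp_add, ← Complex.exp_add, neg_neg,
    ← neg_mul]
  congr 1
  have : (Real.pi * Complex.I * (τ / 4 + (t + τ + 1 / 2)) +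
      -Real.pi * Complex.I * (τ + 2 * (t + 1 / 2 + τ / 2)) : ℂ)
      = (-Real.pi * Complex.I * (τ + 2 * t) + Real.pi * Complex.I * (τ / 4 + (t + 1 / 2)))
        - Real.pi * Complex.I := by ring
  rw [this, Complex.exp_sub, Complex.exp_pi_mul_I, div_neg, div_one, neg_neg]

theorem theta_neg (τ t : ℂ) : theta τ (-t) = -theta τ t := by
  unfold theta
  congr 1
  rw [← tsum_neg, ← (Equiv.subLeft (-1 : ℤ)).tsum_eq]
  refine tsum_congr fun j => ?_
  rw [← neg_one_mul (Complex.exp _), ← Complex.exp_pi_mul_I, ← Complex.exp_add,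
    Complex.exp_eq_exp_iff_exists_int]
  refine ⟨-j - 1, ?_⟩
  simp only [Equiv.subLeft_apply]
  push_cast
  ring

@[simp] theorem theta_zero (τ : ℂ) : theta τ 0 = 0 := by
  have h := theta_neg τ 0
  rw [neg_zero] at h
  exact self_eq_neg.1 h

theorem theta_sub_comm (τ x y : ℂ) : theta τ (x - y) = -theta τ (y - x) := by
  rw [← theta_neg, neg_sub]

theorem differentiable_theta {τ : ℂ} (hτ : 0 < τ.im) : Differentiable ℂ (theta τ) := by
  have : theta τ = fun t => -(Complex.exp (Real.pi * Complex.I * (τ / 4 + (t + 1 / 2))) *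
      jacobiTheta₂ (t + 1 / 2 + τ / 2) τ) := funext (theta_eq_jacobiTheta₂ τ)
  rw [this]
  intro t
  have h1 : DifferentiableAt ℂ (fun t : ℂ => jacobiTheta₂ (t + 1 / 2 + τ / 2) τ) t :=
    (differentiableAt_jacobiTheta₂_fst (t + 1 / 2 + τ / 2) hτ).comp
      (f := fun t : ℂ => t + 1 / 2 + τ / 2) t (by fun_prop)
  fun_prop

theorem analyticAt_theta {τ : ℂ} (hτ : 0 < τ.im) (t : ℂ) : AnalyticAt ℂ (theta τ) t :=
  (differentiable_theta hτ).analyticAt t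

/-- `∑_{p even} e^{πiτp²/2 + 2πipx}`. -/
def thetaEven (τ x : ℂ) : ℂ := ∑' a : ℤ, jacobiTheta₂_term a (2 * x) (2 * τ)

/-- `∑_{p odd} e^{πiτp²/2 + 2πipx}`. -/
def thetaOdd (τ x : ℂ) : ℂ :=
  ∑' a : ℤ, Complex.exp (Real.pi * Complex.I * (τ / 2 + 2 * x)) *
    jacobiTheta₂_term a (2 * x + τ) (2 * τ)

theorem theta_mul_theta {τ : ℂ} (hτ : 0 < τ.im) (x y : ℂ) :
    theta τ (x + y) * theta τ (x - y) =
      thetaEven τ x * thetaOdd τ y - thetaOdd τ x * thetaEven τ y := by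
  have h2τ : 0 < (2 * τ).im := by simpa using hτ
  set T : ℂ → ℤ → ℂ := fun t j => Complex.exp (Real.pi * Complex.I * ((j : ℂ) + 1 / 2) ^ 2 * τ
      + 2 * Real.pi * Complex.I * ((j : ℂ) + 1 / 2) * (t + 1 / 2)) with hT
  have hTs : ∀ t, Summable fun j => ‖T t j‖ := by
    intro t
    have h1 := ((summable_jacobiTheta₂_term_iff (t + 1 / 2 + τ / 2) τ).2 hτ).mul_left
      (Complex.exp (Real.pi * Complex.I * (τ / 4 + (t + 1 / 2))))
    refine (h1.congr fun j => ?_).norm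
    rw [jacobiTheta₂_term, ← Complex.exp_add]
    simp only [hT]
    congr 1
    ring
  set E : ℂ → ℤ → ℂ := fun x a => jacobiTheta₂_term a (2 * x) (2 * τ) with hE
  set O : ℂ → ℤ → ℂ := fun x a => Complex.exp (Real.pi * Complex.I * (τ / 2 + 2 * x)) *
    jacobiTheta₂_term a (2 * x + τ) (2 * τ) with hO
  have hEs : ∀ x, Summable fun a => ‖E x a‖ := fun x =>
    ((summable_jacobiTheta₂_term_iff (2 * x) (2 * τ)).2 h2τ).norm
  have hOs : ∀ x, Summable fun a => ‖O x a‖ := fun x =>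
    (((summable_jacobiTheta₂_term_iff (2 * x + τ) (2 * τ)).2 h2τ).mul_left _).norm
  have hlhs : theta τ (x + y) * theta τ (x - y) = ∑' p : ℤ × ℤ, T (x + y) p.1 * T (x - y) p.2 := by
    rw [← tsum_mul_tsum_of_summable_norm (hTs _) (hTs _)]
    simp only [theta, hT, neg_mul_neg]
  have hr1 : thetaEven τ x * thetaOdd τ y = ∑' p : ℤ × ℤ, E x p.1 * O y p.2 := by
    rw [← tsum_mul_tsum_of_summable_norm (hEs _) (hOs _)]
    rfl
  have hr2 : thetaOdd τ x * thetaEven τ y = ∑' p : ℤ × ℤ, O x p.1 * E y p.2 := by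
    rw [← tsum_mul_tsum_of_summable_norm (hOs _) (hEs _)]
    rfl
  have hs := summable_mul_of_summable_norm (hTs (x + y)) (hTs (x - y))
  have hs1 := summable_mul_of_summable_norm (hEs x) (hOs y)
  have hs2 := summable_mul_of_summable_norm (hOs x) (hEs y)
  let e : (ℤ × ℤ) ⊕ (ℤ × ℤ) ≃ ℤ × ℤ :=
    { toFun := Sum.elim (fun p => (p.1 + p.2, p.1 - p.2 - 1)) (fun p => (p.1 + p.2, p.1 - p.2))
      invFun := fun p => if (p.1 + p.2) % 2 = 0 then
          Sum.inr ((p.1 + p.2) / 2, (p.1 - p.2) / 2)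
        else Sum.inl ((p.1 + p.2 + 1) / 2, (p.1 - p.2 - 1) / 2)
      left_inv := by
        rintro (⟨a, b⟩ | ⟨a, b⟩)
        · have h1 : ¬ (a + b + (a - b - 1)) % 2 = 0 := by omega
          simp only [Sum.elim_inl, h1, if_false, Sum.inl.injEq, Prod.mk.injEq]
          omega
        · have h1 : (a + b + (a - b)) % 2 = 0 := by omega
          simp only [Sum.elim_inr, h1, if_true, Sum.inr.injEq, Prod.mk.injEq]
          omega
      right_inv := by
        rintro ⟨j, k⟩
        by_cases h : (j + k) % 2 = 0
        · simp only [h, if_true, Sum.elim_inr, Prod.mk.injEq]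
          omega
        · simp only [h, if_false, Sum.elim_inl, Prod.mk.injEq]
          omega }
  have he1 : ∀ p : ℤ × ℤ, T (x + y) (e (Sum.inl p)).1 * T (x - y) (e (Sum.inl p)).2
      = E x p.1 * O y p.2 := by
    rintro ⟨a, b⟩
    simp only [e, hT, hE, hO, Equiv.coe_fn_mk, Sum.elim_inl, jacobiTheta₂_term, ← Complex.exp_add]
    rw [Complex.exp_eq_exp_iff_exists_int]
    refine ⟨a, ?_⟩
    push_cast
    ring
  have he2 : ∀ p : ℤ × ℤ, T (x + y) (e (Sum.inr p)).1 * T (x - y) (e (Sum.inr p)).2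
      = -(O x p.1 * E y p.2) := by
    rintro ⟨a, b⟩
    simp only [e, hT, hE, hO, Equiv.coe_fn_mk, Sum.elim_inr, jacobiTheta₂_term, ← Complex.exp_add]
    rw [← neg_one_mul (Complex.exp _), ← Complex.exp_pi_mul_I, ← Complex.exp_add,
      Complex.exp_eq_exp_iff_exists_int]
    refine ⟨a, ?_⟩
    push_cast
    ring
  rw [hlhs, hr1, hr2, ← e.tsum_eq, Summable.tsum_sum (f := fun c => T (x + y) (e c).1 *
      T (x - y) (e c).2)]
  · simp only [he1, he2, tsum_neg, ← sub_eq_add_neg]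
  · exact hs1.congr fun p => (he1 p).symm
  · exact hs2.neg.congr fun p => (he2 p).symm

/-- The three-term identity for theta functions. -/
theorem theta_three_term {τ : ℂ} (hτ : 0 < τ.im) (x y z w : ℂ) :
    theta τ (x + z) * theta τ (x - z) * (theta τ (y + w) * theta τ (y - w)) =
      theta τ (x + y) * theta τ (x - y) * (theta τ (z + w) * theta τ (z - w)) +
      theta τ (x + w) * theta τ (x - w) * (theta τ (y + z) * theta τ (y - z)) := by
  simp only [theta_mul_theta hτ]
  ring

theorem exists_jacobiTheta₂_ne_zero {τ : ℂ} (hτ : 0 < τ.im) : ∃ z, jacobiTheta₂ z τ ≠ 0 := by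
  by_contra! h
  let f : ℤ → C(ℝ, ℂ) := fun n => ⟨fun x => jacobiTheta₂_term n x τ, by
    unfold jacobiTheta₂_term; fun_prop⟩
  have hnorm : ∀ (n : ℤ) (x : ℝ), ‖f n x‖ = ‖jacobiTheta₂_term n 0 τ‖ := by
    intro n x
    simp [f, norm_jacobiTheta₂_term]
  have hs : Summable fun n => ‖(f n).restrict (⟨Set.uIcc 0 1, isCompact_uIcc⟩ :
      TopologicalSpace.Compacts ℝ)‖ := by
    refine Summable.of_nonneg_of_le (fun _ => norm_nonneg _) (fun n => ?_)
      (((summable_jacobiTheta₂_term_iff 0 τ).2 hτ).norm)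
    rw [ContinuousMap.norm_le _ (norm_nonneg _)]
    intro x
    exact (hnorm n x).le
  have hsum := intervalIntegral.hasSum_intervalIntegral_of_summable_norm (a := 0) (b := 1) hs
  have h0 : ∀ x : ℝ, ∑' n, f n x = 0 := fun x => h x
  simp only [h0, intervalIntegral.integral_zero] at hsum
  have hint : ∀ n : ℤ, ∫ x in (0 : ℝ)..1, f n x = if n = 0 then 1 else 0 := by
    intro n
    by_cases hn : n = 0
    · subst hn
      simp [f, jacobiTheta₂_term]
    · have hc : (2 * Real.pi * Complex.I * n : ℂ) ≠ 0 := by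
        simp [Real.pi_ne_zero, hn]
      have : ∀ x : ℝ, f n x = Complex.exp (Real.pi * Complex.I * n ^ 2 * τ) *
          Complex.exp ((2 * Real.pi * Complex.I * n) * x) := by
        intro x
        simp only [f, ContinuousMap.coe_mk, jacobiTheta₂_term]
        rw [← Complex.exp_add]
        congr 1
        ring
      simp only [this, hn, if_false]
      rw [intervalIntegral.integral_const_mul, integral_exp_mul_complex hc]
      have h1 : Complex.exp (2 * Real.pi * Complex.I * n * (1 : ℝ)) = 1 := by
        rw [Complex.exp_eq_one_iff]
        exact ⟨n, by push_cast; ring⟩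
      rw [h1]
      simp
  simp only [hint] at hsum
  have := hsum.unique (hasSum_ite_eq (0 : ℤ) (1 : ℂ))
  simp at this

theorem exists_theta_ne_zero {τ : ℂ} (hτ : 0 < τ.im) : ∃ t, theta τ t ≠ 0 := by
  obtain ⟨z, hz⟩ := exists_jacobiTheta₂_ne_zero hτ
  refine ⟨z - 1 / 2 - τ / 2, ?_⟩
  rw [theta_eq_jacobiTheta₂, show z - 1 / 2 - τ / 2 + 1 / 2 + τ / 2 = z by ring]
  exact neg_ne_zero.2 (mul_ne_zero (Complex.exp_ne_zero _) hz)

theorem eventually_theta_ne_zero {τ : ℂ} (hτ : 0 < τ.im) (t : ℂ) :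
    ∀ᶠ x in 𝓝[≠] t, theta τ x ≠ 0 := by
  refine (analyticAt_theta hτ t).eventually_eq_zero_or_eventually_ne_zero.resolve_left fun h => ?_
  obtain ⟨x, hx⟩ := exists_theta_ne_zero hτ
  have han : AnalyticOnNhd ℂ (theta τ) Set.univ := fun y _ => analyticAt_theta hτ y
  have := han.eqOn_zero_of_preconnected_of_eventuallyEq_zero isPreconnected_univ
    (Set.mem_univ t) h
  exact hx (this (Set.mem_univ x))

theorem eventually_theta_add_ne_zero {τ : ℂ} (hτ : 0 < τ.im) (a t : ℂ) :
    ∀ᶠ x in 𝓝[≠] t, theta τ (x + a) ≠ 0 := by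
  have : Tendsto (fun x => x + a) (𝓝[≠] t) (𝓝[≠] (t + a)) := by
    refine tendsto_nhdsWithin_iff.2 ⟨?_, ?_⟩
    · exact ((continuous_id.add continuous_const).tendsto t).mono_left nhdsWithin_le_nhds
    · filter_upwards [self_mem_nhdsWithin] with x hx
      simpa using hx
  exact this.eventually (eventually_theta_ne_zero hτ (t + a))

/-- If `θ(a) = 0`, then `θ(u) / θ(u-a)` is an exponential function. -/
theorem theta_eq_exp_mul_of_theta_eq_zero {τ : ℂ} (hτ : 0 < τ.im) {a : ℂ} (ha : theta τ a = 0) :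
    ∃ s B : ℂ, theta τ s ≠ 0 ∧ theta τ (s - a) ≠ 0 ∧
      ∀ u, theta τ u * theta τ (s - a) =
        theta τ s * Complex.exp (B * (u - s)) * theta τ (u - a) := by
  have hid : ∀ u v e : ℂ, theta τ u * theta τ v * (theta τ (u + e - a) * theta τ (v - e - a)) =
      theta τ (u + e) * theta τ (v - e) * (theta τ (u - a) * theta τ (v - a)) := by
    intro u v e
    have h := theta_three_term hτ ((u + v) / 2) (a - (u + v) / 2) ((u - v) / 2) ((u - v) / 2 + e)
    rw [show (u + v) / 2 + (u - v) / 2 = u by ring, show (u + v) / 2 - (u - v) / 2 = v by ring,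
      show a - (u + v) / 2 + ((u - v) / 2 + e) = -(v - e - a) by ring,
      show a - (u + v) / 2 - ((u - v) / 2 + e) = -(u + e - a) by ring,
      show (u + v) / 2 + (a - (u + v) / 2) = a by ring,
      show (u + v) / 2 + ((u - v) / 2 + e) = u + e by ring,
      show (u + v) / 2 - ((u - v) / 2 + e) = v - e by ring,
      show a - (u + v) / 2 + (u - v) / 2 = -(v - a) by ring,
      show a - (u + v) / 2 - (u - v) / 2 = -(u - a) by ring, ha] at h
    simp only [theta_neg] at h
    linear_combination h
  have hd : ∀ x, HasDerivAt (theta τ) (deriv (theta τ) x) x := fun x =>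
    (differentiable_theta hτ x).hasDerivAt
  have hd1 : ∀ x b, HasDerivAt (fun e => theta τ (x + e - b)) (deriv (theta τ) (x - b)) 0 := by
    intro x b
    have := (hd (x - b)).comp_of_eq (0 : ℂ) (((hasDerivAt_id (0 : ℂ)).const_add x).sub_const b)
      (by simp)
    simpa using! this
  have hd2 : ∀ x b, HasDerivAt (fun e => theta τ (x - e - b)) (-deriv (theta τ) (x - b)) 0 := by
    intro x b
    have := (hd (x - b)).comp_of_eq (0 : ℂ) (((hasDerivAt_id (0 : ℂ)).const_sub x).sub_const b)
      (by simp)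
    simpa using! this
  have hW : ∀ u v, theta τ u * theta τ v * (deriv (theta τ) (u - a) * theta τ (v - a) -
        theta τ (u - a) * deriv (theta τ) (v - a)) =
      (deriv (theta τ) u * theta τ v - theta τ u * deriv (theta τ) v) *
        (theta τ (u - a) * theta τ (v - a)) := by
    intro u v
    have h1 := ((hd1 u a).mul (hd2 v a)).const_mul (theta τ u * theta τ v)
    have h2 := ((hd1 u 0).mul (hd2 v 0)).mul_const (theta τ (u - a) * theta τ (v - a))
    have h3 := h1.unique (h2.congr_of_eventuallyEq (Eventually.of_forall fun e => by
      simpa using! hid u v e))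
    simp only [add_zero, sub_zero] at h3
    linear_combination h3
  obtain ⟨s, hs1, hs2⟩ := ((eventually_theta_ne_zero hτ 0).and
    (eventually_theta_add_ne_zero hτ (-a) 0)).exists
  rw [← sub_eq_add_neg] at hs2
  set B : ℂ := deriv (theta τ) s / theta τ s - deriv (theta τ) (s - a) / theta τ (s - a) with hB
  have hODE : ∀ u, deriv (theta τ) u * theta τ (u - a) - theta τ u * deriv (theta τ) (u - a) =
      B * (theta τ u * theta τ (u - a)) := by
    intro u
    have h := hW u s
    rw [hB]
    field_simp
    linear_combination -h
  refine ⟨s, B, hs1, hs2, ?_⟩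
  have hr : ∀ u, theta τ (u - a) ≠ 0 →
      HasDerivAt (fun u => theta τ u * Complex.exp (-(B * (u - s))) / theta τ (u - a)) 0 u := by
    intro u hu
    have he : HasDerivAt (fun u : ℂ => Complex.exp (-(B * (u - s))))
        (Complex.exp (-(B * (u - s))) * (-(B * 1))) u :=
      ((((hasDerivAt_id u).sub_const s).const_mul B).neg).cexp
    have hk : HasDerivAt (fun u => theta τ (u - a)) (deriv (theta τ) (u - a)) u := by
      simpa using! (hd (u - a)).comp_sub_const u a
    refine (((hd u).mul he).div hk hu).congr_deriv ?_
    rw [div_eq_zero_iff]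
    left
    simp only [Pi.mul_apply]
    linear_combination Complex.exp (-(B * (u - s))) * hODE u
  have hopen : {u | theta τ (u - a) ≠ 0} ∈ 𝓝 s :=
    (((differentiable_theta hτ).continuous.comp (continuous_id.sub
        continuous_const)).isOpen_preimage
      _ isOpen_compl_singleton).mem_nhds hs2
  obtain ⟨r, hr0, hball⟩ := Metric.mem_nhds_iff.1 hopen
  have hconst : ∀ u ∈ Metric.ball s r,
      theta τ u * theta τ (s - a) = theta τ s * Complex.exp (B * (u - s)) * theta τ (u - a) := by
    intro u hu
    have := Metric.isOpen_ball.is_const_of_deriv_eq_zero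
      (f := fun u => theta τ u * Complex.exp (-(B * (u - s))) / theta τ (u - a))
      (convex_ball s r).isPreconnected
      (fun x hx => (hr x (hball hx)).differentiableAt.differentiableWithinAt)
      (fun x hx => (hr x (hball hx)).deriv) hu (Metric.mem_ball_self hr0)
    have hu' : theta τ (u - a) ≠ 0 := hball hu
    simp only [sub_self, mul_zero, neg_zero, Complex.exp_zero, mul_one] at this
    rw [Complex.exp_neg] at this
    have hE := Complex.exp_ne_zero (B * (u - s))
    field_simp at this
    linear_combination this
  have h1 : AnalyticOnNhd ℂ (fun u => theta τ u * theta τ (s - a)) Set.univ :=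
    fun u _ => ((analyticAt_theta hτ u).mul analyticAt_const)
  have h2 : AnalyticOnNhd ℂ (fun u => theta τ s * Complex.exp (B * (u - s)) * theta τ (u - a))
      Set.univ := by
    have : Differentiable ℂ fun u => theta τ s * Complex.exp (B * (u - s)) * theta τ (u - a) := by
      have := differentiable_theta hτ
      fun_prop
    exact fun u _ => this.analyticAt u
  exact fun u => congrFun (h1.eq_of_eventuallyEq h2 (z₀ := s)
    (eventually_of_mem (Metric.ball_mem_nhds s hr0) hconst)) u

theorem theta_eq_zero_iff {τ : ℂ} (hτ : 0 < τ.im) {a : ℂ} :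
    theta τ a = 0 ↔ ∃ r s : ℤ, a = r + s * τ := by
  constructor
  · intro ha
    obtain ⟨s, B, h1, h2, h⟩ := theta_eq_exp_mul_of_theta_eq_zero hτ ha
    have hone := h (s + 1)
    have htau := h (s + τ)
    rw [theta_add_one, show s + 1 - a = s - a + 1 by ring, theta_add_one,
      show B * (s + 1 - s) = B by ring] at hone
    rw [theta_add_tau, show s + τ - a = s - a + τ by ring, theta_add_tau,
      show B * (s + τ - s) = B * τ by ring] at htau
    have hB : Complex.exp B = 1 := by
      have : theta τ s * theta τ (s - a) * (Complex.exp B - 1) = 0 := by linear_combination hone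
      simpa [h1, h2, sub_eq_zero] using this
    have hE : Complex.exp (-Real.pi * Complex.I * (τ + 2 * s)) =
        Complex.exp (B * τ) * Complex.exp (-Real.pi * Complex.I * (τ + 2 * (s - a))) := by
      have : theta τ s * theta τ (s - a) * (Complex.exp (-Real.pi * Complex.I * (τ + 2 * s)) -
        Complex.exp (B * τ) * Complex.exp (-Real.pi * Complex.I * (τ + 2 * (s - a)))) = 0 := by
        linear_combination -htau
      simpa [h1, h2, sub_eq_zero] using this
    obtain ⟨k, hk⟩ := Complex.exp_eq_one_iff.1 hB
    rw [← Complex.exp_add, Complex.exp_eq_exp_iff_exists_int] at hE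
    obtain ⟨j, hj⟩ := hE
    refine ⟨-j, -k, ?_⟩
    have h2pi : (2 * Real.pi * Complex.I : ℂ) ≠ 0 := by simp [Real.pi_ne_zero]
    refine mul_left_cancel₀ h2pi ?_
    rw [hk] at hj
    push_cast
    linear_combination -hj
  · rintro ⟨r, s, rfl⟩
    have hτs : ∀ (k : ℕ) (t : ℂ), theta τ t = 0 → theta τ (t + k * τ) = 0 := by
      intro k t ht
      induction k with
      | zero => simpa using ht
      | succ k ih =>
        rw [show t + (k + 1 : ℕ) * τ = t + k * τ + τ by push_cast; ring, theta_add_tau, ih]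
        simp
    have h1s : ∀ (k : ℕ) (t : ℂ), theta τ t = 0 → theta τ (t + k) = 0 := by
      intro k t ht
      induction k with
      | zero => simpa using ht
      | succ k ih =>
        rw [show t + (k + 1 : ℕ) = t + k + 1 by push_cast; ring, theta_add_one, ih]
        simp
    have key : ∀ r s : ℕ, theta τ (r + s * τ) = 0 ∧ theta τ (r - s * τ) = 0 := by
      intro r s
      have h0 : theta τ (s * τ) = 0 := by simpa using hτs s 0 (theta_zero τ)
      refine ⟨?_, ?_⟩
      · simpa [add_comm] using h1s r _ h0
      · rw [show (r - s * τ : ℂ) = -(s * τ) + r by ring]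
        exact h1s r _ (by rw [theta_neg, h0, neg_zero])
    obtain ⟨r', rfl | rfl⟩ := r.eq_nat_or_neg <;> obtain ⟨s', rfl | rfl⟩ := s.eq_nat_or_neg
    · simpa using (key r' s').1
    · simpa [← sub_eq_add_neg] using (key r' s').2
    · rw [← neg_eq_zero, ← theta_neg]
      have := (key r' s').2
      convert this using 2
      push_cast
      ring
    · rw [← neg_eq_zero, ← theta_neg]
      have := (key r' s').1
      convert this using 2
      push_cast
      ring

/-! ### Algebraic Bethe ansatz -/

section
variable {W : Type*} [AddCommGroup W] [Module ℂ W]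

/-- The `RLL` relation applied to the vector `u` of weight `ν`. -/
def RLLRelation (τ η : ℂ) (L : ℂ → ℂ → Fin 2 → Fin 2 → Module.End ℂ W) (z w l ν : ℂ) (u : W) :
    Prop :=
  ∀ γ δ α β : Fin 2,
    ∑ α' : Fin 2, ∑ β' : Fin 2,
        rMat τ η (z - w) (l - 2 * η * (ν + sgn α + sgn β - sgn α' - sgn β')) γ δ α' β' •
          L z l α' α (L w (l - 2 * η * sgn α) β' β u)
      = ∑ α' : Fin 2, ∑ β' : Fin 2,
        rMat τ η (z - w) l α' β' α β • L w l δ β' (L z (l - 2 * η * sgn β') γ α' u)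

@[simp] theorem sgn_zero : sgn 0 = 1 := rfl
@[simp] theorem sgn_one : sgn 1 = -1 := rfl

theorem RLLRelation.b_b {τ η : ℂ} {L : ℂ → ℂ → Fin 2 → Fin 2 → Module.End ℂ W} {z w l ν : ℂ}
    {u : W} (h : RLLRelation τ η L z w l ν u) :
    L z l 0 1 (L w (l + 2 * η) 0 1 u) = L w l 0 1 (L z (l + 2 * η) 0 1 u) := by
  simpa [Fin.sum_univ_two, rMat] using h 0 0 1 1

theorem RLLRelation.a_b {τ η : ℂ} {L : ℂ → ℂ → Fin 2 → Fin 2 → Module.End ℂ W} {t w l ν : ℂ}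
    {u : W} (h : RLLRelation τ η L t w l ν u) (hl : theta τ l ≠ 0) (hl' : theta τ (l - 2 * η) ≠ 0)
    (htw : theta τ (t - w) ≠ 0) (htw' : theta τ (t - w - 2 * η) ≠ 0) :
    L w l 0 0 (L t (l - 2 * η) 0 1 u) =
      (theta τ l * theta τ (t - w - 2 * η) / (theta τ (l - 2 * η) * theta τ (t - w))) •
        L t l 0 1 (L w (l + 2 * η) 0 0 u) +
      (theta τ (l + t - w) * theta τ (2 * η) / (theta τ (l - 2 * η) * theta τ (t - w))) •
        L w l 0 1 (L t (l + 2 * η) 0 0 u) := by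
  have h1 := h 0 0 1 0
  simp only [Fin.sum_univ_two, rMat, sgn_zero, sgn_one] at h1
  norm_num at h1
  rw [h1, smul_add, smul_smul, smul_smul]
  have e1 : theta τ (-l + 2 * η) = -theta τ (l - 2 * η) := by rw [← theta_neg]; congr 1; ring
  have hc1 : theta τ l * theta τ (t - w - 2 * η) / (theta τ (l - 2 * η) * theta τ (t - w)) *
      alphaFn τ η (t - w) (-l) = 1 := by
    rw [alphaFn, e1, theta_neg]
    field_simp
  have hc2 : theta τ l * theta τ (t - w - 2 * η) / (theta τ (l - 2 * η) * theta τ (t - w)) *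
      betaFn τ η (t - w) l =
      -(theta τ (l + t - w) * theta τ (2 * η) / (theta τ (l - 2 * η) * theta τ (t - w))) := by
    rw [betaFn, show l + (t - w) = l + t - w by ring]
    field_simp
  simp only [hc1, hc2, one_smul, neg_smul]
  abel

theorem RLLRelation.d_b {τ η : ℂ} {L : ℂ → ℂ → Fin 2 → Fin 2 → Module.End ℂ W} {t w l l' ν : ℂ}
    {u : W} (h : RLLRelation τ η L w t l ν u) (e : l' = l - 2 * η * (ν - 2))
    (hl : theta τ l' ≠ 0) (hl' : theta τ (l' - 2 * η) ≠ 0)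
    (htw : theta τ (t - w) ≠ 0) (htw' : theta τ (t - w + 2 * η) ≠ 0) :
    L w l 1 1 (L t (l + 2 * η) 0 1 u) =
      (theta τ l' * theta τ (t - w + 2 * η) / (theta τ (l' - 2 * η) * theta τ (t - w))) •
        L t l 0 1 (L w (l + 2 * η) 1 1 u) +
      (-(theta τ (l' + t - w) * theta τ (2 * η)) / (theta τ (l' - 2 * η) * theta τ (t - w))) •
        L w l 0 1 (L t (l + 2 * η) 1 1 u) := by
  have h1 := h 1 0 1 1
  simp only [Fin.sum_univ_two, rMat, sgn_zero, sgn_one] at h1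
  norm_num at h1
  rw [show 2 * η * (ν + -1 + -1) - l = -l' by rw [e]; ring,
    show 2 * η * (ν + -1 - 1) - l = -l' by rw [e]; ring] at h1
  rw [← h1, smul_add, smul_smul, smul_smul]
  have e1 : theta τ (-l' + 2 * η) = -theta τ (l' - 2 * η) := by rw [← theta_neg]; congr 1; ring
  have e2 : theta τ (w - t - 2 * η) = -theta τ (t - w + 2 * η) := by
    rw [← theta_neg]; congr 1; ring
  have e3 : theta τ (-l' + (w - t)) = -theta τ (l' + t - w) := by rw [← theta_neg]; congr 1; ring
  have hc1 : theta τ l' * theta τ (t - w + 2 * η) / (theta τ (l' - 2 * η) * theta τ (t - w)) *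
      alphaFn τ η (w - t) (-l') = 1 := by
    rw [alphaFn, e1, e2, theta_neg, theta_sub_comm τ w t]
    field_simp
  have hc2 : theta τ l' * theta τ (t - w + 2 * η) / (theta τ (l' - 2 * η) * theta τ (t - w)) *
      betaFn τ η (w - t) (-l') =
      -(-(theta τ (l' + t - w) * theta τ (2 * η)) / (theta τ (l' - 2 * η) * theta τ (t - w))) := by
    rw [betaFn, e3, e2, theta_neg]
    field_simp
  simp only [hc1, hc2, one_smul, neg_smul]
  abel

/-- Spectral parameters in general position: none of `θ(x-y)`, `θ(x-y±2η)` vanishes. -/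
def Separated (τ η x y : ℂ) : Prop :=
  theta τ (x - y) ≠ 0 ∧ theta τ (x - y - 2 * η) ≠ 0 ∧ theta τ (x - y + 2 * η) ≠ 0

theorem Separated.symm {τ η x y : ℂ} (h : Separated τ η x y) : Separated τ η y x := by
  refine ⟨?_, ?_, ?_⟩
  · rw [theta_sub_comm]; exact neg_ne_zero.2 h.1
  · rw [show y - x - 2 * η = -(x - y + 2 * η) by ring, theta_neg]; exact neg_ne_zero.2 h.2.2
  · rw [show y - x + 2 * η = -(x - y - 2 * η) by ring, theta_neg]; exact neg_ne_zero.2 h.2.1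

theorem latticeC_add_int {η μ l : ℂ} (hl : l ∈ latticeC η μ) (k : ℤ) :
    l + 2 * η * k ∈ latticeC η μ := by
  obtain ⟨j, rfl⟩ := hl
  exact ⟨j + k, by push_cast; ring⟩

/-- The `RLL` relations on even weight spaces, for dynamical parameters in `C_μ` and spectral
parameters in `S`. -/
structure RLLOn (τ η μ : ℂ) (h : Module.End ℂ W) (L : ℂ → ℂ → Fin 2 → Fin 2 → Module.End ℂ W)
    (S : Set ℂ) : Prop where
  theta_ne : ∀ l ∈ latticeC η μ, theta τ l ≠ 0
  weight : ∀ (z l : ℂ) (β α : Fin 2) (ν : ℂ), ∀ u ∈ h.eigenspace ν,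
    L z l β α u ∈ h.eigenspace (ν + sgn α - sgn β)
  rll : ∀ z ∈ S, ∀ w ∈ S, theta τ (z - w - 2 * η) ≠ 0 → ∀ l ∈ latticeC η μ, ∀ k : ℤ,
    ∀ u ∈ h.eigenspace (2 * (k : ℂ)), RLLRelation τ η L z w l (2 * k) u

theorem betheVector_mem {h : Module.End ℂ W} {b : ℂ → ℂ → Module.End ℂ W} {η : ℂ} {v : ℂ → W}
    {k : ℤ} (hb : ∀ (z l ν : ℂ), ∀ u ∈ h.eigenspace ν, b z l u ∈ h.eigenspace (ν - 2))
    (hv : ∀ l, v l ∈ h.eigenspace (2 * (k : ℂ))) (ts : List ℂ) (l : ℂ) :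
    betheVector η b v ts l ∈ h.eigenspace (2 * ((k - ts.length : ℤ) : ℂ)) := by
  induction ts generalizing l with
  | nil => simpa [betheVector] using hv l
  | cons t ts ih =>
    have := hb t l _ _ (ih (l + 2 * η))
    rw [betheVector]
    convert this using 2
    push_cast [List.length_cons]
    ring

theorem RLLOn.weight_b {τ η μ : ℂ} {h : Module.End ℂ W}
    {L : ℂ → ℂ → Fin 2 → Fin 2 → Module.End ℂ W} {S : Set ℂ} (H : RLLOn τ η μ h L S)
    (z l ν : ℂ) (u : W) (hu : u ∈ h.eigenspace ν) : L z l 0 1 u ∈ h.eigenspace (ν - 2) := by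
  have := H.weight z l 0 1 ν u hu
  convert this using 2
  simp
  ring

theorem RLLOn.betheVector_perm {τ η μ : ℂ} {h : Module.End ℂ W}
    {L : ℂ → ℂ → Fin 2 → Fin 2 → Module.End ℂ W} {S : Set ℂ} (H : RLLOn τ η μ h L S)
    {v : ℂ → W} {k : ℤ} (hv : ∀ l, v l ∈ h.eigenspace (2 * (k : ℂ))) {ts ts' : List ℂ}
    (hp : ts.Perm ts') (hS : ∀ t ∈ ts, t ∈ S) (hsep : ts.Pairwise (Separated τ η)) :
    ∀ l ∈ latticeC η μ, betheVector η (fun x l => L x l 0 1) v ts l =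
      betheVector η (fun x l => L x l 0 1) v ts' l := by
  induction hp with
  | nil => exact fun _ _ => rfl
  | cons x _ ih =>
    intro l hl
    simp only [betheVector]
    rw [ih (fun t ht => hS t (List.mem_cons_of_mem _ ht)) hsep.of_cons _ (latticeC_add hl)]
  | swap x y ts =>
    intro l hl
    simp only [betheVector]
    have hxy : Separated τ η y x := (List.pairwise_cons.1 hsep).1 x (by simp)
    exact (H.rll y (hS y (by simp)) x (hS x (by simp)) hxy.2.1 l hl (k - ts.length)
      _ (betheVector_mem (fun z l ν u hu => H.weight_b z l ν u hu) hv ts _)).b_b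
  | trans h1 _ ih1 ih2 =>
    intro l hl
    rw [ih1 hS hsep l hl]
    exact ih2 (fun t ht => hS t (h1.mem_iff.2 ht))
      (h1.pairwise hsep fun h => h.symm) l hl

/-- The combinatorial part of the Bethe ansatz: a commutation relation
`X(w) b(t) = f b(t) X(w) + g b(w) X(t)` gives the action of `X(w)` on Bethe vectors. -/
theorem RLLOn.diagonal_betheVector {τ η μ : ℂ} {h : Module.End ℂ W}
    {L : ℂ → ℂ → Fin 2 → Fin 2 → Module.End ℂ W} {S : Set ℂ} (H : RLLOn τ η μ h L S)
    {v : ℂ → W} {k : ℤ} (hv : ∀ l, v l ∈ h.eigenspace (2 * (k : ℂ)))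
    (X : ℂ → ℂ → (ℂ → W) → W) (f g : ℕ → ℂ → ℂ → ℂ → ℂ) (P : ℕ → ℂ → ℂ) (Q : ℕ → ℂ → ℂ → ℂ → ℂ)
    (ρ κ : ℂ → ℂ)
    (hX0 : ∀ w ∈ S, ∀ l ∈ latticeC η μ, X w l v = (P 0 l * ρ w) • v l)
    (hX : ∀ ts : List ℂ, (∀ t ∈ ts, t ∈ S) → ∀ t ∈ S, ∀ w ∈ S, Separated τ η t w →
      ∀ l ∈ latticeC η μ, X w l (betheVector η (fun x l => L x l 0 1) v (t :: ts)) =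
        f ts.length w t l • L t l 0 1 (X w (l + 2 * η) (betheVector η (fun x l => L x l 0 1) v ts))
        + g ts.length w t l •
          L w l 0 1 (X t (l + 2 * η) (betheVector η (fun x l => L x l 0 1) v ts)))
    (hP : ∀ m t w l, l ∈ latticeC η μ → Separated τ η t w →
      f m w t l * P m (l + 2 * η) = P (m + 1) l * κ (t - w))
    (hQ : ∀ m t w l, l ∈ latticeC η μ → Separated τ η t w →
      g m w t l * P m (l + 2 * η) = Q (m + 1) t w l)
    (hQ' : ∀ m t s w l, l ∈ latticeC η μ → Separated τ η t w → Separated τ η s w →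
      Separated τ η s t → f m w t l * Q m s w (l + 2 * η) + g m w t l * Q m s t (l + 2 * η) =
        Q (m + 1) s w l * κ (t - s))
    {m : ℕ} (t : Fin m → ℂ) (htS : ∀ i, t i ∈ S)
    (hsep : ∀ i j, i ≠ j → Separated τ η (t i) (t j)) :
    ∀ w ∈ S, (∀ i, Separated τ η (t i) w) → ∀ l ∈ latticeC η μ,
      X w l (betheVector η (fun x l => L x l 0 1) v (List.ofFn t)) =
        (P m l * ρ w * ∏ j, κ (t j - w)) •
          betheVector η (fun x l => L x l 0 1) v (List.ofFn t) l +
        ∑ i, (Q m (t i) w l * ρ (t i) * ∏ j ∈ Finset.univ.erase i, κ (t j - t i)) •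
          betheVector η (fun x l => L x l 0 1) v (List.ofFn (Function.update t i w)) l := by
  induction m with
  | zero =>
    intro w hw _ l hl
    simp [betheVector, hX0 w hw l hl]
  | succ m ih =>
    intro w hw htw l hl
    set b : ℂ → ℂ → Module.End ℂ W := fun x l => L x l 0 1 with hb
    set r : Fin m → ℂ := fun j => t j.succ with hr
    have ih' := ih r (fun i => htS _) (fun i j hij => hsep _ _ (by simpa using hij))
    have hl2 := latticeC_add hl
    have hsep0 : ∀ i, Separated τ η (r i) (t 0) := fun i => hsep _ _ (Fin.succ_ne_zero i)
    have hXt := hX (List.ofFn r) (by simp [List.mem_ofFn, hr, htS]) (t 0) (htS 0) w hw (htw 0) l hl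
    rw [List.length_ofFn, ih' w hw (fun i => htw _) _ hl2, ih' (t 0) (htS 0) hsep0 _ hl2] at hXt
    have hcons : List.ofFn t = t 0 :: List.ofFn r := by rw [List.ofFn_succ]
    have hupd0 : List.ofFn (Function.update t 0 w) = w :: List.ofFn r := by
      rw [List.ofFn_succ]; simp [hr]
    have hupds : ∀ i : Fin m, List.ofFn (Function.update t i.succ w) =
        t 0 :: List.ofFn (Function.update r i w) := by
      intro i
      rw [List.ofFn_succ]
      refine congrArg₂ List.cons (Function.update_of_ne (Fin.succ_ne_zero i).symm _ _)
        (congrArg List.ofFn (funext fun j => ?_))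
      · by_cases hj : j = i
        · subst hj; simp
        · simp [hj, hr]
    have hswap : ∀ i : Fin m, L w l 0 1 (betheVector η b v (List.ofFn (Function.update r i (t 0)))
        (l + 2 * η)) = L (t 0) l 0 1 (betheVector η b v (List.ofFn (Function.update r i w))
        (l + 2 * η)) := by
      intro i
      refine H.betheVector_perm hv (ts := w :: List.ofFn (Function.update r i (t 0)))
        (ts' := t 0 :: List.ofFn (Function.update r i w)) ?_ ?_ ?_ l hl
      · have e1 : w :: List.ofFn (Function.update r i (t 0)) =
            List.ofFn (Fin.cons w (Function.update r i (t 0)) : Fin (m + 1) → ℂ) := by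
          rw [List.ofFn_succ]; rfl
        have e2 : t 0 :: List.ofFn (Function.update r i w) =
            List.ofFn (Fin.cons (t 0) (Function.update r i w) : Fin (m + 1) → ℂ) := by
          rw [List.ofFn_succ]; rfl
        rw [e1, e2]
        have : (Fin.cons w (Function.update r i (t 0)) : Fin (m + 1) → ℂ) =
            (Fin.cons (t 0) (Function.update r i w) : Fin (m + 1) → ℂ) ∘
              Equiv.swap 0 i.succ := by
          ext j
          refine Fin.cases ?_ (fun j => ?_) j
          · simp
          · by_cases hj : j = i
            · subst hj
              simp only [Fin.cons_succ, Function.comp_apply, Equiv.swap_apply_right, Fin.cons_zero,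
                Function.update_self]
            · rw [Function.comp_apply, Equiv.swap_apply_of_ne_of_ne (Fin.succ_ne_zero j)
                (by simpa using hj), Fin.cons_succ, Fin.cons_succ, Function.update_of_ne hj,
                Function.update_of_ne hj]
        rw [this]
        exact Equiv.Perm.ofFn_comp_perm _ _
      · intro x hx
        rcases List.mem_cons.1 hx with rfl | hx
        · exact hw
        · obtain ⟨j, rfl⟩ := (List.mem_ofFn' _ _).1 hx
          by_cases hj : j = i
          · subst hj; simpa using htS 0
          · simpa [hj, hr] using htS _
      · rw [List.pairwise_cons]
        refine ⟨?_, ?_⟩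
        · intro x hx
          obtain ⟨j, rfl⟩ := (List.mem_ofFn' _ _).1 hx
          by_cases hj : j = i
          · subst hj; simpa using (htw 0).symm
          · simpa [hj, hr] using (htw _).symm
        · rw [List.pairwise_ofFn]
          intro j j' hjj
          by_cases hj : j = i
          · subst hj
            simpa [hjj.ne'] using (hsep0 _).symm
          · by_cases hj' : j' = i
            · subst hj'; simpa [hj] using hsep0 _
            · simpa [hj, hj', hr] using hsep _ _ (by simpa using hjj.ne)
    have hperase : ∀ i : Fin m, ∏ j ∈ Finset.univ.erase i.succ, κ (t j - t i.succ) =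
        κ (t 0 - r i) * ∏ j ∈ Finset.univ.erase i, κ (r j - r i) := by
      intro i
      have : (Finset.univ.erase i.succ : Finset (Fin (m + 1))) =
          insert 0 ((Finset.univ.erase i).map (Fin.succEmb m)) := by
        ext j
        refine Fin.cases ?_ (fun j => ?_) j
        · simp [(Fin.succ_ne_zero i).symm]
        · simp [Fin.succ_ne_zero]
      rw [this, Finset.prod_insert (by simp [Fin.succ_ne_zero]), Finset.prod_map]
      rfl
    have hperase0 : ∏ j ∈ Finset.univ.erase (0 : Fin (m + 1)), κ (t j - t 0) =
        ∏ j, κ (r j - t 0) := by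
      have : (Finset.univ.erase (0 : Fin (m + 1))) = Finset.univ.map (Fin.succEmb m) := by
        ext j
        refine Fin.cases ?_ (fun j => ?_) j
        · simp
        · simp [Fin.succ_ne_zero]
      rw [this, Finset.prod_map]
      rfl
    rw [← hcons] at hXt
    simp only [hb] at hswap
    rw [hXt, Fin.sum_univ_succ, Fin.prod_univ_succ, hperase0, hupd0, hcons]
    simp only [betheVector, hperase, hupds, map_add, map_smul, map_sum, smul_add, smul_smul,
      Finset.smul_sum, hb, hswap]
    rw [add_add_add_comm, ← Finset.sum_add_distrib, add_assoc]
    congr 1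
    · congr 1
      linear_combination (ρ w * ∏ j, κ (r j - w)) * hP m (t 0) w l hl (htw 0)
    · congr 1
      · congr 1
        linear_combination (ρ (t 0) * ∏ j, κ (r j - t 0)) * hQ m (t 0) w l hl (htw 0)
      · refine Finset.sum_congr rfl fun i _ => ?_
        rw [← add_smul]
        congr 1
        have := hQ' m (t 0) (r i) w l hl (htw 0) (htw i.succ) (hsep0 i)
        linear_combination (ρ (r i) * ∏ j ∈ Finset.univ.erase i, κ (r j - r i)) * this

end

theorem theta_exchange {τ : ℂ} (hτ : 0 < τ.im) (l t s w e : ℂ) :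
    theta τ l * theta τ (t - w - e) * (theta τ (l + e + s - w) * theta τ (s - t)) +
      theta τ (l + t - w) * theta τ e * (theta τ (l + e + s - t) * theta τ (s - w)) =
    theta τ (l + s - w) * theta τ (s - t + e) * (theta τ (l + e) * theta τ (t - w)) := by
  have h := theta_three_term hτ (l + e / 2 + (s - w) / 2) (e / 2 + (s - w) / 2)
    (e / 2 - (s - w) / 2) (e / 2 + (s + w) / 2 - t)
  rw [show l + e / 2 + (s - w) / 2 + (e / 2 - (s - w) / 2) = l + e by ring,
    show l + e / 2 + (s - w) / 2 - (e / 2 - (s - w) / 2) = l + s - w by ring,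
    show e / 2 + (s - w) / 2 + (e / 2 + (s + w) / 2 - t) = s - t + e by ring,
    show e / 2 + (s - w) / 2 - (e / 2 + (s + w) / 2 - t) = t - w by ring,
    show l + e / 2 + (s - w) / 2 + (e / 2 + (s - w) / 2) = l + e + s - w by ring,
    show l + e / 2 + (s - w) / 2 - (e / 2 + (s - w) / 2) = l by ring,
    show e / 2 - (s - w) / 2 + (e / 2 + (s + w) / 2 - t) = -(t - w - e) by ring,
    show e / 2 - (s - w) / 2 - (e / 2 + (s + w) / 2 - t) = -(s - t) by ring,
    show l + e / 2 + (s - w) / 2 + (e / 2 + (s + w) / 2 - t) = l + e + s - t by ring,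
    show l + e / 2 + (s - w) / 2 - (e / 2 + (s + w) / 2 - t) = l + t - w by ring,
    show e / 2 + (s - w) / 2 + (e / 2 - (s - w) / 2) = e by ring,
    show e / 2 + (s - w) / 2 - (e / 2 - (s - w) / 2) = s - w by ring, theta_neg, theta_neg] at h
  linear_combination -h

section
variable {W : Type*} [AddCommGroup W] [Module ℂ W]

/-- `∏_k θ(x-p_k)/θ(x-q_k)`. -/
def weightRatio {n : ℕ} (τ η : ℂ) (z Λ : Fin n → ℂ) (x : ℂ) : ℂ :=
  ∏ k, theta τ (x - pPar η z Λ k) / theta τ (x - qPar η z Λ k)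

/-- A highest weight vector of weight `2m` with respect to spectral parameters in `S` and
dynamical parameters in `C_μ`. -/
structure HighestWeightOn {n : ℕ} (τ η μ : ℂ) (h : Module.End ℂ W)
    (L : ℂ → ℂ → Fin 2 → Fin 2 → Module.End ℂ W) (S : Set ℂ) (z Λ : Fin n → ℂ) (m : ℕ)
    (v : ℂ → W) : Prop where
  mem : ∀ l, v l ∈ h.eigenspace (2 * (m : ℂ))
  a_apply : ∀ x ∈ S, ∀ l ∈ latticeC η μ, L x l 0 0 (v (l - 2 * η)) = v l
  d_apply : ∀ x ∈ S, ∀ l ∈ latticeC η μ, L x l 1 1 (v (l + 2 * η)) =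
    (theta τ (l - 4 * η * m) / theta τ l * weightRatio τ η z Λ x) • v l

variable {τ η μ : ℂ} {h : Module.End ℂ W} {L : ℂ → ℂ → Fin 2 → Fin 2 → Module.End ℂ W} {S : Set ℂ}

theorem RLLOn.theta_add_int_ne {l : ℂ} (H : RLLOn τ η μ h L S) (hl : l ∈ latticeC η μ) {l' : ℂ}
    (k : ℤ) (e : l' = l + 2 * η * k) : theta τ l' ≠ 0 :=
  e ▸ H.theta_ne _ (latticeC_add_int hl k)

theorem RLLOn.a_betheVector (hτ : 0 < τ.im) (H : RLLOn τ η μ h L S) {n m₀ : ℕ} {z Λ : Fin n → ℂ}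
    {v : ℂ → W} (hv : HighestWeightOn τ η μ h L S z Λ m₀ v)
    {m : ℕ} (t : Fin m → ℂ) (htS : ∀ i, t i ∈ S)
    (hsep : ∀ i j, i ≠ j → Separated τ η (t i) (t j)) :
    ∀ w ∈ S, (∀ i, Separated τ η (t i) w) → ∀ l ∈ latticeC η μ,
      L w l 0 0 (betheVector η (fun x l => L x l 0 1) v (List.ofFn t) (l - 2 * η)) =
        (theta τ (l + 2 * η * (m - 1)) / theta τ (l - 2 * η) * 1 *
          ∏ j, theta τ (t j - w - 2 * η) / theta τ (t j - w)) •
          betheVector η (fun x l => L x l 0 1) v (List.ofFn t) l +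
        ∑ i, (theta τ (l + t i - w) * theta τ (2 * η) * theta τ (l + 2 * η * (m - 1)) /
            (theta τ (l - 2 * η) * theta τ l * theta τ (t i - w)) * 1 *
            ∏ j ∈ Finset.univ.erase i, theta τ (t j - t i - 2 * η) / theta τ (t j - t i)) •
          betheVector η (fun x l => L x l 0 1) v (List.ofFn (Function.update t i w)) l := by
  have hm : ∀ l, v l ∈ h.eigenspace (2 * ((m₀ : ℤ) : ℂ)) := by simpa using hv.mem
  have h0 : ∀ l ∈ latticeC η μ, theta τ l ≠ 0 := H.theta_ne
  have h1 : ∀ l ∈ latticeC η μ, theta τ (l - 2 * η) ≠ 0 := fun l hl => h0 _ (latticeC_sub hl)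
  have h2 : ∀ l ∈ latticeC η μ, theta τ (l + 2 * η) ≠ 0 := fun l hl => h0 _ (latticeC_add hl)
  refine H.diagonal_betheVector hm (fun w l F => L w l 0 0 (F (l - 2 * η)))
    (fun _ w t l => theta τ l * theta τ (t - w - 2 * η) / (theta τ (l - 2 * η) * theta τ (t - w)))
    (fun _ w t l => theta τ (l + t - w) * theta τ (2 * η) /
      (theta τ (l - 2 * η) * theta τ (t - w)))
    (fun m l => theta τ (l + 2 * η * (m - 1)) / theta τ (l - 2 * η))
    (fun m t w l => theta τ (l + t - w) * theta τ (2 * η) * theta τ (l + 2 * η * (m - 1)) /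
            (theta τ (l - 2 * η) * theta τ l * theta τ (t - w)))
    (fun _ => 1) (fun x => theta τ (x - 2 * η) / theta τ x) ?_ ?_ ?_ ?_ ?_ t htS hsep
  · intro w hw l hl
    have : l + 2 * η * (((0 : ℕ) : ℂ) - 1) = l - 2 * η := by push_cast; ring
    rw [this, div_self (h1 l hl), hv.a_apply w hw l hl, one_mul, one_smul]
  · intro ts _ t ht w hw htw l hl
    simp only [betheVector, sub_add_cancel, add_sub_cancel_right]
    exact (H.rll t ht w hw htw.2.1 l hl _ _ (betheVector_mem H.weight_b hm ts l)).a_b (h0 l hl)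
      (h1 l hl) htw.1 htw.2.1
  · intro m t w l hl htw
    have := h0 l hl
    have := h1 l hl
    have := htw.1
    rw [show l + 2 * η + 2 * η * (m - 1) = l + 2 * η * m by ring, add_sub_cancel_right]
    push_cast
    rw [add_sub_cancel_right]
    field_simp
  · intro m t w l hl htw
    have := h0 l hl
    have := h1 l hl
    have := htw.1
    rw [show l + 2 * η + 2 * η * (m - 1) = l + 2 * η * m by ring, add_sub_cancel_right]
    push_cast
    rw [add_sub_cancel_right]
    field_simp
  · intro m t s w l hl htw hsw hst
    have e1 := h0 l hl
    have e2 := h1 l hl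
    have e3 := h2 l hl
    have e4 := htw.1
    have e5 := hsw.1
    have e6 := hst.1
    have key := theta_exchange hτ l t s w (2 * η)
    have e7 : theta τ (t - s) = -theta τ (s - t) := theta_sub_comm _ _ _
    have e8 : theta τ (t - s - 2 * η) = -theta τ (s - t + 2 * η) := by
      rw [← theta_neg]; congr 1; ring
    rw [show l + 2 * η + 2 * η * (m - 1) = l + 2 * η * m by ring, add_sub_cancel_right, e7, e8]
    push_cast
    rw [add_sub_cancel_right, neg_div_neg_eq]
    field_simp
    linear_combination theta τ (2 * η) * theta τ (l + 2 * η * m) * key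

theorem RLLOn.d_betheVector (hτ : 0 < τ.im) (H : RLLOn τ η μ h L S) {n m₀ : ℕ} {z Λ : Fin n → ℂ}
    {v : ℂ → W} (hv : HighestWeightOn τ η μ h L S z Λ m₀ v)
    {m : ℕ} (t : Fin m → ℂ) (htS : ∀ i, t i ∈ S)
    (hsep : ∀ i j, i ≠ j → Separated τ η (t i) (t j)) :
    ∀ w ∈ S, (∀ i, Separated τ η (t i) w) → ∀ l ∈ latticeC η μ,
      L w l 1 1 (betheVector η (fun x l => L x l 0 1) v (List.ofFn t) (l + 2 * η)) =
        (theta τ (l - 4 * η * (m₀ - m)) / theta τ (l + 2 * η * m) * weightRatio τ η z Λ w *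
          ∏ j, theta τ (t j - w + 2 * η) / theta τ (t j - w)) •
          betheVector η (fun x l => L x l 0 1) v (List.ofFn t) l +
        ∑ i, (-(theta τ (l - 4 * η * (m₀ - m) + t i - w) * theta τ (2 * η)) /
            (theta τ (t i - w) * theta τ (l + 2 * η * m)) * weightRatio τ η z Λ (t i) *
            ∏ j ∈ Finset.univ.erase i, theta τ (t j - t i + 2 * η) / theta τ (t j - t i)) •
          betheVector η (fun x l => L x l 0 1) v (List.ofFn (Function.update t i w)) l := by
  have hm : ∀ l, v l ∈ h.eigenspace (2 * ((m₀ : ℤ) : ℂ)) := by simpa using hv.mem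
  refine H.diagonal_betheVector hm (fun w l F => L w l 1 1 (F (l + 2 * η)))
    (fun m w t l => theta τ (l - 4 * η * (m₀ - (m + 1))) * theta τ (t - w + 2 * η) /
      (theta τ (l - 4 * η * (m₀ - (m + 1)) - 2 * η) * theta τ (t - w)))
    (fun m w t l => -(theta τ (l - 4 * η * (m₀ - (m + 1)) + t - w) * theta τ (2 * η)) /
      (theta τ (l - 4 * η * (m₀ - (m + 1)) - 2 * η) * theta τ (t - w)))
    (fun m l => theta τ (l - 4 * η * (m₀ - m)) / theta τ (l + 2 * η * m))
    (fun m t w l => -(theta τ (l - 4 * η * (m₀ - m) + t - w) * theta τ (2 * η)) /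
            (theta τ (t - w) * theta τ (l + 2 * η * m)))
    (weightRatio τ η z Λ) (fun x => theta τ (x + 2 * η) / theta τ x) ?_ ?_ ?_ ?_ ?_ t htS hsep
  · intro w hw l hl
    rw [hv.d_apply w hw l hl]
    simp
  · intro ts _ t ht w hw htw l hl
    simp only [betheVector]
    refine (H.rll w hw t ht htw.symm.2.1 l hl _ _ (betheVector_mem H.weight_b hm ts _)).d_b
      ?_ ?_ ?_ htw.1 htw.2.2
    · push_cast
      ring
    · exact H.theta_add_int_ne hl (-2 * (m₀ - (ts.length + 1))) (by push_cast; ring)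
    · exact H.theta_add_int_ne hl (-2 * (m₀ - (ts.length + 1)) - 1) (by push_cast; ring)
  · intro m t w l hl htw
    have e1 : theta τ (l - 4 * η * (m₀ - (m + 1)) - 2 * η) ≠ 0 :=
      H.theta_add_int_ne hl (-2 * (m₀ - (m + 1)) - 1) (by push_cast; ring)
    have e2 : theta τ (l + 2 * η * (m + 1)) ≠ 0 :=
      H.theta_add_int_ne hl (m + 1) (by push_cast; ring)
    have := htw.1
    rw [show l + 2 * η + 2 * η * m = l + 2 * η * (m + 1) by ring,
      show l + 2 * η - 4 * η * (m₀ - m) = l - 4 * η * (m₀ - (m + 1)) - 2 * η by ring]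
    push_cast
    generalize theta τ (l - 4 * η * (m₀ - (m + 1)) - 2 * η) = X at *
    field_simp
  · intro m t w l hl htw
    have e1 : theta τ (l - 4 * η * (m₀ - (m + 1)) - 2 * η) ≠ 0 :=
      H.theta_add_int_ne hl (-2 * (m₀ - (m + 1)) - 1) (by push_cast; ring)
    have e2 : theta τ (l + 2 * η * (m + 1)) ≠ 0 :=
      H.theta_add_int_ne hl (m + 1) (by push_cast; ring)
    have := htw.1
    rw [show l + 2 * η + 2 * η * m = l + 2 * η * (m + 1) by ring,
      show l + 2 * η - 4 * η * (m₀ - m) = l - 4 * η * (m₀ - (m + 1)) - 2 * η by ring]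
    push_cast
    generalize theta τ (l - 4 * η * (m₀ - (m + 1)) - 2 * η) = X at *
    field_simp
  · intro m t s w l hl htw hsw hst
    have e1 : theta τ (l - 4 * η * (m₀ - (m + 1)) - 2 * η) ≠ 0 :=
      H.theta_add_int_ne hl (-2 * (m₀ - (m + 1)) - 1) (by push_cast; ring)
    have e2 : theta τ (l + 2 * η * (m + 1)) ≠ 0 :=
      H.theta_add_int_ne hl (m + 1) (by push_cast; ring)
    have e4 := htw.1
    have e5 := hsw.1
    have e6 := hst.1
    rw [show l + 2 * η + 2 * η * m = l + 2 * η * (m + 1) by ring,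
      show l + 2 * η - 4 * η * (m₀ - m) = l - 4 * η * (m₀ - (m + 1)) - 2 * η by ring]
    push_cast
    generalize l - 4 * η * (m₀ - (m + 1)) = l' at *
    have key := theta_exchange hτ l' t s w (-(2 * η))
    rw [show t - w - -(2 * η) = t - w + 2 * η by ring, theta_neg,
      show l' + -(2 * η) = l' - 2 * η by ring] at key
    have e7 : theta τ (t - s) = -theta τ (s - t) := theta_sub_comm _ _ _
    have e8 : theta τ (t - s + 2 * η) = -theta τ (s - t + -(2 * η)) := by
      rw [← theta_neg]; congr 1; ring
    rw [e7, e8, neg_div_neg_eq]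
    field_simp
    linear_combination -theta τ (2 * η) * key

theorem gFn_sub (τ η c : ℂ) (m : ℕ) (l : ℂ) :
    gFn τ η c m (l - 2 * η) * theta τ (l - 2 * η) =
      Complex.exp (-2 * η * c) * gFn τ η c m l * theta τ (l - 2 * η * (m + 1)) := by
  have : ∀ m : ℕ, (∏ j ∈ Finset.Icc 1 m, theta τ (l - 2 * η - 2 * η * j)) * theta τ (l - 2 * η) =
      (∏ j ∈ Finset.Icc 1 m, theta τ (l - 2 * η * j)) * theta τ (l - 2 * η * (m + 1)) := by
    intro m
    induction m with
    | zero => simp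
    | succ m ih =>
      rw [Finset.prod_Icc_succ_top (by omega), Finset.prod_Icc_succ_top (by omega)]
      push_cast
      rw [show l - 2 * η - 2 * η * (m + 1) = l - 2 * η * (m + 1 + 1) by ring]
      linear_combination theta τ (l - 2 * η * (m + 1 + 1)) * ih
  unfold gFn
  rw [show c * (l - 2 * η) = -2 * η * c + c * l by ring, Complex.exp_add]
  linear_combination (Complex.exp (-2 * η * c) * Complex.exp (c * l)) * this m

theorem betheVector_smul (η : ℂ) (b : ℂ → ℂ → Module.End ℂ W) (g : ℂ → ℂ) (v : ℂ → W)
    (ts : List ℂ) (l : ℂ) :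
    betheVector η b (fun l => g l • v l) ts l =
      g (l + 2 * η * ts.length) • betheVector η b v ts l := by
  induction ts generalizing l with
  | nil => simp [betheVector]
  | cons t ts ih =>
    simp only [betheVector, ih, map_smul]
    congr 2
    push_cast [List.length_cons]
    ring

/-- The coefficient of the unwanted term in which `t_i` is replaced by `w`. -/
def unwanted {n m : ℕ} (τ η : ℂ) (z Λ : Fin n → ℂ) (c : ℂ) (t : Fin m → ℂ) (w l : ℂ) (i : Fin m) :
    ℂ :=
  gFn τ η c m (l + 2 * η * m) * (theta τ (l + t i - w) * theta τ (2 * η) /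
    (theta τ l * theta τ (t i - w))) *
    (Complex.exp (-2 * η * c) *
        (∏ j ∈ Finset.univ.erase i, theta τ (t j - t i - 2 * η) / theta τ (t j - t i)) -
      Complex.exp (2 * η * c) * weightRatio τ η z Λ (t i) *
        (∏ j ∈ Finset.univ.erase i, theta τ (t j - t i + 2 * η) / theta τ (t j - t i)))

theorem RLLOn.transfer_betheVector (hτ : 0 < τ.im) (H : RLLOn τ η μ h L S) {n m : ℕ}
    {z Λ : Fin n → ℂ} {v : ℂ → W} (hv : HighestWeightOn τ η μ h L S z Λ m v) (c : ℂ)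
    (t : Fin m → ℂ) (htS : ∀ i, t i ∈ S) (hsep : ∀ i j, i ≠ j → Separated τ η (t i) (t j))
    {w : ℂ} (hw : w ∈ S) (htw : ∀ i, Separated τ η (t i) w) {l : ℂ} (hl : l ∈ latticeC η μ) :
    let ψ := betheVector η (fun x l => L x l 0 1) (fun l => gFn τ η c m l • v l) (List.ofFn t)
    L w l 0 0 (ψ (l - 2 * η)) + L w l 1 1 (ψ (l + 2 * η)) =
      betheEigenvalue τ η z Λ c t w • ψ l +
      ∑ i, unwanted τ η z Λ c t w l i •
        betheVector η (fun x l => L x l 0 1) v (List.ofFn (Function.update t i w)) l := by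
  intro ψ
  have h0 : theta τ l ≠ 0 := H.theta_ne l hl
  have h1 : theta τ (l - 2 * η) ≠ 0 := H.theta_ne _ (latticeC_sub hl)
  have h2 : theta τ (l + 2 * η * m) ≠ 0 := H.theta_add_int_ne hl m (by push_cast; ring)
  have g1 := gFn_sub τ η c m (l + 2 * η * m)
  rw [show l + 2 * η * m - 2 * η * (m + 1) = l - 2 * η by ring,
    show l + 2 * η * m - 2 * η = l + 2 * η * (m - 1) by ring] at g1
  have g2 := gFn_sub τ η c m (l + 2 * η * m + 2 * η)
  rw [show l + 2 * η * m + 2 * η - 2 * η * (m + 1) = l by ring, add_sub_cancel_right] at g2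
  have g2' : gFn τ η c m (l + 2 * η * m + 2 * η) * theta τ l =
      Complex.exp (2 * η * c) * gFn τ η c m (l + 2 * η * m) * theta τ (l + 2 * η * m) := by
    have : Complex.exp (2 * η * c) * Complex.exp (-2 * η * c) = 1 := by
      rw [← Complex.exp_add, ← Complex.exp_zero]; congr 1; ring
    linear_combination (-Complex.exp (2 * η * c)) * g2 -
      (gFn τ η c m (l + 2 * η * m + 2 * η) * theta τ l) * this
  simp only [ψ, betheVector_smul, List.length_ofFn, map_smul]
  rw [H.a_betheVector hτ hv t htS hsep w hw htw l hl,
    H.d_betheVector hτ hv t htS hsep w hw htw l hl,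
    show l - 2 * η + 2 * η * m = l + 2 * η * (m - 1) by ring,
    show l + 2 * η + 2 * η * m = l + 2 * η * m + 2 * η by ring, sub_self, mul_zero, sub_zero]
  simp only [smul_add, Finset.smul_sum, smul_smul]
  rw [add_add_add_comm, ← Finset.sum_add_distrib, ← add_smul]
  simp only [betheEigenvalue, unwanted]
  generalize Complex.exp (-2 * η * c) = E₁ at *
  generalize Complex.exp (2 * η * c) = E₂ at *
  congr 1
  · congr 1
    simp only [weightRatio]
    generalize (∏ j, theta τ (t j - w - 2 * η) / theta τ (t j - w)) = A
    generalize (∏ j, theta τ (t j - w + 2 * η) / theta τ (t j - w)) = B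
    generalize (∏ k, theta τ (w - pPar η z Λ k) / theta τ (w - qPar η z Λ k)) = D
    field_simp
    linear_combination A * theta τ (l + 2 * η * m) * g1 + D * B * theta τ (l - 2 * η) * g2'
  · refine Finset.sum_congr rfl fun i _ => ?_
    rw [← add_smul]
    congr 1
    have e4 := (htw i).1
    generalize (∏ j ∈ Finset.univ.erase i, theta τ (t j - t i - 2 * η) / theta τ (t j - t i)) = A
    generalize (∏ j ∈ Finset.univ.erase i, theta τ (t j - t i + 2 * η) / theta τ (t j - t i)) = B
    generalize weightRatio τ η z Λ (t i) = D
    field_simp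
    linear_combination theta τ (l + t i - w) * theta τ (2 * η) *
      (A * theta τ (l + 2 * η * m) * g1 - D * B * theta τ (l - 2 * η) * g2')

end

/-! ### Analytic continuation in the spectral parameters -/

theorem countable_theta_zeros {τ : ℂ} (hτ : 0 < τ.im) : {x | theta τ x = 0}.Countable := by
  refine (Set.countable_range fun p : ℤ × ℤ => (p.1 + p.2 * τ : ℂ)).mono ?_
  intro x hx
  obtain ⟨r, s, h⟩ := (theta_eq_zero_iff hτ).1 hx
  exact ⟨(r, s), h.symm⟩

theorem countable_theta_comp_zeros {τ : ℂ} (hτ : 0 < τ.im) {f : ℂ → ℂ}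
    (hf : Function.Injective f) : {x | theta τ (f x) = 0}.Countable :=
  (countable_theta_zeros hτ).preimage_of_injOn hf.injOn

theorem eq_of_continuousAt_of_countable {B : Set ℂ} (hB : B.Countable) {f g : ℂ → ℂ} {x : ℂ}
    (hf : ContinuousAt f x) (hg : ContinuousAt g x) (h : ∀ᶠ y in 𝓝 x, y ∉ B → f y = g y) :
    f x = g x := by
  have : (𝓝[Bᶜ] x).NeBot := mem_closure_iff_nhdsWithin_neBot.1 (hB.dense_compl ℝ x)
  refine tendsto_nhds_unique (l := 𝓝[Bᶜ] x) (hf.mono_left nhdsWithin_le_nhds)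
    ((hg.mono_left nhdsWithin_le_nhds).congr' ?_)
  filter_upwards [self_mem_nhdsWithin, nhdsWithin_le_nhds h] with y hy h using (h hy).symm

theorem countable_not_separated {τ : ℂ} (hτ : 0 < τ.im) (η t : ℂ) :
    {w | ¬ Separated τ η t w}.Countable := by
  have h : ∀ a : ℂ, {w | theta τ (t - w + a) = 0}.Countable := fun a =>
    countable_theta_comp_zeros hτ fun x y hxy => by simpa using hxy
  refine (((h 0).union (h (-(2 * η)))).union (h (2 * η))).mono fun w hw => ?_
  simp only [Separated, Set.mem_ofPred_eq, not_and_or, not_not, Set.mem_union, add_zero,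
    ← sub_eq_add_neg] at hw ⊢
  tauto

section
variable {W : Type*} [AddCommGroup W] [Module ℂ W]

theorem vecRegularAt_const (u : W) (p : ℂ) : VecRegularAt (fun _ => u) p :=
  fun _ => analyticAt_const

theorem VecRegularAt.add {x y : ℂ → W} {p : ℂ} (hx : VecRegularAt x p) (hy : VecRegularAt y p) :
    VecRegularAt (fun s => x s + y s) p := fun φ => by
  simp only [map_add]
  exact (hx φ).add (hy φ)

theorem VecRegularAt.smul {g : ℂ → ℂ} {x : ℂ → W} {p : ℂ} (hg : AnalyticAt ℂ g p)
    (hx : VecRegularAt x p) : VecRegularAt (fun s => g s • x s) p := fun φ => by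
  simp only [map_smul]
  exact hg.smul (hx φ)

theorem VecRegularAt.map {x : ℂ → W} {p : ℂ} (hx : VecRegularAt x p) (A : Module.End ℂ W) :
    VecRegularAt (fun s => A (x s)) p := fun φ => hx (φ.comp A)

/-- Coordinates on a finite dimensional subspace extend to the whole space. -/
theorem exists_coordinates (V : Submodule ℂ W) [FiniteDimensional ℂ V] :
    ∃ (n : ℕ) (e : Fin n → W) (g : Fin n → Module.Dual ℂ W), (∀ i, e i ∈ V) ∧
      ∀ u ∈ V, u = ∑ i, g i u • e i := by
  let b := Module.finBasis ℂ V
  choose g hg using fun i => LinearMap.exists_extend (b.coord i)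
  refine ⟨_, fun i => (b i : W), g, fun i => (b i).2, fun u hu => ?_⟩
  have h1 : ∀ i, g i u = b.coord i ⟨u, hu⟩ := fun i =>
    LinearMap.congr_fun (hg i) ⟨u, hu⟩
  have := congrArg (Subtype.val) (b.sum_repr ⟨u, hu⟩)
  rw [Submodule.coe_sum] at this
  simpa only [h1, Module.Basis.coord_apply] using! this.symm

theorem VecRegularAt.apply {V : Submodule ℂ W} [FiniteDimensional ℂ V] {x : ℂ → W} {p : ℂ}
    {A : ℂ → Module.End ℂ W} (hx : VecRegularAt x p) (hxV : ∀ s, x s ∈ V)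
    (hA : ∀ u ∈ V, VecRegularAt (fun s => A s u) p) : VecRegularAt (fun s => A s (x s)) p := by
  obtain ⟨n, e, g, he, hg⟩ := exists_coordinates V
  intro φ
  have : (fun s => φ (A s (x s))) = fun s => ∑ i, g i (x s) * φ (A s (e i)) := by
    ext s
    conv_lhs => rw [hg _ (hxV s)]
    simp
  rw [this]
  exact Finset.analyticAt_fun_sum _ fun i _ => (hx (g i)).mul (hA _ (he i) φ)

theorem vecRegularAt_betheVector {h : Module.End ℂ W} {b : ℂ → ℂ → Module.End ℂ W} {η : ℂ}
    {v : ℂ → W} {k : ℤ}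
    (hb : ∀ (z l ν : ℂ), ∀ u ∈ h.eigenspace ν, b z l u ∈ h.eigenspace (ν - 2))
    (hv : ∀ l, v l ∈ h.eigenspace (2 * (k : ℂ)))
    [∀ k : ℤ, FiniteDimensional ℂ (h.eigenspace (2 * (k : ℂ)))] (p : ℂ)
    (ts : List (ℂ → ℂ)) (l : ℂ → ℂ)
    (hreg : ∀ f ∈ ts, ∀ j < ts.length, ∀ i < ts.length,
      ∀ u ∈ h.eigenspace (2 * ((k - i : ℤ) : ℂ)), VecRegularAt (fun s =>
        b (f s) (l s + 2 * η * j) u) p)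
    (hvreg : VecRegularAt (fun s => v (l s + 2 * η * ts.length)) p) :
    VecRegularAt (fun s => betheVector η b v (ts.map fun f => f s) (l s)) p := by
  induction ts generalizing l with
  | nil => simpa [betheVector] using! hvreg
  | cons f ts ih =>
    simp only [List.map_cons, betheVector]
    refine VecRegularAt.apply (V := h.eigenspace (2 * ((k - ts.length : ℤ) : ℂ)))
      (x := fun s => betheVector η b v (ts.map fun f => f s) (l s + 2 * η))
      (A := fun s => b (f s) (l s)) (ih (fun s => l s + 2 * η) ?_ ?_) ?_ ?_
    · intro g hg j hj i hi u hu
      have := hreg g (List.mem_cons_of_mem _ hg) (j + 1) (by simpa using hj) i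
        (by rw [List.length_cons]; omega) u hu
      convert this using 4
      push_cast
      ring
    · convert hvreg using 3
      push_cast [List.length_cons]
      ring
    · intro s
      simpa using betheVector_mem hb hv (ts.map fun f => f s) (l s + 2 * η)
    · intro u hu
      simpa using! hreg f (by simp) 0 (by simp) ts.length (by simp) u hu

end

theorem bethe_theta_ne {n m : ℕ} {τ η : ℂ} {z Λ : Fin n → ℂ} {c : ℂ} {t : Fin m → ℂ}
    (hbae : BetheEquations τ η z Λ c t) (i : Fin m) :
    (∀ j, j ≠ i → theta τ (t j - t i - 2 * η) ≠ 0 ∧ theta τ (t j - t i + 2 * η) ≠ 0) ∧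
    (∀ k, theta τ (t i - qPar η z Λ k) ≠ 0) ∧ ∀ k, theta τ (t i - pPar η z Λ k) ≠ 0 := by
  have h := hbae i
  have h0 := Complex.exp_ne_zero (4 * η * c)
  rw [← h] at h0
  have h1 := Finset.prod_ne_zero_iff.1 (left_ne_zero_of_mul h0)
  have h2 := Finset.prod_ne_zero_iff.1 (right_ne_zero_of_mul h0)
  simp only [div_ne_zero_iff] at h1 h2
  exact ⟨fun j hj => h1 j (by simpa using hj), fun k => (h2 k (Finset.mem_univ k)).1,
    fun k => (h2 k (Finset.mem_univ k)).2⟩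

theorem bethe_separated {n m : ℕ} {τ η : ℂ} (hτ : 0 < τ.im) {z Λ : Fin n → ℂ} {c : ℂ}
    {t : Fin m → ℂ} (ht : ∀ i j, i ≠ j → ∀ r s : ℤ, t i - t j ≠ r + s * τ)
    (hbae : BetheEquations τ η z Λ c t) (i j : Fin m) (hij : i ≠ j) :
    Separated τ η (t i) (t j) :=
  ⟨fun h => by
    obtain ⟨r, s, h⟩ := (theta_eq_zero_iff hτ).1 h
    exact ht i j hij r s h, ((bethe_theta_ne hbae j).1 i hij).1,
        ((bethe_theta_ne hbae j).1 i hij).2⟩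

theorem unwanted_eq_zero {n m : ℕ} {τ η : ℂ} (hτ : 0 < τ.im) {z Λ : Fin n → ℂ} {c : ℂ}
    {t : Fin m → ℂ} (ht : ∀ i j, i ≠ j → ∀ r s : ℤ, t i - t j ≠ r + s * τ)
    (hbae : BetheEquations τ η z Λ c t) (w l : ℂ) (i : Fin m) :
    unwanted τ η z Λ c t w l i = 0 := by
  have h := hbae i
  have hsep := fun j (hj : j ∈ Finset.univ.erase i) =>
    bethe_separated hτ ht hbae j i (Finset.ne_of_mem_erase hj)
  have h1 : (∏ j ∈ Finset.univ.erase i, theta τ (t j - t i - 2 * η) / theta τ (t j - t i)) =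
      (∏ j ∈ Finset.univ.erase i, theta τ (t j - t i - 2 * η) / theta τ (t j - t i + 2 * η)) *
      ∏ j ∈ Finset.univ.erase i, theta τ (t j - t i + 2 * η) / theta τ (t j - t i) := by
    rw [← Finset.prod_mul_distrib]
    refine Finset.prod_congr rfl fun j hj => ?_
    have := (hsep j hj).2.2
    field_simp
  have h2 : weightRatio τ η z Λ (t i) *
      (∏ k, theta τ (t i - qPar η z Λ k) / theta τ (t i - pPar η z Λ k)) = 1 := by
    rw [weightRatio, ← Finset.prod_mul_distrib]
    refine Finset.prod_eq_one fun k _ => ?_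
    have := (bethe_theta_ne hbae i).2.1 k
    have := (bethe_theta_ne hbae i).2.2 k
    field_simp
  have hE : Complex.exp (2 * η * c) = Complex.exp (-2 * η * c) * Complex.exp (4 * η * c) := by
    rw [← Complex.exp_add]; congr 1; ring
  rw [unwanted, h1, hE, ← h]
  generalize (∏ j ∈ Finset.univ.erase i, theta τ (t j - t i - 2 * η) / theta τ (t j - t i + 2 * η))
    = R
  generalize (∏ j ∈ Finset.univ.erase i, theta τ (t j - t i + 2 * η) / theta τ (t j - t i)) = P at *
  generalize (∏ k, theta τ (t i - qPar η z Λ k) / theta τ (t i - pPar η z Λ k)) = Q at *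
  refine mul_eq_zero_of_right _ ?_
  linear_combination (-Complex.exp (-2 * η * c) * R * P) * h2

theorem continuousAt_weightRatio {n : ℕ} {τ η : ℂ} (hτ : 0 < τ.im) {z Λ : Fin n → ℂ} {x : ℂ}
    (hx : ∀ k, theta τ (x - qPar η z Λ k) ≠ 0) : ContinuousAt (weightRatio τ η z Λ) x := by
  have hc : Continuous (theta τ) := (differentiable_theta hτ).continuous
  unfold weightRatio
  refine tendsto_finsetProd _ fun k _ => ?_
  exact ContinuousAt.div (by fun_prop) (by fun_prop) (hx k)

theorem continuousAt_betheEigenvalue {n m : ℕ} {τ η : ℂ} (hτ : 0 < τ.im) {z Λ : Fin n → ℂ} {c : ℂ}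
    {t : Fin m → ℂ} {w : ℂ} (h1 : ∀ j, theta τ (t j - w) ≠ 0)
    (h2 : ∀ k, theta τ (w - qPar η z Λ k) ≠ 0) : ContinuousAt (betheEigenvalue τ η z Λ c t) w := by
  have hc : Continuous (theta τ) := (differentiable_theta hτ).continuous
  unfold betheEigenvalue
  have hk : ∀ e : ℂ, ContinuousAt (fun w => ∏ j, theta τ (t j - w + e) / theta τ (t j - w)) w :=
    fun e => tendsto_finsetProd _ fun j _ =>
      ContinuousAt.div (f := fun w => theta τ (t j - w + e)) (by fun_prop) (by fun_prop) (h1 j)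
  have hk1 := hk (-(2 * η))
  simp only [← sub_eq_add_neg] at hk1
  exact (continuousAt_const.mul hk1).add
    ((continuousAt_const.mul (hk (2 * η))).mul (continuousAt_weightRatio hτ h2))

/-- The eigenvalue, with its removable singularities removed. -/
def regularizedEigenvalue {n m : ℕ} (τ η : ℂ) (z Λ : Fin n → ℂ) (c : ℂ) (t : Fin m → ℂ) (w : ℂ) :
    ℂ :=
  limUnder (𝓝[≠] w) (betheEigenvalue τ η z Λ c t)

theorem regularizedEigenvalue_eq {n m : ℕ} {τ η : ℂ} (hτ : 0 < τ.im) {z Λ : Fin n → ℂ} {c : ℂ}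
    {t : Fin m → ℂ} {w : ℂ} (h1 : ∀ j, theta τ (t j - w) ≠ 0)
    (h2 : ∀ k, theta τ (w - qPar η z Λ k) ≠ 0) :
    regularizedEigenvalue τ η z Λ c t w = betheEigenvalue τ η z Λ c t w :=
  ((continuousAt_betheEigenvalue hτ h1 h2).tendsto.mono_left nhdsWithin_le_nhds).limUnder_eq

section
variable {W : Type*} [AddCommGroup W] [Module ℂ W]

theorem eq_of_forall_dual_eq {u v : W} (h : ∀ φ : Module.Dual ℂ W, φ u = φ v) : u = v := by
  rw [← sub_eq_zero, ← Module.forall_dual_apply_eq_zero_iff ℂ]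
  intro φ
  rw [map_sub, h, sub_self]

variable {τ η μ : ℂ} {h : Module.End ℂ W} {L : ℂ → ℂ → Fin 2 → Fin 2 → Module.End ℂ W} {B : Set ℂ}

theorem RLLOn.transfer_bethe_of_generic (hτ : 0 < τ.im) (hB : B.Countable)
    (H : RLLOn τ η μ h L Bᶜ) {n m : ℕ} {z Λ : Fin n → ℂ} {v : ℂ → W}
    (hv : HighestWeightOn τ η μ h L Bᶜ z Λ m v)
    [∀ k : ℤ, FiniteDimensional ℂ (h.eigenspace (2 * (k : ℂ)))] {c : ℂ} {t : Fin m → ℂ}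
    (ht : ∀ i j, i ≠ j → ∀ r s : ℤ, t i - t j ≠ r + s * τ)
    (hbae : BetheEquations τ η z Λ c t)
    (hb : ∀ i, ∀ l ∈ latticeC η μ, ∀ k : ℤ, ∀ u ∈ h.eigenspace (2 * (k : ℂ)),
      VecRegularAt (fun s => L s l 0 1 u) (t i))
    {w : ℂ} (hw : w ∉ B) (htw : ∀ i, Separated τ η (t i) w) {l : ℂ} (hl : l ∈ latticeC η μ) :
    let ψ := betheVector η (fun x l => L x l 0 1) (fun l => gFn τ η c m l • v l) (List.ofFn t)
    L w l 0 0 (ψ (l - 2 * η)) + L w l 1 1 (ψ (l + 2 * η)) =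
      betheEigenvalue τ η z Λ c t w • ψ l := by
  intro ψ
  refine eq_of_forall_dual_eq fun φ => ?_
  have hc : Continuous (theta τ) := (differentiable_theta hτ).continuous
  have hm : ∀ l, v l ∈ h.eigenspace (2 * ((m : ℤ) : ℂ)) := by simpa using hv.mem
  have hgm : ∀ l, gFn τ η c m l • v l ∈ h.eigenspace (2 * ((m : ℤ) : ℂ)) :=
    fun l => Submodule.smul_mem _ _ (hm l)
  have hshift : ∀ i, ∀ l ∈ latticeC η μ, ∀ k : ℤ, ∀ u ∈ h.eigenspace (2 * (k : ℂ)),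
      VecRegularAt (fun s => L (t i + s) l 0 1 u) 0 := by
    intro i l hl k u hu φ
    exact (hb i l hl k u hu φ).comp_of_eq (f := fun s => t i + s)
      (analyticAt_const.add analyticAt_id) (by simp)
  have hlat : ∀ l ∈ latticeC η μ, ∀ j : ℕ, l + 2 * η * j ∈ latticeC η μ := fun l hl j => by
    simpa using latticeC_add_int hl (j : ℤ)
  have hψ : ∀ l ∈ latticeC η μ, VecRegularAt (fun s => betheVector η (fun x l => L x l 0 1)
      (fun l => gFn τ η c m l • v l) (List.ofFn fun i => t i + s) l) 0 := by
    intro l hl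
    have := vecRegularAt_betheVector H.weight_b hgm 0 (List.ofFn fun i => fun s => t i + s)
      (fun _ => l) (by
        intro f hf j _ k _ u hu
        obtain ⟨i, rfl⟩ := (List.mem_ofFn' _ _).1 hf
        exact hshift i _ (hlat l hl j) _ u hu) (vecRegularAt_const _ _)
    simpa [List.map_ofFn, Function.comp_def] using! this
  have hψ' : ∀ i, VecRegularAt (fun s => betheVector η (fun x l => L x l 0 1)
      v (List.ofFn (Function.update (fun i => t i + s) i w)) l) 0 := by
    intro i
    have := vecRegularAt_betheVector H.weight_b hm 0
      (List.ofFn (Function.update (fun i => fun s => t i + s) i fun _ => w))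
      (fun _ => l) (by
        intro f hf j _ k _ u hu
        obtain ⟨i', rfl⟩ := (List.mem_ofFn' _ _).1 hf
        by_cases hi : i' = i
        · subst hi
          simpa using! vecRegularAt_const _ _
        · simpa [hi] using! hshift i' _ (hlat l hl j) _ u hu) (vecRegularAt_const _ _)
    convert this using 4
    rw [List.map_ofFn]
    congr 1
    ext i'
    by_cases hi : i' = i
    · subst hi; simp
    · simp [hi]
  have hEig : ContinuousAt (fun s => betheEigenvalue τ η z Λ c (fun i => t i + s) w) 0 := by
    unfold betheEigenvalue
    have hk : ∀ e : ℂ, ContinuousAt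
        (fun s => ∏ j, theta τ (t j + s - w + e) / theta τ (t j + s - w)) 0 :=
      fun e => tendsto_finsetProd _ fun j _ =>
        ContinuousAt.div (f := fun s => theta τ (t j + s - w + e)) (by fun_prop) (by fun_prop)
          (by simpa using (htw j).1)
    have hk1 := hk (-(2 * η))
    simp only [← sub_eq_add_neg] at hk1
    exact (continuousAt_const.mul hk1).add
      ((continuousAt_const.mul (hk (2 * η))).mul continuousAt_const)
  have hU : ∀ i, ContinuousAt (fun s => unwanted τ η z Λ c (fun i => t i + s) w l i) 0 := by
    intro i
    have h1 : ContinuousAt (fun s => weightRatio τ η z Λ (t i + s)) 0 :=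
      ContinuousAt.comp_of_eq (g := weightRatio τ η z Λ) (f := fun s => t i + s)
        (continuousAt_weightRatio hτ (bethe_theta_ne hbae i).2.1)
        (continuousAt_const.add continuousAt_id) (by simp)
    unfold unwanted
    simp only [add_sub_add_right_eq_sub]
    refine (continuousAt_const.mul (ContinuousAt.div (by fun_prop) (by fun_prop) ?_)).mul
      (continuousAt_const.sub ((continuousAt_const.mul h1).mul continuousAt_const))
    simpa using mul_ne_zero (H.theta_ne l hl) (htw i).1
  have hlhs := ((hψ _ (latticeC_sub hl)).map (L w l 0 0)).add
    ((hψ _ (latticeC_add hl)).map (L w l 1 1)) φ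
  have hBs : (⋃ i, {s | t i + s ∈ B}).Countable :=
    Set.countable_iUnion fun i => hB.preimage_of_injOn (fun x _ y _ hxy => by simpa using hxy)
  have hnear : ∀ᶠ s in 𝓝 (0 : ℂ), ∀ i, Separated τ η (t i + s) w := by
    refine eventually_all.2 fun i => ?_
    have hn : ∀ f : ℂ → ℂ, Continuous f → f 0 ≠ 0 → ∀ᶠ s in 𝓝 (0 : ℂ), f s ≠ 0 :=
      fun f hf h0 => hf.continuousAt.eventually_ne h0
    exact (hn (fun s => theta τ (t i + s - w)) (by fun_prop) (by simpa using (htw i).1)).and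
      ((hn (fun s => theta τ (t i + s - w - 2 * η)) (by fun_prop) (by simpa using (htw i).2.1)).and
      (hn (fun s => theta τ (t i + s - w + 2 * η)) (by fun_prop) (by simpa using (htw i).2.2)))
  have := eq_of_continuousAt_of_countable hBs hlhs.continuousAt
    ((hEig.mul (hψ l hl φ).continuousAt).add
      (tendsto_finsetSum Finset.univ fun i _ => (hU i).mul (hψ' i φ).continuousAt)) (by
      filter_upwards [hnear] with s hs hsB
      have hsB' : ∀ i, t i + s ∈ Bᶜ := by simpa using hsB
      have := congrArg φ (H.transfer_betheVector hτ hv c (fun i => t i + s) hsB'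
        (fun i j hij => by
          have := bethe_separated hτ ht hbae i j hij
          simpa [Separated] using this) hw hs hl)
      simpa using! this)
  simp only [Pi.add_apply, Pi.mul_apply, add_zero, unwanted_eq_zero hτ ht hbae, zero_mul,
    Finset.sum_const_zero] at this
  simpa only [add_zero, map_smul, smul_eq_mul] using! this

theorem RLLOn.transfer_bethe (hτ : 0 < τ.im) (hB : B.Countable)
    (H : RLLOn τ η μ h L Bᶜ) {n m : ℕ} {z Λ : Fin n → ℂ} {v : ℂ → W}
    (hv : HighestWeightOn τ η μ h L Bᶜ z Λ m v)
    [∀ k : ℤ, FiniteDimensional ℂ (h.eigenspace (2 * (k : ℂ)))] {c : ℂ} {t : Fin m → ℂ}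
    (ht : ∀ i j, i ≠ j → ∀ r s : ℤ, t i - t j ≠ r + s * τ)
    (hbae : BetheEquations τ η z Λ c t)
    (hb : ∀ i, ∀ l ∈ latticeC η μ, ∀ k : ℤ, ∀ u ∈ h.eigenspace (2 * (k : ℂ)),
      VecRegularAt (fun s => L s l 0 1 u) (t i))
    {w : ℂ} (hw : ∀ l ∈ latticeC η μ, ∀ α, ∀ u ∈ h.eigenspace (0 : ℂ),
      VecRegularAt (fun s => L s l α α u) w) {l : ℂ} (hl : l ∈ latticeC η μ) :
    let ψ := betheVector η (fun x l => L x l 0 1) (fun l => gFn τ η c m l • v l) (List.ofFn t)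
    L w l 0 0 (ψ (l - 2 * η)) + L w l 1 1 (ψ (l + 2 * η)) =
      regularizedEigenvalue τ η z Λ c t w • ψ l := by
  intro ψ
  have hψ0 : ∀ l, ψ l ∈ h.eigenspace (0 : ℂ) := fun l => by
    have hgm : ∀ l, gFn τ η c m l • v l ∈ h.eigenspace (2 * ((m : ℤ) : ℂ)) :=
      fun l => Submodule.smul_mem _ _ (by simpa using hv.mem l)
    simpa using betheVector_mem H.weight_b hgm (List.ofFn t) l
  set B' : Set ℂ := B ∪ ⋃ i, {w | ¬ Separated τ η (t i) w} with hB'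
  have hB'c : B'.Countable := hB.union (Set.countable_iUnion fun i =>
      countable_not_separated hτ η _)
  have hid : ∀ x ∉ B', ∀ l ∈ latticeC η μ, L x l 0 0 (ψ (l - 2 * η)) + L x l 1 1 (ψ (l + 2 * η)) =
      betheEigenvalue τ η z Λ c t x • ψ l := by
    intro x hx l hl
    simp only [hB', Set.mem_union, Set.mem_iUnion, Set.mem_ofPred_eq, not_or, not_exists,
      not_not] at hx
    exact H.transfer_bethe_of_generic hτ hB hv ht hbae hb hx.1 hx.2 hl
  by_cases hz : ∀ l ∈ latticeC η μ, ψ l = 0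
  · simp [hz _ (latticeC_sub hl), hz _ (latticeC_add hl), hz _ hl]
  push Not at hz
  obtain ⟨l₁, hl₁, hne⟩ := hz
  obtain ⟨φ₁, hφ₁⟩ : ∃ φ : Module.Dual ℂ W, φ (ψ l₁) ≠ 0 := by
    by_contra! h0
    exact hne ((Module.forall_dual_apply_eq_zero_iff ℂ _).1 h0)
  have hreg : ∀ l ∈ latticeC η μ, VecRegularAt
      (fun x => L x l 0 0 (ψ (l - 2 * η)) + L x l 1 1 (ψ (l + 2 * η))) w := fun l hl =>
    (hw l hl 0 _ (hψ0 _)).add (hw l hl 1 _ (hψ0 _))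
  set F : ℂ → ℂ := fun x => φ₁ (L x l₁ 0 0 (ψ (l₁ - 2 * η)) + L x l₁ 1 1 (ψ (l₁ + 2 * η))) /
    φ₁ (ψ l₁) with hF
  have hFan : AnalyticAt ℂ F w := (hreg l₁ hl₁ φ₁).div analyticAt_const hφ₁
  have hFE : ∀ x ∉ B', F x = betheEigenvalue τ η z Λ c t x := by
    intro x hx
    simp only [hF, hid x hx l₁ hl₁, map_smul, smul_eq_mul]
    field_simp
  have hpunct : ∀ᶠ x in 𝓝[≠] w, F x = betheEigenvalue τ η z Λ c t x := by
    have h1 : ∀ᶠ x in 𝓝[≠] w, ∀ j, theta τ (t j - x) ≠ 0 := eventually_all.2 fun j => by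
      filter_upwards [eventually_theta_add_ne_zero hτ (-t j) w] with x hx
      rw [show t j - x = -(x + -t j) by ring, theta_neg]
      exact neg_ne_zero.2 hx
    have h2 : ∀ᶠ x in 𝓝[≠] w, ∀ k, theta τ (x - qPar η z Λ k) ≠ 0 := eventually_all.2 fun k => by
      simpa only [sub_eq_add_neg] using eventually_theta_add_ne_zero hτ (-qPar η z Λ k) w
    filter_upwards [h1, h2, nhdsWithin_le_nhds hFan.eventually_analyticAt] with x h1 h2 h3
    exact eq_of_continuousAt_of_countable hB'c h3.continuousAt
      (continuousAt_betheEigenvalue hτ h1 h2)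
      (Eventually.of_forall hFE)
  have hε : regularizedEigenvalue τ η z Λ c t w = F w :=
    ((hFan.continuousAt.tendsto.mono_left nhdsWithin_le_nhds).congr' hpunct).limUnder_eq
  rw [hε]
  refine eq_of_forall_dual_eq fun φ => ?_
  have := eq_of_continuousAt_of_countable hB'c (hreg l hl φ).continuousAt
    (hFan.continuousAt.mul (continuousAt_const (y := φ (ψ l))))
    (Eventually.of_forall fun x hx => by
      change φ (L x l 0 0 (ψ (l - 2 * η)) + L x l 1 1 (ψ (l + 2 * η))) = F x * φ (ψ l)
      rw [hid x hx l hl, hFE x hx, map_smul, smul_eq_mul])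
  rw [map_smul]
  exact this

end

/-! ### Generic dynamical parameters -/

theorem countable_compl_of_mem_codiscrete {s : Set ℂ} (hs : s ∈ codiscrete ℂ) : sᶜ.Countable :=
  (HereditarilyLindelofSpace.isLindelof _).countable_of_isDiscrete (mem_codiscrete'.1 hs).2

theorem eventually_codiscrete_add {p : ℂ → Prop} (hp : ∀ᶠ l in codiscrete ℂ, p l) (a : ℂ) :
    ∀ᶠ l in codiscrete ℂ, p (l + a) := by
  have h1 : ∀ x, ∀ᶠ l in 𝓝[≠] x, p l := fun x => by
    simpa using! disjoint_principal_right.1 (mem_codiscrete.1 hp x)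
  refine mem_codiscrete.2 fun x => disjoint_principal_right.2 ?_
  rw [compl_compl]
  have : Tendsto (fun x => x + a) (𝓝[≠] x) (𝓝[≠] (x + a)) := by
    refine tendsto_nhdsWithin_iff.2 ⟨?_, ?_⟩
    · exact ((continuous_id.add continuous_const).tendsto x).mono_left nhdsWithin_le_nhds
    · filter_upwards [self_mem_nhdsWithin] with y hy
      simpa using hy
  exact this.eventually (h1 (x + a))

theorem countable_zeros {f : ℂ → ℂ} {U : Set ℂ} (hf : AnalyticOnNhd ℂ f U) (hU : IsPreconnected U)
    {x : ℂ} (hx : x ∈ U) (h : f x ≠ 0) : {y | y ∈ U ∧ f y = 0}.Countable := by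
  have h1 := (hf.eqOn_zero_or_eventually_ne_zero_of_preconnected hU).resolve_left
    fun h0 => h (h0 hx)
  rw [show {y | y ∈ U ∧ f y = 0} = {y | f y = 0} ∩ U by ext; simp [and_comm]]
  refine (HereditarilyLindelofSpace.isLindelof _).countable_of_isDiscrete
    (isDiscrete_of_codiscreteWithin ?_)
  filter_upwards [h1] with y hy h2 using hy h2

/-- For `l` outside a countable set, a meromorphic function of two variables has countably many
singularities on the line with second coordinate `l`. -/
theorem IsMeromorphic₂.exists_countable {F : ℂ × ℂ → ℂ} (hF : IsMeromorphic₂ F) :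
    ∃ E : Set ℂ, E.Countable ∧ ∀ l ∉ E, {z | ¬ AnalyticAt ℂ F (z, l)}.Countable := by
  have hloc : ∀ p : ℂ × ℂ, ∃ r > 0, ∃ E : Set ℂ, E.Countable ∧ ∀ l ∈ Metric.ball p.2 r, l ∉ E →
      {z | z ∈ Metric.ball p.1 r ∧ ¬ AnalyticAt ℂ F (z, l)}.Countable := by
    intro p
    obtain ⟨f, g, hf, hg, hne, hFg⟩ := hF p
    have hev := (hf.eventually_analyticAt.and hg.eventually_analyticAt).and hFg
    obtain ⟨r, hr, hball⟩ := Metric.eventually_nhds_iff_ball.1 hev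
    obtain ⟨⟨z₁, l₁⟩, hg1, hmem⟩ := (hne.and_eventually (Metric.ball_mem_nhds p hr)).exists
    change (z₁, l₁) ∈ Metric.ball (p.1, p.2) r at hmem
    rw [← Prod.mk.eta (p := p)] at hball
    rw [← ball_prod_same] at hball hmem
    have hg2 : ∀ l ∈ Metric.ball p.2 r, AnalyticOnNhd ℂ (fun z => g (z, l)) (Metric.ball p.1 r) :=
      fun l hl z hz => (hball (z, l) ⟨hz, hl⟩).1.2.comp₂ (f := fun z => z) (g := fun _ => l)
        analyticAt_id analyticAt_const
    have hg3 : ∀ z ∈ Metric.ball p.1 r, AnalyticOnNhd ℂ (fun l => g (z, l)) (Metric.ball p.2 r) :=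
      fun z hz l hl => (hball (z, l) ⟨hz, hl⟩).1.2.comp₂ (f := fun _ => z) (g := fun l => l)
        analyticAt_const analyticAt_id
    refine ⟨r, hr, {l | l ∈ Metric.ball p.2 r ∧ g (z₁, l) = 0},
      countable_zeros (hg3 z₁ hmem.1) (convex_ball _ _).isPreconnected hmem.2 hg1, ?_⟩
    intro l hl hlE
    refine (countable_zeros (hg2 l hl) (convex_ball _ _).isPreconnected hmem.1
      (fun h0 => hlE ⟨hl, h0⟩)).mono ?_
    rintro z ⟨hz, hzF⟩
    refine ⟨hz, by_contra fun h0 => hzF ?_⟩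
    have h1 := (hball (z, l) ⟨hz, hl⟩).1
    refine (h1.1.div h1.2 h0).congr ?_
    have hopen : Metric.ball p.1 r ×ˢ Metric.ball p.2 r ∈ 𝓝 (z, l) :=
      (Metric.isOpen_ball.prod Metric.isOpen_ball).mem_nhds ⟨hz, hl⟩
    filter_upwards [hopen, h1.2.continuousAt.eventually_ne h0] with q hq hgq
    exact ((hball q hq).2 hgq).symm
  choose r hr E hE hreg using hloc
  obtain ⟨s, hs, hcover⟩ := TopologicalSpace.countable_cover_nhds
    (f := fun p : ℂ × ℂ => Metric.ball p.1 (r p) ×ˢ Metric.ball p.2 (r p))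
    (fun p => (Metric.isOpen_ball.prod Metric.isOpen_ball).mem_nhds
      ⟨Metric.mem_ball_self (hr p), Metric.mem_ball_self (hr p)⟩)
  refine ⟨⋃ p ∈ s, E p, hs.biUnion fun p _ => hE p, fun l hl => ?_⟩
  have : {z | ¬ AnalyticAt ℂ F (z, l)} ⊆ ⋃ p ∈ s, {z | (z ∈ Metric.ball p.1 (r p) ∧
      ¬ AnalyticAt ℂ F (z, l)) ∧ l ∈ Metric.ball p.2 (r p)} := by
    intro z hz
    have := Set.mem_univ (z, l)
    rw [← hcover] at this
    simp only [Set.mem_iUnion] at this ⊢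
    obtain ⟨p, hp, hzp⟩ := this
    exact ⟨p, hp, ⟨hzp.1, hz⟩, hzp.2⟩
  refine (hs.biUnion fun p hp => ?_).mono this
  by_cases hlp : l ∈ Metric.ball p.2 (r p)
  · exact (hreg p l hlp fun h => hl (Set.mem_biUnion hp h)).mono fun z hz => hz.1
  · refine Set.countable_empty.mono fun z hz => hlp hz.2

section
variable {W : Type*} [AddCommGroup W] [Module ℂ W]

theorem countable_zeros_of_vecRegularAt {V : Submodule ℂ W} [FiniteDimensional ℂ V] {ψ : ℂ → W}
    (hV : ∀ l, ψ l ∈ V) (hreg : ∀ᶠ l in codiscrete ℂ, VecRegularAt ψ l)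
    (hne : ¬ ψ =ᶠ[codiscrete ℂ] 0) : {l | ψ l = 0}.Countable := by
  obtain ⟨n, e, g, he, hg⟩ := exists_coordinates V
  set A : Fin n → Set ℂ := fun i => {l | AnalyticAt ℂ (fun x => g i (ψ x)) l} with hA
  have hAc : ∀ i, A i ∈ codiscrete ℂ := fun i => by
    filter_upwards [hreg] with l hl using hl (g i)
  obtain ⟨i, x, hx, hne⟩ : ∃ i, ∃ x ∈ A i, g i (ψ x) ≠ 0 := by
    by_contra! h0
    refine hne ?_
    filter_upwards [eventually_all.2 hAc] with l hl
    rw [hg _ (hV l)]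
    exact Finset.sum_eq_zero fun i _ => by rw [h0 i l (hl i), zero_smul]
  have hconn : IsPreconnected (A i) := by
    have := ((countable_compl_of_mem_codiscrete (hAc i)).isPathConnected_compl_of_one_lt_rank
      (by rw [Complex.rank_real_complex]; norm_num)).isConnected.isPreconnected
    rwa [compl_compl] at this
  refine ((countable_zeros (fun y hy => hy) hconn hx hne).union
    (countable_compl_of_mem_codiscrete (hAc i))).mono fun l hl => ?_
  by_cases hl' : l ∈ A i
  · exact Or.inl ⟨hl', by rw [show ψ l = 0 from hl, map_zero]⟩
  · exact Or.inr hl'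

theorem EntryRegularAt.vecRegularAt_fst {h : Module.End ℂ W}
    {L : ℂ → ℂ → Fin 2 → Fin 2 → Module.End ℂ W} {β α : Fin 2} {ν z l : ℂ}
    (hreg : EntryRegularAt h L β α ν z l) {u : W} (hu : u ∈ h.eigenspace ν) :
    VecRegularAt (fun s => L s l β α u) z := fun φ =>
  (hreg u hu φ).comp₂ (f := fun s => s) (g := fun _ => l) analyticAt_id analyticAt_const

theorem EntryRegularAt.vecRegularAt_snd {h : Module.End ℂ W}
    {L : ℂ → ℂ → Fin 2 → Fin 2 → Module.End ℂ W} {β α : Fin 2} {ν z l a : ℂ}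
    (hreg : EntryRegularAt h L β α ν z (l + a)) {u : W} (hu : u ∈ h.eigenspace ν) :
    VecRegularAt (fun s => L z (s + a) β α u) l := fun φ =>
  (hreg u hu φ).comp₂ (f := fun _ => z) (g := fun s => s + a) analyticAt_const
    (analyticAt_id.add analyticAt_const)

namespace EModule

variable {τ η : ℂ} (M : EModule τ η W)

theorem exists_countable_entryRegularAt (β α : Fin 2) (ν : ℂ) :
    ∃ E : Set ℂ, E.Countable ∧ ∀ l ∉ E, {z | ¬ EntryRegularAt M.h M.L β α ν z l}.Countable := by
  have := M.finite_weight ν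
  have := M.finite_weight (ν + sgn α - sgn β)
  obtain ⟨n, e, g, he, hg⟩ := exists_coordinates (M.h.eigenspace ν)
  obtain ⟨n', e', g', he', hg'⟩ := exists_coordinates (M.h.eigenspace (ν + sgn α - sgn β))
  choose E hE hreg using fun i j => (M.L_merom β α (e i) (g' j)).exists_countable
  refine ⟨⋃ i, ⋃ j, E i j, Set.countable_iUnion fun i => Set.countable_iUnion fun j => hE i j,
    fun l hl => ?_⟩
  simp only [Set.mem_iUnion, not_exists] at hl
  refine (Set.countable_iUnion fun i => Set.countable_iUnion fun j => hreg i j l (hl i j)).mono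
    fun z hz => ?_
  by_contra hcon
  simp only [Set.mem_iUnion, Set.mem_ofPred_eq, not_exists, not_not] at hcon
  refine hz fun u hu φ => ?_
  have : (fun p : ℂ × ℂ => φ (M.L p.1 p.2 β α u)) = fun p => ∑ i, ∑ j,
      (g i u * φ (e' j)) * g' j (M.L p.1 p.2 β α (e i)) := by
    ext p
    conv_lhs => rw [hg u hu]
    simp only [map_sum, map_smul, smul_eq_mul]
    refine Finset.sum_congr rfl fun i _ => ?_
    conv_lhs => rw [hg' _ (M.L_weight p.1 p.2 β α ν _ (he i))]
    simp only [map_sum, map_smul, smul_eq_mul, Finset.mul_sum]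
    exact Finset.sum_congr rfl fun j _ => by ring
  rw [this]
  exact Finset.analyticAt_fun_sum _ fun i _ => Finset.analyticAt_fun_sum _ fun j _ =>
    analyticAt_const.mul (hcon i j)

theorem bethe_mem {n m : ℕ} {z Λ : Fin n → ℂ} {v₀ : ℂ → W} (hΛ : ∑ j, Λ j = 2 * (m : ℂ))
    (hv : M.IsHighestWeightVector z Λ v₀) (c : ℂ) (t : Fin m → ℂ) (l : ℂ) :
    M.bethe v₀ c t l ∈ M.h.eigenspace (0 : ℂ) := by
  have hgm : ∀ l, gFn τ η c m l • v₀ l ∈ M.h.eigenspace (2 * ((m : ℤ) : ℂ)) :=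
    fun l => Submodule.smul_mem _ _ (by simpa [hΛ] using hv.mem l)
  simpa [bethe] using betheVector_mem (b := fun x l => M.L x l 0 1) (η := η)
    (fun z l ν u hu => by
      have := M.L_weight z l 0 1 ν u hu
      convert this using 2
      simp
      ring) hgm (List.ofFn t) l

theorem bethe_vecRegularAt (hτ : 0 < τ.im) {n m : ℕ} {z Λ : Fin n → ℂ} {v₀ : ℂ → W}
    (hΛ : ∑ j, Λ j = 2 * (m : ℂ)) (hv : M.IsHighestWeightVector z Λ v₀) (c : ℂ) (t : Fin m → ℂ)
    {l : ℂ} (hreg : ∀ i : Fin m, ∀ j : Fin m, ∀ k : Fin m,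
      EntryRegularAt M.h M.L 0 1 (2 * ((m - (k : ℕ) : ℤ) : ℂ)) (t i) (l + 2 * η * (j : ℕ)))
    (hvreg : VecRegularAt v₀ (l + 2 * η * m)) : VecRegularAt (M.bethe v₀ c t) l := by
  have hd := differentiable_theta hτ
  have hgan : Differentiable ℂ (gFn τ η c m) := by
    unfold gFn
    fun_prop
  have : ∀ k : ℤ, FiniteDimensional ℂ (M.h.eigenspace (2 * (k : ℂ))) := fun k => M.finite_weight _
  have hgm : ∀ l, gFn τ η c m l • v₀ l ∈ M.h.eigenspace (2 * ((m : ℤ) : ℂ)) :=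
    fun l => Submodule.smul_mem _ _ (by simpa [hΛ] using hv.mem l)
  have := vecRegularAt_betheVector (b := fun x l => M.L x l 0 1) (η := η)
    (fun z l ν u hu => by
      have := M.L_weight z l 0 1 ν u hu
      convert this using 2
      simp
      ring) hgm l (List.ofFn fun i => fun _ : ℂ => t i) (fun s => s)
    (by
      intro f hf j hj k hk u hu
      rw [List.length_ofFn] at hj hk
      obtain ⟨i, rfl⟩ := (List.mem_ofFn' _ _).1 hf
      exact (hreg i ⟨j, hj⟩ ⟨k, hk⟩).vecRegularAt_snd hu)
    (by
      rw [List.length_ofFn]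
      have h1 : AnalyticAt ℂ (fun s => s + 2 * η * (m : ℂ)) l := analyticAt_id.add analyticAt_const
      refine VecRegularAt.smul ((hgan.analyticAt (l + 2 * η * m)).comp_of_eq h1 rfl)
        fun φ => (hvreg φ).comp_of_eq h1 rfl)
  simpa [bethe, List.map_ofFn, Function.comp_def] using! this

theorem highestWeight_vecRegularAt_countable {n : ℕ} {z Λ : Fin n → ℂ} {v₀ : ℂ → W}
    (hv : M.IsHighestWeightVector z Λ v₀) : ∀ᶠ l in codiscrete ℂ, VecRegularAt v₀ l := by
  have := M.finite_weight (∑ j, Λ j)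
  obtain ⟨n', e, g, he, hg⟩ := exists_coordinates (M.h.eigenspace (∑ j, Λ j))
  have : ∀ i, ∀ᶠ l in codiscrete ℂ, AnalyticAt ℂ (fun x => g i (v₀ x)) l := fun i =>
    (meromorphicOn_univ.2 (hv.merom (g i))).eventually_codiscreteWithin_analyticAt
  filter_upwards [eventually_all.2 this] with l hl
  intro φ
  have : (fun x => φ (v₀ x)) = fun x => ∑ i, g i (v₀ x) * φ (e i) := by
    ext x
    conv_lhs => rw [hg _ (hv.mem x)]
    simp
  rw [this]
  exact Finset.analyticAt_fun_sum _ fun i _ => (hl i).mul analyticAt_const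

theorem bethe_main (hτ : 0 < τ.im) {n m : ℕ} {z Λ : Fin n → ℂ}
    (hΛ : ∑ j, Λ j = 2 * (m : ℂ)) (c : ℂ) (t : Fin m → ℂ)
    (ht : ∀ i j, i ≠ j → ∀ r s : ℤ, t i - t j ≠ r + s * τ)
    (hbae : BetheEquations τ η z Λ c t) (v₀ : ℂ → W) (hv : M.IsHighestWeightVector z Λ v₀)
    (hb : ∀ i, M.BDefinedAt (t i)) :
    ∃ E : Set ℂ, E.Countable ∧ ∀ μ ∉ E,
      {w | ¬ M.TransferDefinedOn μ w}.Countable ∧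
      (∀ l ∈ latticeC η μ, VecRegularAt (M.bethe v₀ c t) l) ∧
      ∃ ψ : M.FunZero μ, (∀ l, (ψ l : W) = M.bethe v₀ c t l) ∧
        (∀ w, M.TransferDefinedOn μ w →
          M.transfer μ w ψ = regularizedEigenvalue τ η z Λ c t w • ψ) ∧
        (¬ (M.bethe v₀ c t =ᶠ[Filter.codiscrete ℂ] 0) → ψ ≠ 0) := by
  have : ∀ k : ℤ, FiniteDimensional ℂ (M.h.eigenspace (2 * (k : ℂ))) := fun k => M.finite_weight _
  have := M.finite_weight 0
  choose E₀ hE₀ hreg₀ using fun (p : Fin 2 × Fin 2 × ℤ) =>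
    M.exists_countable_entryRegularAt p.1 p.2.1 (2 * (p.2.2 : ℂ))
  have hvreg := M.highestWeight_vecRegularAt_countable hv
  have hψreg : ∀ᶠ l in codiscrete ℂ, VecRegularAt (M.bethe v₀ c t) l := by
    have h1 : ∀ᶠ l in codiscrete ℂ, ∀ i : Fin m, ∀ j : Fin m, ∀ k : Fin m,
        EntryRegularAt M.h M.L 0 1 (2 * ((m - (k : ℕ) : ℤ) : ℂ)) (t i) (l + 2 * η * (j : ℕ)) :=
      eventually_all.2 fun i => eventually_all.2 fun j => eventually_all.2 fun k =>
        eventually_codiscrete_add (hb i _) _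
    filter_upwards [h1, eventually_codiscrete_add hvreg (2 * η * m)] with l h1 h2
    exact M.bethe_vecRegularAt hτ hΛ hv c t h1 h2
  set Z : Set ℂ := {l | M.bethe v₀ c t l = 0 ∧ ¬ (M.bethe v₀ c t =ᶠ[codiscrete ℂ] 0)} with hZ
  have hZc : Z.Countable := by
    by_cases h0 : M.bethe v₀ c t =ᶠ[codiscrete ℂ] 0
    · refine Set.countable_empty.mono fun l hl => hl.2 h0
    · exact (countable_zeros_of_vecRegularAt (M.bethe_mem hΛ hv c t) hψreg h0).mono fun l hl => hl.1
  set D : Set ℂ := (⋃ p, E₀ p) ∪ {l | theta τ l = 0} ∪ {l | VecRegularAt v₀ l}ᶜ ∪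
    (⋃ (i : Fin m) (k : ℤ), {l | EntryRegularAt M.h M.L 0 1 (2 * (k : ℂ)) (t i) l}ᶜ) ∪ Z with hD
  have hDc : D.Countable := by
    refine ((((Set.countable_iUnion hE₀).union (countable_theta_zeros hτ)).union
      (countable_compl_of_mem_codiscrete hvreg)).union ?_).union hZc
    exact Set.countable_iUnion fun i => Set.countable_iUnion fun k =>
      countable_compl_of_mem_codiscrete (hb i _)
  refine ⟨⋃ k : ℤ, {μ | μ + 2 * η * k ∈ D}, Set.countable_iUnion fun k =>
    hDc.preimage_of_injOn (fun x _ y _ hxy => by simpa using hxy), fun μ hμ => ?_⟩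
  have hlat : ∀ l ∈ latticeC η μ, l ∉ D := by
    rintro l ⟨k, rfl⟩ hl
    exact hμ (Set.mem_iUnion.2 ⟨k, hl⟩)
  simp only [hD, Set.mem_union, Set.mem_iUnion, Set.mem_compl_iff, Set.mem_ofPred_eq, not_or,
    not_exists, not_not] at hlat
  have hlatc : (latticeC η μ).Countable := by
    refine (Set.countable_range fun j : ℤ => μ + 2 * η * j).mono ?_
    rintro l ⟨j, rfl⟩
    exact ⟨j, rfl⟩
  set B : Set ℂ := (⋃ l ∈ latticeC η μ, ⋃ p : Fin 2 × Fin 2 × ℤ,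
    {x | ¬ EntryRegularAt M.h M.L p.1 p.2.1 (2 * (p.2.2 : ℂ)) x l}) ∪
    ⋃ j, {x | theta τ (x - qPar η z Λ j) = 0} with hBdef
  have hBc : B.Countable :=
    (hlatc.biUnion fun l hl => Set.countable_iUnion fun p =>
      hreg₀ p l ((hlat l hl).1.1.1.1 p)).union
      (Set.countable_iUnion fun j => countable_theta_comp_zeros hτ (sub_left_injective))
  have hBreg : ∀ x ∉ B, (∀ l ∈ latticeC η μ, ∀ (β α : Fin 2) (k : ℤ),
      EntryRegularAt M.h M.L β α (2 * (k : ℂ)) x l) ∧ ∀ j, theta τ (x - qPar η z Λ j) ≠ 0 := by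
    intro x hx
    simp only [hBdef, Set.mem_union, Set.mem_iUnion, Set.mem_ofPred_eq, not_or, not_exists,
      not_not] at hx
    exact ⟨fun l hl β α k => hx.1 l hl (β, α, k), hx.2⟩
  have hΛ' : ∑ j, Λ j = 2 * ((m : ℤ) : ℂ) := by simpa using hΛ
  have H : RLLOn τ η μ M.h M.L Bᶜ := by
    refine ⟨fun l hl => (hlat l hl).1.1.1.2, M.L_weight, ?_⟩
    intro x hx w hw hxw l hl k u hu
    refine M.rll x w l (2 * k) hxw (hlat l hl).1.1.1.2 (fun k' => ?_) ?_ u hu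
    · have := (hlat _ (latticeC_add_int hl (-(2 * k + k')))).1.1.1.2
      convert this using 2
      push_cast
      ring
    · intro k' _ s _ β α
      rw [show (2 * k + 2 * k' : ℂ) = 2 * ((k + k' : ℤ) : ℂ) by push_cast; ring]
      exact ⟨(hBreg x hx).1 _ (latticeC_add_int hl s) β α _,
        (hBreg w hw).1 _ (latticeC_add_int hl s) β α _⟩
  have hHW : HighestWeightOn τ η μ M.h M.L Bᶜ z Λ m v₀ := by
    refine ⟨fun l => hΛ ▸ hv.mem l, ?_, ?_⟩
    · intro x hx l hl
      refine hv.a_apply x l ?_ (hlat _ (latticeC_sub hl)).1.1.2 (hlat _ hl).1.1.2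
      rw [hΛ']
      exact (hBreg x hx).1 l hl 0 0 _
    · intro x hx l hl
      rw [hv.d_apply x l ?_ (hlat _ (latticeC_add hl)).1.1.2 (hlat _ hl).1.1.2
        (hlat l hl).1.1.1.2 (hBreg x hx).2, highestD, hΛ,
        show l - 2 * η * (2 * m) = l - 4 * η * m by ring]
      · rfl
      · rw [hΛ']
        exact (hBreg x hx).1 l hl 1 1 _
  refine ⟨?_, ?_, fun l => ⟨M.bethe v₀ c t l, M.bethe_mem hΛ hv c t l⟩, fun _ => rfl, ?_, ?_⟩
  · refine hBc.mono fun w hw => ?_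
    by_contra hwB
    refine hw fun l hl => ?_
    have := (hBreg w hwB).1 l hl
    exact ⟨by simpa using this 0 0 0, by simpa using this 1 1 0⟩
  · intro l hl
    refine M.bethe_vecRegularAt hτ hΛ hv c t (fun i j k => ?_) ?_
    · have := (hlat _ (latticeC_add_int hl (j : ℕ))).1.2 i (m - (k : ℕ))
      simpa using this
    · have := (hlat _ (latticeC_add_int hl (m : ℕ))).1.1.2
      simpa using this
  · intro w hw
    funext l
    refine Subtype.ext ?_
    exact H.transfer_bethe hτ hBc hHW ht hbae
      (fun i l hl k u hu => ((hlat l hl).1.2 i k).vecRegularAt_fst hu)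
      (fun l hl α u hu => by
        fin_cases α
        · exact (hw l hl).1.vecRegularAt_fst hu
        · exact (hw l hl).2.vecRegularAt_fst hu) l.2
  · intro hne h0
    have hμ : μ ∈ latticeC η μ := ⟨0, by simp⟩
    refine (hlat μ hμ).2 ⟨?_, hne⟩
    exact congrArg Subtype.val (congrFun h0 ⟨μ, hμ⟩)

end EModule
end

/-! ### Tensor products of evaluation Verma modules -/

theorem tensorL_apply {ι : Type} [DecidableEq ι] {n : ℕ} (η : ℂ) (wt : Fin n → ι → ℂ)
    (next : Fin 2 → Fin 2 → ι → ι) (coef : Fin n → ℂ → ℂ → Fin 2 → Fin 2 → ι → ℂ) (x l : ℂ)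
    (β α : Fin 2) (v : (Fin n → ι) →₀ ℂ) (K' : Fin n → ι) :
    tensorL η wt next coef x l β α v K' = v.sum fun K a => a * ∑ σ : Fin (n + 1) → Fin 2,
      if (σ 0 = β ∧ σ (Fin.last n) = α) ∧ (fun j => next (σ j.castSucc) (σ j.succ) (K j)) = K' then
        ∏ j, coef j x
            (l - 2 * η * ∑ i ∈ Finset.Ioi j, wt i (next (σ i.castSucc) (σ i.succ) (K i)))
            (σ j.castSucc) (σ j.succ) (K j)
      else 0 := by
  rw [tensorL, Finsupp.linearCombination_apply, Finsupp.sum_apply]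
  refine Finsupp.sum_congr fun K _ => ?_
  rw [Finsupp.smul_apply, Finsupp.finsetSum_apply, smul_eq_mul]
  congr 1
  refine Finset.sum_congr rfl fun σ _ => ?_
  by_cases h : σ 0 = β ∧ σ (Fin.last n) = α
  · simp [h, Finsupp.single_apply]
  · simp [h]

theorem evalCoef_c_zero (τ η Λ y l : ℂ) : evalCoef τ η Λ y l 1 0 0 = 0 := by
  simp [evalCoef]

/-- The path `0, 1, …, 1`. -/
def raisePath (n : ℕ) : Fin (n + 2) → Fin 2 := Fin.cons 0 fun _ => 1

/-- The multi-index `(N, 0, …, 0)`. -/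
def firstIndex (n N : ℕ) : Fin (n + 1) → ℕ := Fin.cons N fun _ => 0

/-- The coefficient of `e_{N+1} ⊗ e_0 ⊗ ⋯ ⊗ e_0` in `b(x,λ) e_N ⊗ e_0 ⊗ ⋯ ⊗ e_0`. -/
def raiseCoef {n : ℕ} (τ η : ℂ) (z Λ : Fin (n + 1) → ℂ) (x l : ℂ) (N : ℕ) : ℂ :=
  ∏ j : Fin (n + 1), evalCoef τ η (Λ j) (x - z j)
    (l - 2 * η * ∑ i ∈ Finset.Ioi j, (Λ i - 2 * ((firstIndex n N i + (raisePath n i.succ : ℕ) -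
      (raisePath n i.castSucc : ℕ) : ℕ) : ℂ)))
    (raisePath n j.castSucc) (raisePath n j.succ) (firstIndex n N j)

/-- In a vector in the span of the `e_K` with `K_1 < N` or `K = (N, 0, …, 0)`. -/
def BoundedBy {n : ℕ} (N : ℕ) (v : (Fin (n + 1) → ℕ) →₀ ℂ) : Prop :=
  ∀ K, v K ≠ 0 → K 0 ≤ N ∧ (K 0 = N → K = firstIndex n N)

theorem eq_raisePath {n : ℕ} {τ η : ℂ} {z Λ : Fin (n + 1) → ℂ} {x : ℂ} {l : Fin (n + 1) → ℂ} {N : ℕ}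
    {σ : Fin (n + 2) → Fin 2} (h0 : σ 0 = 0) (h1 : σ 1 = 1)
    (hne : ∏ j, evalCoef τ η (Λ j) (x - z j) (l j) (σ j.castSucc) (σ j.succ)
      (firstIndex n N j) ≠ 0) :
    σ = raisePath n := by
  have hne' := Finset.prod_ne_zero_iff.1 hne
  have hs : ∀ k : ℕ, ∀ hk : k + 1 < n + 2, σ ⟨k + 1, hk⟩ = 1 := by
    intro k
    induction k with
    | zero => intro _; exact h1
    | succ k ih =>
      intro hk
      have hk' : k + 1 < n + 1 := by omega
      have h2 := hne' ⟨k + 1, hk'⟩ (Finset.mem_univ _)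
      have h3 : σ (Fin.castSucc ⟨k + 1, hk'⟩) = 1 := ih (by omega)
      have h4 : firstIndex n N ⟨k + 1, hk'⟩ = 0 := by
        rw [show (⟨k + 1, hk'⟩ : Fin (n + 1)) = Fin.succ ⟨k, by omega⟩ from rfl]
        rfl
      rw [h3, h4] at h2
      have h5 : σ (Fin.succ ⟨k + 1, hk'⟩) = 0 ∨ σ (Fin.succ ⟨k + 1, hk'⟩) = 1 := by
        generalize σ (Fin.succ ⟨k + 1, hk'⟩) = s
        fin_cases s <;> simp
      rcases h5 with h5 | h5
      · rw [h5, evalCoef_c_zero] at h2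
        exact absurd rfl h2
      · exact h5
  funext i
  refine Fin.cases ?_ (fun i => ?_) i
  · exact h0
  · exact hs i i.succ.2

theorem next_raisePath {n : ℕ} (N : ℕ) :
    (fun j => firstIndex n N j + (raisePath n j.succ : ℕ) - (raisePath n j.castSucc : ℕ)) =
      firstIndex n (N + 1) := by
  funext j
  refine Fin.cases ?_ (fun j => ?_) j
  · rfl
  · rw [← Fin.succ_castSucc]
    rfl

theorem vermaL_b_boundedBy {n : ℕ} {τ η : ℂ} {z Λ : Fin (n + 1) → ℂ} {x l : ℂ} {N : ℕ}
    {v : (Fin (n + 1) → ℕ) →₀ ℂ} (hv : BoundedBy N v) :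
    BoundedBy (N + 1) (vermaL τ η z Λ x l 0 1 v) ∧
      vermaL τ η z Λ x l 0 1 v (firstIndex n (N + 1)) =
        v (firstIndex n N) * raiseCoef τ η z Λ x l N := by
  have hfirst : ∀ (K : Fin (n + 1) → ℕ) (σ : Fin (n + 2) → Fin 2) (l : Fin (n + 1) → ℂ), v K ≠ 0 →
      σ 0 = 0 → K 0 + (σ 1 : ℕ) - (σ 0 : ℕ) = N + 1 →
      ∏ j, evalCoef τ η (Λ j) (x - z j) (l j) (σ j.castSucc) (σ j.succ) (K j) ≠ 0 →
      K = firstIndex n N ∧ σ = raisePath n := by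
    intro K σ l hK hσ hN hprod
    have h1 := (σ 1).2
    have h2 := (hv K hK).1
    rw [hσ] at hN
    simp only [Fin.val_zero, tsub_zero] at hN
    have hK0 : K 0 = N := by omega
    have hσ1 : σ 1 = 1 := Fin.ext (by simp; omega)
    have hKf := (hv K hK).2 hK0
    rw [hKf] at hprod
    exact ⟨hKf, eq_raisePath hσ hσ1 hprod⟩
  constructor
  · intro K' hK'
    rw [vermaL, tensorL_apply] at hK'
    obtain ⟨K, hK, hne⟩ := Finset.exists_ne_zero_of_sum_ne_zero hK'
    obtain ⟨σ, _, hσ⟩ := Finset.exists_ne_zero_of_sum_ne_zero (right_ne_zero_of_mul hne)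
    split_ifs at hσ with hc
    swap
    · exact absurd rfl hσ
    obtain ⟨⟨h0, _⟩, hnext⟩ := hc
    have hvK : v K ≠ 0 := by simpa using hK
    have hK'0 : K' 0 = K 0 + (σ 1 : ℕ) - (σ 0 : ℕ) := (congrFun hnext 0).symm
    refine ⟨?_, fun hN => ?_⟩
    · have h1 := (σ 1).2
      have h2 := (hv K hvK).1
      omega
    · obtain ⟨rfl, rfl⟩ := hfirst K σ _ hvK h0 (by omega) hσ
      rw [← hnext, next_raisePath]
  · rw [vermaL, tensorL_apply, Finsupp.sum, Finset.sum_eq_single (firstIndex n N),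
      Finset.sum_eq_single (raisePath n), if_pos, raiseCoef]
    · refine ⟨⟨rfl, ?_⟩, next_raisePath N⟩
      rw [← Fin.succ_last]
      rfl
    · intro σ _ hσ
      split_ifs with hc
      · obtain ⟨⟨h0, _⟩, hnext⟩ := hc
        by_contra hne
        have h2 := congrFun hnext 0
        have hσ1 : σ 1 = 1 := by
          have h1 := (σ 1).2
          change firstIndex n N 0 + (σ 1 : ℕ) - (σ 0 : ℕ) = N + 1 at h2
          rw [h0, show firstIndex n N 0 = N from rfl] at h2
          simp only [Fin.val_zero, tsub_zero] at h2
          exact Fin.ext (by simp; omega)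
        exact hσ (eq_raisePath h0 hσ1 hne)
      · rfl
    · simp
    · intro K hK hKne
      refine mul_eq_zero_of_right _ (Finset.sum_eq_zero fun σ _ => ?_)
      split_ifs with hc
      · obtain ⟨⟨h0, _⟩, hnext⟩ := hc
        by_contra hne
        exact hKne (hfirst K σ _ (by simpa using hK) h0 (congrFun hnext 0) hne).1
      · rfl
    · intro hK
      rw [Finsupp.notMem_support_iff.1 hK, zero_mul]

theorem countable_raiseCoef_zeros {n : ℕ} {τ η : ℂ} (hτ : 0 < τ.im) {z Λ : Fin (n + 1) → ℂ}
    {x : ℂ} (hη : theta τ (2 * η) ≠ 0) (hq : ∀ k, theta τ (x - qPar η z Λ k) ≠ 0)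
    (hp : ∀ k, theta τ (x - pPar η z Λ k) ≠ 0) (N : ℕ) :
    {l | raiseCoef τ η z Λ x l N = 0}.Countable := by
  have hz : ∀ a : ℂ, {l | theta τ (l + a) = 0}.Countable := fun a =>
    countable_theta_comp_zeros hτ (add_left_injective a)
  set s : Fin (n + 1) → ℂ := fun j => 2 * η * ∑ i ∈ Finset.Ioi j, (Λ i - 2 * ((firstIndex n N i +
    (raisePath n i.succ : ℕ) - (raisePath n i.castSucc : ℕ) : ℕ) : ℂ)) with hs
  refine ((Set.countable_iUnion fun j : Fin (n + 1) => hz (-s j)).union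
    ((hz (-s 0 + (x - z 0) - (Λ 0 - 1 - 2 * N) * η)).union
    (Set.countable_iUnion fun j : Fin (n + 1) => hz (-s j - 2 * Λ j * η)))).mono fun l hl => ?_
  by_contra hcon
  simp only [Set.mem_union, Set.mem_iUnion, Set.mem_ofPred_eq, not_or, not_exists] at hcon
  obtain ⟨h1, h2, h3⟩ := hcon
  refine Finset.prod_ne_zero_iff.2 (fun j _ => ?_) hl
  have hq' : theta τ (x - z j - (Λ j + 1) * η) ≠ 0 := by
    convert hq j using 2
    rw [qPar]
    ring
  have hp' : theta τ (x - z j - (1 - Λ j) * η) ≠ 0 := by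
    convert hp j using 2
    rw [pPar]
    ring
  have h1j : theta τ (l - s j) ≠ 0 := by simpa [sub_eq_add_neg] using h1 j
  revert hq' hp' h1j
  refine Fin.cases ?_ (fun j => ?_) j
  · intro hq' _ h1j
    change evalCoef τ η (Λ 0) (x - z 0) (l - s 0) 0 1 N ≠ 0
    simp only [evalCoef]
    norm_num
    refine ⟨⟨?_, hη⟩, hq', h1j⟩
    convert h2 using 2
    ring_nf
  · intro hq' hp' h1j
    have : raisePath n j.succ.castSucc = 1 := by rw [← Fin.succ_castSucc]; rfl
    change evalCoef τ η (Λ j.succ) (x - z j.succ) (l - s j.succ)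
      (raisePath n j.succ.castSucc) 1 0 ≠ 0
    rw [this]
    simp only [evalCoef]
    norm_num
    refine ⟨⟨hp', ?_⟩, hq', h1j⟩
    convert h3 j.succ using 2
    ring_nf

theorem countable_gFn_zeros {τ : ℂ} (hτ : 0 < τ.im) (η c : ℂ) (m : ℕ) :
    {l | gFn τ η c m l = 0}.Countable := by
  refine (Set.countable_iUnion fun j : ℕ => countable_theta_comp_zeros hτ
    (sub_left_injective (b := 2 * η * (j : ℂ)))).mono fun l hl => ?_
  have := (mul_eq_zero.1 hl).resolve_left (Complex.exp_ne_zero _)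
  obtain ⟨j, _, hj⟩ := Finset.prod_eq_zero_iff.1 this
  exact Set.mem_iUnion.2 ⟨j, hj⟩

theorem vermaL_betheVector {n : ℕ} {τ η : ℂ} (hτ : 0 < τ.im) {z Λ : Fin (n + 1) → ℂ}
    (hη : theta τ (2 * η) ≠ 0) (c : ℂ) (m : ℕ) (ts : List ℂ)
    (hq : ∀ t ∈ ts, ∀ k, theta τ (t - qPar η z Λ k) ≠ 0)
    (hp : ∀ t ∈ ts, ∀ k, theta τ (t - pPar η z Λ k) ≠ 0) :
    (∀ l, BoundedBy ts.length (betheVector η (fun x l => vermaL τ η z Λ x l 0 1)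
      (fun l => gFn τ η c m l • Finsupp.single 0 1) ts l)) ∧
    {l | betheVector η (fun x l => vermaL τ η z Λ x l 0 1)
      (fun l => gFn τ η c m l • Finsupp.single 0 1) ts l (firstIndex n ts.length) =
        0}.Countable := by
  have hf0 : firstIndex n 0 = 0 := by
    funext j
    refine Fin.cases rfl (fun j => rfl) j
  induction ts with
  | nil =>
    refine ⟨fun l K hK => ?_, ?_⟩
    · have : K = 0 := by
        by_contra h
        exact hK (by simp [betheVector, Ne.symm h])
      subst this
      exact ⟨le_rfl, fun _ => hf0.symm⟩
    · refine (countable_gFn_zeros hτ η c m).mono fun l hl => ?_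
      simpa [betheVector, hf0] using hl
  | cons t ts ih =>
    obtain ⟨ih1, ih2⟩ := ih (fun t ht => hq t (List.mem_cons_of_mem _ ht))
      (fun t ht => hp t (List.mem_cons_of_mem _ ht))
    refine ⟨fun l => (vermaL_b_boundedBy (ih1 (l + 2 * η))).1, ?_⟩
    refine ((ih2.preimage_of_injOn (f := fun l => l + 2 * η)
      (add_left_injective _).injOn).union (countable_raiseCoef_zeros hτ hη
        (hq t (by simp)) (hp t (by simp)) ts.length)).mono fun l hl => ?_
    rw [Set.mem_ofPred_eq, betheVector, List.length_cons,
      (vermaL_b_boundedBy (ih1 (l + 2 * η))).2, mul_eq_zero] at hl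
    exact hl

theorem vermaBethe_ne_zero {n m : ℕ} {τ η : ℂ} (hτ : 0 < τ.im) {z Λ : Fin n → ℂ}
    (hΛ : ∑ j, Λ j = 2 * (m : ℂ)) {c : ℂ} {t : Fin m → ℂ}
    (hbae : BetheEquations τ η z Λ c t) (hη : theta τ (2 * η) ≠ 0) :
    ¬ (vermaBethe τ η z Λ c t =ᶠ[codiscrete ℂ] 0) := by
  intro h0
  suffices h : ∃ K, {l | vermaBethe τ η z Λ c t l K = 0}.Countable by
    obtain ⟨K, hK⟩ := h
    refine not_countable_complex ((hK.union (countable_compl_of_mem_codiscrete h0)).mono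
      fun l _ => ?_)
    by_cases hl : vermaBethe τ η z Λ c t l = 0
    · exact Or.inl (by rw [Set.mem_ofPred_eq, hl]; rfl)
    · exact Or.inr hl
  cases n with
  | zero =>
    have hm : m = 0 := by
      simpa using hΛ.symm
    subst hm
    refine ⟨0, (countable_gFn_zeros hτ η c 0).mono fun l hl => ?_⟩
    simpa [vermaBethe, betheVector] using hl
  | succ n =>
    refine ⟨_, (vermaL_betheVector hτ hη c m (List.ofFn t) ?_ ?_).2⟩
    · intro x hx
      obtain ⟨i, rfl⟩ := (List.mem_ofFn' _ _).1 hx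
      exact (bethe_theta_ne hbae i).2.1
    · intro x hx
      obtain ⟨i, rfl⟩ := (List.mem_ofFn' _ _).1 hx
      exact (bethe_theta_ne hbae i).2.2

/-! ### The dynamical Yang-Baxter equation

The lemmas `theta_exchange_a`, …, `theta_exchange_h` are the instances of the three-term relation
that the Yang-Baxter equation reduces to. -/

theorem theta_exchange_a {τ : ℂ} (hτ : 0 < τ.im) (x u l g : ℂ) :
    theta τ (x + u) * theta τ (x + l - g) * theta τ l * theta τ (u - g) -
      theta τ x * theta τ (x + u + l - g) * theta τ (u - l) * theta τ g -
      theta τ (x + l) * theta τ (l - g) * theta τ u * theta τ (x + u - g) = 0 := by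
  have h := theta_three_term hτ (x + u / 2 + l / 2 - g / 2) (-u / 2 - l / 2 + g / 2)
    (u / 2 - l / 2 + g / 2) (-u / 2 + l / 2 + g / 2)
  rw [show (x + u / 2 + l / 2 - g / 2) + (u / 2 - l / 2 + g / 2) = x + u by ring,
    show (x + u / 2 + l / 2 - g / 2) - (u / 2 - l / 2 + g / 2) = x + l - g by ring,
    show (-u / 2 - l / 2 + g / 2) + (-u / 2 + l / 2 + g / 2) = -(u - g) by ring,
    show (-u / 2 - l / 2 + g / 2) - (-u / 2 + l / 2 + g / 2) = -(l) by ring,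
    show (x + u / 2 + l / 2 - g / 2) + (-u / 2 - l / 2 + g / 2) = x by ring,
    show (x + u / 2 + l / 2 - g / 2) - (-u / 2 - l / 2 + g / 2) = x + u + l - g by ring,
    show (u / 2 - l / 2 + g / 2) + (-u / 2 + l / 2 + g / 2) = g by ring,
    show (u / 2 - l / 2 + g / 2) - (-u / 2 + l / 2 + g / 2) = u - l by ring,
    show (x + u / 2 + l / 2 - g / 2) + (-u / 2 + l / 2 + g / 2) = x + l by ring,
    show (x + u / 2 + l / 2 - g / 2) - (-u / 2 + l / 2 + g / 2) = x + u - g by ring,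
    show (-u / 2 - l / 2 + g / 2) + (u / 2 - l / 2 + g / 2) = -(l - g) by ring,
    show (-u / 2 - l / 2 + g / 2) - (u / 2 - l / 2 + g / 2) = -(u) by ring] at h
  simp only [theta_neg] at h
  linear_combination h

theorem theta_exchange_b {τ : ℂ} (hτ : 0 < τ.im) (x u l g : ℂ) :
    theta τ (x + u + l) * theta τ l * theta τ (x - g) * theta τ (u - g) -
      theta τ x * theta τ (x + u + l - g) * theta τ (l + g) * theta τ u +
      theta τ (x + l) * theta τ (u + l) * theta τ g * theta τ (x + u - g) = 0 := by
  have h := theta_three_term hτ (x / 2 + u / 2 + l) (x / 2 + u / 2 - g)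
    (x / 2 + u / 2) (x / 2 - u / 2)
  rw [show (x / 2 + u / 2 + l) + (x / 2 + u / 2) = x + u + l by ring,
    show (x / 2 + u / 2 + l) - (x / 2 + u / 2) = l by ring,
    show (x / 2 + u / 2 - g) + (x / 2 - u / 2) = x - g by ring,
    show (x / 2 + u / 2 - g) - (x / 2 - u / 2) = u - g by ring,
    show (x / 2 + u / 2 + l) + (x / 2 + u / 2 - g) = x + u + l - g by ring,
    show (x / 2 + u / 2 + l) - (x / 2 + u / 2 - g) = l + g by ring,
    show (x / 2 + u / 2) + (x / 2 - u / 2) = x by ring,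
    show (x / 2 + u / 2) - (x / 2 - u / 2) = u by ring,
    show (x / 2 + u / 2 + l) + (x / 2 - u / 2) = x + l by ring,
    show (x / 2 + u / 2 + l) - (x / 2 - u / 2) = u + l by ring,
    show (x / 2 + u / 2 - g) + (x / 2 + u / 2) = x + u - g by ring,
    show (x / 2 + u / 2 - g) - (x / 2 + u / 2) = -(g) by ring] at h
  simp only [theta_neg] at h
  linear_combination h

theorem theta_exchange_c {τ : ℂ} (hτ : 0 < τ.im) (x u l g : ℂ) :
    theta τ u * theta τ (x - l + g) * theta τ l * theta τ (x + u - g) -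
      theta τ (u + l - g) * theta τ (x + u - l) * theta τ g * theta τ x -
      theta τ (x - l) * theta τ (x + u) * theta τ (l - g) * theta τ (u - g) = 0 := by
  have h := theta_three_term hτ (x / 2 + u / 2 - l / 2 + g / 2) (x / 2 + u / 2 - l / 2 - g / 2)
    (-x / 2 + u / 2 + l / 2 - g / 2) (x / 2 + u / 2 + l / 2 - g / 2)
  rw [show (x / 2 + u / 2 - l / 2 + g / 2) + (-x / 2 + u / 2 + l / 2 - g / 2) = u by ring,
    show (x / 2 + u / 2 - l / 2 + g / 2) - (-x / 2 + u / 2 + l / 2 - g / 2) = x - l + g by ring,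
    show (x / 2 + u / 2 - l / 2 - g / 2) + (x / 2 + u / 2 + l / 2 - g / 2) = x + u - g by ring,
    show (x / 2 + u / 2 - l / 2 - g / 2) - (x / 2 + u / 2 + l / 2 - g / 2) = -(l) by ring,
    show (x / 2 + u / 2 - l / 2 + g / 2) + (x / 2 + u / 2 - l / 2 - g / 2) = x + u - l by ring,
    show (x / 2 + u / 2 - l / 2 + g / 2) - (x / 2 + u / 2 - l / 2 - g / 2) = g by ring,
    show (-x / 2 + u / 2 + l / 2 - g / 2) + (x / 2 + u / 2 + l / 2 - g / 2) = u + l - g by ring,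
    show (-x / 2 + u / 2 + l / 2 - g / 2) - (x / 2 + u / 2 + l / 2 - g / 2) = -(x) by ring,
    show (x / 2 + u / 2 - l / 2 + g / 2) + (x / 2 + u / 2 + l / 2 - g / 2) = x + u by ring,
    show (x / 2 + u / 2 - l / 2 + g / 2) - (x / 2 + u / 2 + l / 2 - g / 2) = -(l - g) by ring,
    show (x / 2 + u / 2 - l / 2 - g / 2) + (-x / 2 + u / 2 + l / 2 - g / 2) = u - g by ring,
    show (x / 2 + u / 2 - l / 2 - g / 2) - (-x / 2 + u / 2 + l / 2 - g / 2) = x - l by ring] at h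
  simp only [theta_neg] at h
  linear_combination -h

theorem theta_exchange_d {τ : ℂ} (hτ : 0 < τ.im) (x u l g : ℂ) :
    theta τ (u + l - g) * theta τ (x + u) * theta τ l * theta τ (x - g) -
      theta τ x * theta τ (u + l) * theta τ (l - g) * theta τ (x + u - g) -
      theta τ (x - l) * theta τ (x + u + l - g) * theta τ g * theta τ u = 0 := by
  have h := theta_three_term hτ (x / 2 + u + l / 2 - g / 2) (-x / 2 + l / 2 + g / 2)
    (-x / 2 + l / 2 - g / 2) (x / 2 + l / 2 - g / 2)
  rw [show (x / 2 + u + l / 2 - g / 2) + (-x / 2 + l / 2 - g / 2) = u + l - g by ring,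
    show (x / 2 + u + l / 2 - g / 2) - (-x / 2 + l / 2 - g / 2) = x + u by ring,
    show (-x / 2 + l / 2 + g / 2) + (x / 2 + l / 2 - g / 2) = l by ring,
    show (-x / 2 + l / 2 + g / 2) - (x / 2 + l / 2 - g / 2) = -(x - g) by ring,
    show (x / 2 + u + l / 2 - g / 2) + (-x / 2 + l / 2 + g / 2) = u + l by ring,
    show (x / 2 + u + l / 2 - g / 2) - (-x / 2 + l / 2 + g / 2) = x + u - g by ring,
    show (-x / 2 + l / 2 - g / 2) + (x / 2 + l / 2 - g / 2) = l - g by ring,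
    show (-x / 2 + l / 2 - g / 2) - (x / 2 + l / 2 - g / 2) = -(x) by ring,
    show (x / 2 + u + l / 2 - g / 2) + (x / 2 + l / 2 - g / 2) = x + u + l - g by ring,
    show (x / 2 + u + l / 2 - g / 2) - (x / 2 + l / 2 - g / 2) = u by ring,
    show (-x / 2 + l / 2 + g / 2) + (-x / 2 + l / 2 - g / 2) = -(x - l) by ring,
    show (-x / 2 + l / 2 + g / 2) - (-x / 2 + l / 2 - g / 2) = g by ring] at h
  simp only [theta_neg] at h
  linear_combination -h

theorem theta_exchange_e {τ : ℂ} (hτ : 0 < τ.im) (x u l g : ℂ) :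
    theta τ u * theta τ (x + u - l) * theta τ (l - 2 * g) * theta τ x +
      theta τ (u - l + g) * theta τ (x - l + g) * theta τ g * theta τ (x + u - g) -
      theta τ (x + u - l + g) * theta τ (l - g) * theta τ (u - g) * theta τ (x - g) = 0 := by
  have h := theta_three_term hτ (x / 2 + u - l / 2) (-x / 2 - l / 2 + g)
    (-x / 2 + l / 2) (x / 2 - l / 2 + g)
  rw [show (x / 2 + u - l / 2) + (-x / 2 + l / 2) = u by ring,
    show (x / 2 + u - l / 2) - (-x / 2 + l / 2) = x + u - l by ring,
    show (-x / 2 - l / 2 + g) + (x / 2 - l / 2 + g) = -(l - 2 * g) by ring,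
    show (-x / 2 - l / 2 + g) - (x / 2 - l / 2 + g) = -(x) by ring,
    show (x / 2 + u - l / 2) + (-x / 2 - l / 2 + g) = u - l + g by ring,
    show (x / 2 + u - l / 2) - (-x / 2 - l / 2 + g) = x + u - g by ring,
    show (-x / 2 + l / 2) + (x / 2 - l / 2 + g) = g by ring,
    show (-x / 2 + l / 2) - (x / 2 - l / 2 + g) = -(x - l + g) by ring,
    show (x / 2 + u - l / 2) + (x / 2 - l / 2 + g) = x + u - l + g by ring,
    show (x / 2 + u - l / 2) - (x / 2 - l / 2 + g) = u - g by ring,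
    show (-x / 2 - l / 2 + g) + (-x / 2 + l / 2) = -(x - g) by ring,
    show (-x / 2 - l / 2 + g) - (-x / 2 + l / 2) = -(l - g) by ring] at h
  simp only [theta_neg] at h
  linear_combination h

theorem theta_exchange_f {τ : ℂ} (hτ : 0 < τ.im) (x u l g : ℂ) :
    theta τ u * theta τ (x + u - l) * theta τ g * theta τ (x + l - g) -
      theta τ (u - l + g) * theta τ l * theta τ x * theta τ (x + u - g) +
      theta τ (l - g) * theta τ (x + u) * theta τ (u - l) * theta τ (x - g) = 0 := by
  have h := theta_three_term hτ (x / 2 + u - l / 2) (-x / 2 - l / 2 + g)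
    (-x / 2 + l / 2) (x / 2 + l / 2)
  rw [show (x / 2 + u - l / 2) + (-x / 2 + l / 2) = u by ring,
    show (x / 2 + u - l / 2) - (-x / 2 + l / 2) = x + u - l by ring,
    show (-x / 2 - l / 2 + g) + (x / 2 + l / 2) = g by ring,
    show (-x / 2 - l / 2 + g) - (x / 2 + l / 2) = -(x + l - g) by ring,
    show (x / 2 + u - l / 2) + (-x / 2 - l / 2 + g) = u - l + g by ring,
    show (x / 2 + u - l / 2) - (-x / 2 - l / 2 + g) = x + u - g by ring,
    show (-x / 2 + l / 2) + (x / 2 + l / 2) = l by ring,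
    show (-x / 2 + l / 2) - (x / 2 + l / 2) = -(x) by ring,
    show (x / 2 + u - l / 2) + (x / 2 + l / 2) = x + u by ring,
    show (x / 2 + u - l / 2) - (x / 2 + l / 2) = u - l by ring,
    show (-x / 2 - l / 2 + g) + (-x / 2 + l / 2) = -(x - g) by ring,
    show (-x / 2 - l / 2 + g) - (-x / 2 + l / 2) = -(l - g) by ring] at h
  simp only [theta_neg] at h
  linear_combination -h

theorem theta_exchange_g {τ : ℂ} (hτ : 0 < τ.im) (l g : ℂ) :
    theta τ (l - 2 * g) * theta τ l * theta τ l * theta τ l -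
      theta τ (l + g) * theta τ (l - g) * theta τ (l - g) * theta τ (l - g) +
      theta τ (2 * l - g) * theta τ g * theta τ g * theta τ g = 0 := by
  have h := theta_three_term hτ (l - g) (0) (-g) l
  rw [show (l - g) + (-g) = l - 2 * g by ring,
    show (l - g) - (-g) = l by ring,
    show (0) + l = l by ring,
    show (0) - l = -(l) by ring,
    show (l - g) + (0) = l - g by ring,
    show (l - g) - (0) = l - g by ring,
    show (-g) + l = l - g by ring,
    show (-g) - l = -(l + g) by ring,
    show (l - g) + l = 2 * l - g by ring,
    show (l - g) - l = -(g) by ring,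
    show (0) + (-g) = -(g) by ring,
    show (0) - (-g) = g by ring] at h
  simp only [theta_neg] at h
  linear_combination -h

theorem theta_exchange_h {τ : ℂ} (hτ : 0 < τ.im) (x u l g : ℂ) :
    theta τ u * theta τ x * theta τ (x + u - g) * theta τ (2 * l - g) -
      theta τ l * theta τ (u + l - g) * theta τ (x + u - l) * theta τ (x + l - g) -
      theta τ (l - g) * theta τ (x - l) * theta τ (x + u + l - g) * theta τ (u - l) = 0 := by
  have h := theta_three_term hτ (x / 2 + u / 2) (-x / 2 - u / 2 + l)
    (-x / 2 + u / 2) (-x / 2 - u / 2 - l + g)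
  rw [show (x / 2 + u / 2) + (-x / 2 + u / 2) = u by ring,
    show (x / 2 + u / 2) - (-x / 2 + u / 2) = x by ring,
    show (-x / 2 - u / 2 + l) + (-x / 2 - u / 2 - l + g) = -(x + u - g) by ring,
    show (-x / 2 - u / 2 + l) - (-x / 2 - u / 2 - l + g) = 2 * l - g by ring,
    show (x / 2 + u / 2) + (-x / 2 - u / 2 + l) = l by ring,
    show (x / 2 + u / 2) - (-x / 2 - u / 2 + l) = x + u - l by ring,
    show (-x / 2 + u / 2) + (-x / 2 - u / 2 - l + g) = -(x + l - g) by ring,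
    show (-x / 2 + u / 2) - (-x / 2 - u / 2 - l + g) = u + l - g by ring,
    show (x / 2 + u / 2) + (-x / 2 - u / 2 - l + g) = -(l - g) by ring,
    show (x / 2 + u / 2) - (-x / 2 - u / 2 - l + g) = x + u + l - g by ring,
    show (-x / 2 - u / 2 + l) + (-x / 2 + u / 2) = -(x - l) by ring,
    show (-x / 2 - u / 2 + l) - (-x / 2 + u / 2) = -(u - l) by ring] at h
  simp only [theta_neg] at h
  linear_combination -h

theorem alphaFn_neg (τ η x l : ℂ) : alphaFn τ η x (-l) =
    theta τ (l - 2 * η) * theta τ x / (theta τ l * theta τ (x - 2 * η)) := by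
  rw [alphaFn, show -l + 2 * η = -(l - 2 * η) by ring, theta_neg, theta_neg, neg_mul, neg_mul,
    neg_div_neg_eq]

theorem betaFn_neg (τ η x l : ℂ) : betaFn τ η x (-l) =
    theta τ (x - l) * theta τ (2 * η) / (theta τ l * theta τ (x - 2 * η)) := by
  rw [betaFn, show -l + x = x - l by ring, theta_neg, neg_mul, neg_div_neg_eq]

/-- The matrix elements of the dynamical Yang-Baxter equation on the subspace of weight one. -/
theorem dybe_weight_one {τ η : ℂ} (hτ : 0 < τ.im) {x y u l n L N : ℂ} (hy : y = x + u)
    (hn : n = -l) (hL : L = l - 2 * η) (hN : N = -L) (hl : theta τ l ≠ 0) (hL0 : theta τ L ≠ 0)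
    (hx : theta τ (x - 2 * η) ≠ 0) (hy0 : theta τ (y - 2 * η) ≠ 0)
    (hu : theta τ (u - 2 * η) ≠ 0) :
    (alphaFn τ η y n * alphaFn τ η x N = alphaFn τ η x n * alphaFn τ η y N) ∧
    (alphaFn τ η y n * betaFn τ η x L = alphaFn τ η x n * betaFn τ η y L * betaFn τ η u n +
      betaFn τ η x l * alphaFn τ η u n) ∧
    (betaFn τ η y l = alphaFn τ η x n * betaFn τ η y L * alphaFn τ η u l +
      betaFn τ η x l * betaFn τ η u l) ∧
    (alphaFn τ η u N * betaFn τ η x N + betaFn τ η u L * betaFn τ η y n * alphaFn τ η x N =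
      betaFn τ η x n * alphaFn τ η y N) ∧
    (alphaFn τ η u N * alphaFn τ η x L + betaFn τ η u L * betaFn τ η y n * betaFn τ η x L =
      alphaFn τ η x l * alphaFn τ η u n + betaFn τ η x n * betaFn τ η y L * betaFn τ η u n) ∧
    (betaFn τ η u L * alphaFn τ η y l = alphaFn τ η x l * betaFn τ η u l +
      betaFn τ η x n * betaFn τ η y L * alphaFn τ η u l) ∧
    (alphaFn τ η u L * betaFn τ η y n * alphaFn τ η x N + betaFn τ η u N * betaFn τ η x N =
      betaFn τ η y N) ∧
    (alphaFn τ η u L * betaFn τ η y n * betaFn τ η x L + betaFn τ η u N * alphaFn τ η x L =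
      alphaFn τ η y L * betaFn τ η u n) ∧
    (alphaFn τ η u L * alphaFn τ η y l = alphaFn τ η y L * alphaFn τ η u l) := by
  subst hN hn hy hL
  simp only [alphaFn_neg, betaFn_neg]
  simp only [alphaFn, betaFn]
  generalize 2 * η = g at *
  have ha := theta_exchange_a hτ x u l g
  have hb := theta_exchange_b hτ x u l g
  have hc := theta_exchange_c hτ x u l g
  have hd := theta_exchange_d hτ x u l g
  have he := theta_exchange_e hτ x u l g
  have hf := theta_exchange_f hτ x u l g
  have hg := theta_exchange_g hτ l g
  have hh := theta_exchange_h hτ x u l g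
  rw [show l - g - g = l - 2 * g by ring, show l - g + g = l by ring,
    show x - (l - g) = x - l + g by ring, show u - (l - g) = u - l + g by ring,
    show x + u - (l - g) = x + u - l + g by ring, show l - g + x = x + l - g by ring,
    show l - g + u = u + l - g by ring, show l - g + (x + u) = x + u + l - g by ring,
    show l + x = x + l by ring, show l + u = u + l by ring, show l + (x + u) = x + u + l by ring]
  generalize theta τ (x + u) = y₀ at *
  generalize theta τ (x + u - g) = y₁ at *
  generalize theta τ (x + u + l) = y₂ at *
  generalize theta τ (x + u + l - g) = y₃ at *
  generalize theta τ (x + u - l) = y₄ at *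
  generalize theta τ (x + u - l + g) = y₅ at *
  generalize theta τ (x + l) = x₂ at *
  generalize theta τ (x + l - g) = x₃ at *
  generalize theta τ (x - l) = x₄ at *
  generalize theta τ (x - l + g) = x₅ at *
  generalize theta τ (x - g) = x₁ at *
  generalize theta τ x = x₀ at *
  generalize theta τ (u + l) = u₂ at *
  generalize theta τ (u + l - g) = u₃ at *
  generalize theta τ (u - l) = u₄ at *
  generalize theta τ (u - l + g) = u₅ at *
  generalize theta τ (u - g) = u₁ at *
  generalize theta τ u = u₀ at *
  generalize theta τ (2 * l - g) = l₃ at *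
  generalize theta τ (l - 2 * g) = l₂ at *
  generalize theta τ (l - g) = l₁ at *
  generalize theta τ (l + g) = l₄ at *
  generalize theta τ l = l₀ at *
  generalize theta τ g = g₀ at *
  refine ⟨?_, ?_, ?_, ?_, ?_, ?_, ?_, ?_, ?_⟩
  · field_simp
  · field_simp
    linear_combination -g₀ * ha
  · field_simp
    linear_combination -g₀ * hb
  · field_simp
    linear_combination l₂ * g₀ * hc
  · field_simp
    linear_combination u₀ * x₀ * y₁ * hg - g₀ ^ 3 * hh
  · field_simp
    linear_combination -l₄ * g₀ * hd
  · field_simp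
    linear_combination g₀ * he
  · field_simp
    linear_combination -g₀ * hf
  · field_simp

/-- The dynamical Yang-Baxter equation. -/
theorem dybe {τ η : ℂ} (hτ : 0 < τ.im) {z w l : ℂ} (hl : theta τ l ≠ 0)
    (hl1 : theta τ (l - 2 * η) ≠ 0) (hl2 : theta τ (l + 2 * η) ≠ 0)
    (hx : theta τ (z - w - 2 * η) ≠ 0) (hz : theta τ (z - 2 * η) ≠ 0)
    (hw : theta τ (w - 2 * η) ≠ 0) (k'' k γ δ α β : Fin 2) :
    ∑ α' : Fin 2, ∑ β' : Fin 2, ∑ k' : Fin 2,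
      rMat τ η (z - w) (l - 2 * η * sgn k'') γ δ α' β' *
        (rMat τ η z l α' k'' α k' * rMat τ η w (l - 2 * η * sgn α) β' k' β k) =
    ∑ α' : Fin 2, ∑ β' : Fin 2, ∑ k' : Fin 2,
      rMat τ η w l δ k'' β' k' * rMat τ η z (l - 2 * η * sgn β') γ k' α' k *
        rMat τ η (z - w) l α' β' α β := by
  have h1 := dybe_weight_one (η := η) (x := z - w) (y := z) (u := w) hτ (by ring) rfl rfl rfl hl hl1
    hx hz hw
  have h2 := dybe_weight_one (η := η) (x := z - w) (y := z) (u := w) (l := -l) (n := l)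
    (L := -(l + 2 * η)) (N := l + 2 * η) hτ (by ring) (by ring) (by ring) (by ring)
    (by rw [theta_neg]; exact neg_ne_zero.2 hl) (by rw [theta_neg]; exact neg_ne_zero.2 hl2)
    hx hz hw
  obtain ⟨a1, a2, a3, a4, a5, a6, a7, a8, a9⟩ := h1
  obtain ⟨b1, b2, b3, b4, b5, b6, b7, b8, b9⟩ := h2
  have e : l - 2 * η * (-1) = l + 2 * η := by ring
  fin_cases k'' <;> fin_cases k <;> fin_cases γ <;> fin_cases δ <;> fin_cases α <;> fin_cases β <;>
    simp only [Fin.sum_univ_two, rMat, Fin.zero_eta, Fin.mk_one, sgn_zero, sgn_one, Int.cast_neg,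
      Int.cast_one, mul_one, e, Fin.isValue, and_true, true_and, and_false, false_and, if_true,
      if_false, one_ne_zero, zero_ne_one, mul_zero, zero_mul, add_zero, zero_add, one_mul,
          and_self] <;>
    first
      | done
      | linear_combination a1
      | linear_combination a2
      | linear_combination a3
      | linear_combination a4
      | linear_combination a5
      | linear_combination a6
      | linear_combination a7
      | linear_combination a8
      | linear_combination a9
      | linear_combination b1
      | linear_combination b2
      | linear_combination b3
      | linear_combination b4
      | linear_combination b5
      | linear_combination b6
      | linear_combination b7
      | linear_combination b8
      | linear_combination b9

/-- The matrix elements of the `L`-operator of `V(z_1) ⊗ ⋯ ⊗ V(z_n)`. -/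
def fundEntry {n : ℕ} (τ η : ℂ) (z : Fin n → ℂ) (x l : ℂ) (β α : Fin 2)
    (K' K : Fin n → Fin 2) : ℂ :=
  ∑ σ : Fin (n + 1) → Fin 2, if σ 0 = β ∧ σ (Fin.last n) = α then
    ∏ j, rMat τ η (x - z j) (l - 2 * η * ∑ i ∈ Finset.Ioi j, (sgn (K' i) : ℂ))
      (σ j.castSucc) (K' j) (σ j.succ) (K j) else 0

theorem fundEntry_zero (τ η : ℂ) (z : Fin 0 → ℂ) (x l : ℂ) (β α : Fin 2) (K' K : Fin 0 → Fin 2) :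
    fundEntry τ η z x l β α K' K = if β = α then 1 else 0 := by
  rw [fundEntry, (Equiv.funUnique (Fin 1) (Fin 2)).symm.sum_comp
    (fun σ : Fin 1 → Fin 2 => if σ 0 = β ∧ σ (Fin.last 0) = α then
    ∏ j : Fin 0, rMat τ η (x - z j) (l - 2 * η * ∑ i ∈ Finset.Ioi j, (sgn (K' i) : ℂ))
      (σ j.castSucc) (K' j) (σ j.succ) (K j) else 0) |>.symm]
  simp [ite_and]

theorem sum_cons {n : ℕ} (f : (Fin (n + 1) → Fin 2) → ℂ) :
    ∑ K, f K = ∑ k : Fin 2, ∑ K : Fin n → Fin 2, f (Fin.cons k K) := by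
  rw [← (Fin.consEquiv fun _ : Fin (n + 1) => Fin 2).sum_comp, Fintype.sum_prod_type]
  rfl

theorem fundEntry_succ {n : ℕ} (τ η : ℂ) (z : Fin (n + 1) → ℂ) (x l : ℂ) (β α : Fin 2)
    (K' K : Fin (n + 1) → Fin 2) :
    fundEntry τ η z x l β α K' K = ∑ γ : Fin 2,
      rMat τ η (x - z 0) (l - 2 * η * ∑ i : Fin n, (sgn (K' i.succ) : ℂ)) β (K' 0) γ (K 0) *
        fundEntry τ η (Fin.tail z) x l γ α (Fin.tail K') (Fin.tail K) := by
  simp only [fundEntry, Finset.mul_sum]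
  rw [sum_cons, Finset.sum_comm, Finset.sum_comm (γ := Fin 2)]
  refine Finset.sum_congr rfl fun σ _ => ?_
  simp only [Fin.cons_zero, ← Fin.succ_last, Fin.cons_succ, ite_and, Finset.sum_ite_eq', mul_ite,
    mul_zero, Finset.mem_univ, if_true, Fin.prod_univ_succ, Finset.sum_ite_eq, Fin.castSucc_zero,
    ← Fin.succ_castSucc, Fin.sum_Ioi_zero, Fin.sum_Ioi_succ, Fin.tail]

theorem rMat_conservation {τ η x l : ℂ} {γ δ α β : Fin 2} (h : rMat τ η x l γ δ α β ≠ 0) :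
    sgn γ + sgn δ = sgn α + sgn β := by
  revert h
  fin_cases γ <;> fin_cases δ <;> fin_cases α <;> fin_cases β <;> simp [rMat]

theorem rMat_eq_next {τ η x l : ℂ} {γ δ α β : Fin 2} (h : rMat τ η x l γ δ α β ≠ 0) :
    δ = if γ = α then β else α := by
  revert h
  fin_cases γ <;> fin_cases δ <;> fin_cases α <;> fin_cases β <;> simp [rMat]

theorem fundEntry_conservation {n : ℕ} {τ η : ℂ} {z : Fin n → ℂ} {x l : ℂ} {β α : Fin 2}
    {K' K : Fin n → Fin 2} (h : fundEntry τ η z x l β α K' K ≠ 0) :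
    sgn β + ∑ i, sgn (K' i) = sgn α + ∑ i, sgn (K i) := by
  induction n generalizing β with
  | zero =>
    rw [fundEntry_zero] at h
    simp_all
  | succ n ih =>
    rw [fundEntry_succ] at h
    obtain ⟨γ, _, hγ⟩ := Finset.exists_ne_zero_of_sum_ne_zero h
    have h1 := ih (right_ne_zero_of_mul hγ)
    have h2 := rMat_conservation (left_ne_zero_of_mul hγ)
    simp only [Fin.tail] at h1
    rw [Fin.sum_univ_succ, Fin.sum_univ_succ]
    linarith

theorem fundL_apply {n : ℕ} (τ η : ℂ) (z : Fin n → ℂ) (x l : ℂ) (β α : Fin 2)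
    (v : (Fin n → Fin 2) →₀ ℂ) (K' : Fin n → Fin 2) :
    fundL τ η z x l β α v K' = ∑ K, fundEntry τ η z x l β α K' K * v K := by
  rw [fundL, tensorL_apply, Finsupp.sum_fintype _ _ (by simp)]
  refine Finset.sum_congr rfl fun K _ => ?_
  rw [mul_comm]
  congr 1
  refine Finset.sum_congr rfl fun σ _ => ?_
  by_cases h1 : σ 0 = β ∧ σ (Fin.last n) = α
  swap
  · rw [if_neg h1, if_neg fun h => h1 h.1]
  rw [if_pos h1]
  split_ifs with h2
  · rw [← h2.2]
  · by_contra hne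
    refine h2 ⟨h1, funext fun j => ?_⟩
    exact (rMat_eq_next (Finset.prod_ne_zero_iff.1 (Ne.symm hne) j (Finset.mem_univ _))).symm

theorem sum_comm_cycle {A B C : Type*} [Fintype A] [Fintype B] [Fintype C] (f : A → B → C → ℂ) :
    ∑ a, ∑ b, ∑ c, f a b c = ∑ c, ∑ a, ∑ b, f a b c := by
  rw [Finset.sum_comm (γ := C)]
  exact Finset.sum_congr rfl fun a _ => Finset.sum_comm

theorem sum_fusion {A B : Type*} [Fintype A] [Fintype B] {X Z V : A → B → ℂ} {P : A → ℂ}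
    {U : B → ℂ} (h1 : ∀ b, ∑ a, X a b = ∑ a, P a * Z a b)
    (h2 : ∀ a, ∑ b, Z a b * U b = ∑ b, V a b) :
    ∑ a, ∑ b, X a b * U b = ∑ a, ∑ b, P a * V a b := by
  simp_rw [← Finset.mul_sum, ← h2, Finset.mul_sum]
  rw [Finset.sum_comm, Finset.sum_comm (γ := A)]
  refine Finset.sum_congr rfl fun b _ => ?_
  rw [← Finset.sum_mul, h1, Finset.sum_mul]
  exact Finset.sum_congr rfl fun a _ => by ring

theorem fundEntry_rll {n : ℕ} {τ η : ℂ} (hτ : 0 < τ.im) {z : Fin n → ℂ} {x w l : ℂ}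
    (hl : ∀ k : ℤ, theta τ (l + 2 * η * k) ≠ 0) (hxw : theta τ (x - w - 2 * η) ≠ 0)
    (hx : ∀ j, theta τ (x - z j - 2 * η) ≠ 0) (hw : ∀ j, theta τ (w - z j - 2 * η) ≠ 0)
    (K'' K : Fin n → Fin 2) (γ δ α β : Fin 2) :
    ∑ α' : Fin 2, ∑ β' : Fin 2, ∑ K' : Fin n → Fin 2,
      rMat τ η (x - w) (l - 2 * η * ∑ i, (sgn (K'' i) : ℂ)) γ δ α' β' *
        (fundEntry τ η z x l α' α K'' K' * fundEntry τ η z w (l - 2 * η * sgn α) β' β K' K) =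
    ∑ α' : Fin 2, ∑ β' : Fin 2, ∑ K' : Fin n → Fin 2,
      fundEntry τ η z w l δ β' K'' K' * fundEntry τ η z x (l - 2 * η * sgn β') γ α' K' K *
        rMat τ η (x - w) l α' β' α β := by
  induction n generalizing γ δ with
  | zero =>
    simp [fundEntry_zero]
  | succ n ih =>
    set l' := l - 2 * η * ∑ i : Fin n, (sgn (K'' i.succ) : ℂ) with hl'
    have hK : l - 2 * η * ∑ i, (sgn (K'' i) : ℂ) = l' - 2 * η * sgn (K'' 0) := by
      rw [hl', Fin.sum_univ_succ]
      ring
    have hint : ∀ k : ℤ, theta τ (l' + 2 * η * k) ≠ 0 := fun k => by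
      convert hl (k - ∑ i : Fin n, sgn (K'' i.succ)) using 2
      rw [hl']
      push_cast
      ring
    have harg : ∀ (y : ℂ) (a b c d ρ a' : Fin 2) (K' : Fin n → Fin 2) (e : ℂ),
        rMat τ η y (l - 2 * η * sgn a' - 2 * η * ∑ i : Fin n, (sgn (K' i) : ℂ)) a b c d *
          fundEntry τ η (Fin.tail z) e l ρ a' (Fin.tail K'') K' =
        rMat τ η y (l' - 2 * η * sgn ρ) a b c d *
          fundEntry τ η (Fin.tail z) e l ρ a' (Fin.tail K'') K' := fun y a b c d ρ a' K' e => by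
      by_cases h : fundEntry τ η (Fin.tail z) e l ρ a' (Fin.tail K'') K' = 0
      · rw [h, mul_zero, mul_zero]
      · have h1 : (sgn ρ : ℂ) + ∑ i : Fin n, (sgn (K'' i.succ) : ℂ) =
            sgn a' + ∑ i : Fin n, (sgn (K' i) : ℂ) := by
          exact_mod_cast fundEntry_conservation h
        congr 2
        rw [hl']
        linear_combination 2 * η * h1
    have key := sum_fusion (A := Fin 2 × Fin 2 × Fin 2) (B := Fin 2 × Fin 2 × (Fin n → Fin 2))
      (X := fun a b => rMat τ η (x - w) (l' - 2 * η * sgn (K'' 0)) γ δ a.1 a.2.1 *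
        (rMat τ η (x - z 0) l' a.1 (K'' 0) b.1 a.2.2 *
          rMat τ η (w - z 0) (l' - 2 * η * sgn b.1) a.2.1 a.2.2 b.2.1 (K 0)))
      (U := fun b => fundEntry τ η (Fin.tail z) x l b.1 α (Fin.tail K'') b.2.2 *
        fundEntry τ η (Fin.tail z) w (l - 2 * η * sgn α) b.2.1 β b.2.2 (Fin.tail K))
      (Z := fun a b => rMat τ η (x - w) l' a.1 a.2.1 b.1 b.2.1)
      (P := fun a => rMat τ η (w - z 0) l' δ (K'' 0) a.2.1 a.2.2 *
        rMat τ η (x - z 0) (l' - 2 * η * sgn a.2.1) γ a.2.2 a.1 (K 0))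
      (V := fun a b => fundEntry τ η (Fin.tail z) w l a.2.1 b.2.1 (Fin.tail K'') b.2.2 *
        fundEntry τ η (Fin.tail z) x (l - 2 * η * sgn b.2.1) a.1 b.1 b.2.2 (Fin.tail K) *
        rMat τ η (x - w) l b.1 b.2.1 α β)
      (fun b => by
        simp only [Fintype.sum_prod_type]
        have := dybe (η := η) hτ (z := x - z 0) (w := w - z 0) (l := l') (by simpa using hint 0)
          (by simpa [sub_eq_add_neg] using hint (-1)) (by simpa using hint 1)
          (by rwa [sub_sub_sub_cancel_right]) (hx 0) (hw 0) (K'' 0) (K 0) γ δ b.1 b.2.1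
        rwa [sub_sub_sub_cancel_right] at this)
      (fun a => by
        simp only [Fintype.sum_prod_type]
        exact ih (z := Fin.tail z) (fun j => hx j.succ) (fun j => hw j.succ) (Fin.tail K'')
          (Fin.tail K) a.1 a.2.1)
    convert key using 1
    · simp only [Fintype.sum_prod_type]
      refine Finset.sum_congr rfl fun α' _ => Finset.sum_congr rfl fun β' _ => ?_
      rw [sum_cons]
      refine Finset.sum_congr rfl fun k' _ => ?_
      rw [sum_comm_cycle]
      refine Finset.sum_congr rfl fun K' _ => ?_
      rw [fundEntry_succ, fundEntry_succ, Finset.sum_mul_sum, Finset.mul_sum, hK, ← hl']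
      refine Finset.sum_congr rfl fun ρ _ => ?_
      rw [Finset.mul_sum]
      refine Finset.sum_congr rfl fun σ _ => ?_
      simp only [Fin.cons_zero, Fin.cons_succ, Fin.tail_cons]
      linear_combination rMat τ η (x - w) (l' - 2 * η * sgn (K'' 0)) γ δ α' β' *
          rMat τ η (x - z 0) l' α' (K'' 0) ρ k' *
        fundEntry τ η (Fin.tail z) w (l - 2 * η * sgn α) σ β K' (Fin.tail K) *
            harg (w - z 0) β' k' σ (K 0) ρ α K' x
    · conv_rhs => rw [Finset.sum_comm]
      simp only [Fintype.sum_prod_type]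
      refine Finset.sum_congr rfl fun ρ _ => Finset.sum_congr rfl fun σ _ => ?_
      rw [sum_cons, Finset.sum_comm]
      refine Finset.sum_congr rfl fun K' _ => ?_
      have h : ∀ k', fundEntry τ η z w l δ σ K'' (Fin.cons k' K') *
          fundEntry τ η z x (l - 2 * η * sgn σ) γ ρ (Fin.cons k' K') K =
          ∑ β' : Fin 2, ∑ α' : Fin 2, rMat τ η (w - z 0) l' δ (K'' 0) β' k' *
            fundEntry τ η (Fin.tail z) w l β' σ (Fin.tail K'') K' *
            (rMat τ η (x - z 0) (l' - 2 * η * sgn β') γ k' α' (K 0) *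
            fundEntry τ η (Fin.tail z) x (l - 2 * η * sgn σ) α' ρ K' (Fin.tail K)) := fun k' => by
        rw [fundEntry_succ, fundEntry_succ, Finset.sum_mul_sum, ← hl']
        refine Finset.sum_congr rfl fun β' _ => Finset.sum_congr rfl fun α' _ => ?_
        simp only [Fin.cons_zero, Fin.cons_succ, Fin.tail_cons]
        linear_combination rMat τ η (w - z 0) l' δ (K'' 0) β' k' *
          fundEntry τ η (Fin.tail z) x (l - 2 * η * sgn σ) α' ρ K' (Fin.tail K) *
              harg (x - z 0) γ k' α' (K 0) β' σ K' w
      simp_rw [h]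
      simp only [Fin.sum_univ_two]
      ring

/-! ### The tensor product of fundamental representations -/

/-- The operator `h` on `V(z_1) ⊗ ⋯ ⊗ V(z_n)`. -/
def fundH (n : ℕ) : Module.End ℂ ((Fin n → Fin 2) →₀ ℂ) :=
  Finsupp.linearCombination ℂ fun K => Finsupp.single K (∑ i, (sgn (K i) : ℂ))

theorem fundH_apply {n : ℕ} (v : (Fin n → Fin 2) →₀ ℂ) (K : Fin n → Fin 2) :
    fundH n v K = v K * ∑ i, (sgn (K i) : ℂ) := by
  rw [fundH, Finsupp.linearCombination_apply, Finsupp.sum_fintype _ _ (by simp),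
    Finsupp.finsetSum_apply]
  simp [Finsupp.single_apply]

theorem mem_eigenspace_fundH {n : ℕ} {ν : ℂ} {v : (Fin n → Fin 2) →₀ ℂ} :
    v ∈ (fundH n).eigenspace ν ↔ ∀ K, v K ≠ 0 → ∑ i, (sgn (K i) : ℂ) = ν := by
  rw [Module.End.mem_eigenspace_iff, DFunLike.ext_iff]
  refine forall_congr' fun K => ?_
  rw [fundH_apply, Finsupp.smul_apply, smul_eq_mul, mul_comm ν]
  by_cases h : v K = 0
  · simp [h]
  · simp [h]

theorem fundL_weight {n : ℕ} {τ η : ℂ} {z : Fin n → ℂ} (x l : ℂ) (β α : Fin 2) (ν : ℂ)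
    (u : (Fin n → Fin 2) →₀ ℂ) (hu : u ∈ (fundH n).eigenspace ν) :
    fundL τ η z x l β α u ∈ (fundH n).eigenspace (ν + sgn α - sgn β) := by
  rw [mem_eigenspace_fundH] at hu ⊢
  intro K' hK'
  rw [fundL_apply] at hK'
  obtain ⟨K, _, hK⟩ := Finset.exists_ne_zero_of_sum_ne_zero hK'
  have h1 : (sgn β : ℂ) + ∑ i, (sgn (K' i) : ℂ) = sgn α + ∑ i, (sgn (K i) : ℂ) := by
    exact_mod_cast fundEntry_conservation (left_ne_zero_of_mul hK)
  rw [← hu K (right_ne_zero_of_mul hK)]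
  linear_combination h1

theorem fundL_rllRelation {n : ℕ} {τ η : ℂ} (hτ : 0 < τ.im) {z : Fin n → ℂ} {x w l : ℂ}
    (hl : ∀ k : ℤ, theta τ (l + 2 * η * k) ≠ 0) (hxw : theta τ (x - w - 2 * η) ≠ 0)
    (hx : ∀ j, theta τ (x - z j - 2 * η) ≠ 0) (hw : ∀ j, theta τ (w - z j - 2 * η) ≠ 0) {ν : ℂ}
    {u : (Fin n → Fin 2) →₀ ℂ} (hu : u ∈ (fundH n).eigenspace ν) :
    RLLRelation τ η (fundL τ η z) x w l ν u := by
  intro γ δ α β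
  ext K''
  rw [mem_eigenspace_fundH] at hu
  simp only [Finsupp.finsetSum_apply, Finsupp.smul_apply, fundL_apply, smul_eq_mul,
    Finset.mul_sum]
  have hsum : ∀ f : Fin 2 → Fin 2 → (Fin n → Fin 2) → (Fin n → Fin 2) → ℂ,
      ∑ α', ∑ β', ∑ K', ∑ K, f α' β' K' K = ∑ K, ∑ α', ∑ β', ∑ K', f α' β' K' K := fun f => by
    refine Eq.trans ?_ (sum_comm_cycle fun a b K => ∑ K', f a b K' K)
    exact Finset.sum_congr rfl fun _ _ => Finset.sum_congr rfl fun _ _ => Finset.sum_comm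
  rw [hsum, hsum]
  refine Finset.sum_congr rfl fun K _ => ?_
  have h := congrArg (· * u K) (fundEntry_rll hτ hl hxw hx hw K'' K γ δ α β)
  simp only [Finset.sum_mul] at h
  convert h using 1
  · refine Finset.sum_congr rfl fun α' _ => Finset.sum_congr rfl fun β' _ =>
      Finset.sum_congr rfl fun K' _ => ?_
    by_cases h1 : fundEntry τ η z x l α' α K'' K' = 0
    · simp [h1]
    by_cases h2 : fundEntry τ η z w (l - 2 * η * sgn α) β' β K' K = 0
    · simp [h2]
    by_cases h3 : u K = 0
    · simp [h3]
    have h1' : (sgn α' : ℂ) + ∑ i, (sgn (K'' i) : ℂ) = sgn α + ∑ i, (sgn (K' i) : ℂ) := by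
      exact_mod_cast fundEntry_conservation h1
    have h2' : (sgn β' : ℂ) + ∑ i, (sgn (K' i) : ℂ) = sgn β + ∑ i, (sgn (K i) : ℂ) := by
      exact_mod_cast fundEntry_conservation h2
    rw [show ν + sgn α + sgn β - sgn α' - sgn β' = ∑ i, (sgn (K'' i) : ℂ) by
      rw [← hu K h3]; linear_combination -h1' - h2']
    ring
  · refine Finset.sum_congr rfl fun α' _ => Finset.sum_congr rfl fun β' _ =>
      Finset.sum_congr rfl fun K' _ => ?_
    ring

theorem fundL_rllOn {n : ℕ} {τ η μ : ℂ} (hτ : 0 < τ.im) (z : Fin n → ℂ)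
    (hμ : ∀ l ∈ latticeC η μ, theta τ l ≠ 0) :
    RLLOn τ η μ (fundH n) (fundL τ η z) {x | ∃ j, theta τ (x - z j - 2 * η) = 0}ᶜ where
  theta_ne := hμ
  weight := fundL_weight
  rll x hx w hw hxw l hl k u hu := by
    simp only [Set.mem_compl_iff, Set.mem_ofPred_eq, not_exists] at hx hw
    exact fundL_rllRelation hτ (fun k => hμ _ (latticeC_add_int hl k)) hxw hx hw hu

theorem eq_zero_of_sum_sgn {n : ℕ} {K : Fin n → Fin 2} (h : ∑ i, sgn (K i) = n) : K = 0 := by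
  have hle : ∀ k : Fin 2, sgn k ≤ 1 := by decide
  have h1 : ∀ k : Fin 2, 1 - sgn k = 0 → k = 0 := by decide
  have h0 : ∑ i, (1 - sgn (K i)) = 0 := by simp [h]
  rw [Finset.sum_eq_zero_iff_of_nonneg fun i _ => sub_nonneg.2 (hle _)] at h0
  exact funext fun i => h1 _ (h0 i (Finset.mem_univ i))

theorem fundEntry_highest_a {n : ℕ} (τ η : ℂ) (z : Fin n → ℂ) (x l : ℂ) :
    fundEntry τ η z x l 0 0 0 0 = 1 := by
  induction n with
  | zero => simp [fundEntry_zero]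
  | succ n ih =>
    have e0 : Fin.tail (0 : Fin (n + 1) → Fin 2) = 0 := rfl
    rw [fundEntry_succ, Fin.sum_univ_two]
    simp [rMat, e0, ih]

theorem fundEntry_highest_d {n : ℕ} {τ η : ℂ} (z : Fin n → ℂ) (x : ℂ) {l : ℂ}
    (hl : ∀ k : ℤ, theta τ (l + 2 * η * k) ≠ 0) :
    fundEntry τ η z x l 1 1 0 0 = theta τ (l - 2 * η * n) / theta τ l *
      ∏ j, theta τ (x - z j) / theta τ (x - z j - 2 * η) := by
  have hl0 : theta τ l ≠ 0 := by simpa using hl 0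
  induction n with
  | zero => simp [fundEntry_zero, hl0]
  | succ n ih =>
    have h := ih (Fin.tail z)
    have hn : theta τ (l - 2 * η * n) ≠ 0 := by simpa [sub_eq_add_neg] using hl (-n)
    have hr : fundEntry τ η z x l 1 1 0 0 = alphaFn τ η (x - z 0) (-(l - 2 * η * n)) *
        fundEntry τ η (Fin.tail z) x l 1 1 0 0 := by
      rw [fundEntry_succ, Fin.sum_univ_two]
      have e0 : Fin.tail (0 : Fin (n + 1) → Fin 2) = 0 := rfl
      simp [rMat, e0]
    rw [hr, h, alphaFn_neg, Fin.prod_univ_succ]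
    simp only [Fin.tail]
    rw [show l - 2 * η * n - 2 * η = l - 2 * η * (n + 1 : ℕ) by push_cast; ring]
    field_simp

theorem fundL_highestWeightOn {n m : ℕ} {τ η μ : ℂ} {z Λ : Fin n → ℂ} (hΛ : ∀ j, Λ j = 1)
    (hm : ∑ j, Λ j = 2 * (m : ℂ)) (hμ : ∀ l ∈ latticeC η μ, theta τ l ≠ 0) (S : Set ℂ) :
    HighestWeightOn τ η μ (fundH n) (fundL τ η z) S z Λ m fun _ => Finsupp.single 0 1 := by
  have hn : (n : ℂ) = 2 * m := by simpa [hΛ] using hm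
  have hdiag : ∀ x l : ℂ, ∀ α : Fin 2, fundL τ η z x l α α (Finsupp.single 0 1) =
      fundEntry τ η z x l α α 0 0 • Finsupp.single 0 1 := fun x l α => by
    ext K'
    rw [fundL_apply, Finset.sum_eq_single 0 (fun K _ hK => by simp [hK]) (by simp)]
    by_cases hK : K' = 0
    · simp [hK]
    · rw [Finsupp.smul_apply, Finsupp.single_eq_of_ne hK, smul_zero, Finsupp.single_eq_same,
        mul_one]
      by_contra hne
      exact hK (eq_zero_of_sum_sgn (by simpa using fundEntry_conservation hne))
  refine ⟨fun l => ?_, fun x _ l _ => ?_, fun x _ l hl => ?_⟩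
  · rw [mem_eigenspace_fundH]
    intro K hK
    have : K = 0 := by
      by_contra h
      exact hK (Finsupp.single_eq_of_ne h)
    simp [this, hn]
  · rw [hdiag, fundEntry_highest_a, one_smul]
  · rw [hdiag, fundEntry_highest_d _ _ fun k => hμ _ (latticeC_add_int hl k), weightRatio]
    simp only [pPar, qPar, hΛ]
    congr 2
    · rw [hn]; ring_nf
    · refine Finset.prod_congr rfl fun j _ => ?_
      congr 2 <;> ring

theorem analyticAt_rMat {τ η : ℂ} (hτ : 0 < τ.im) {f g : ℂ → ℂ} {p : ℂ} (hf : AnalyticAt ℂ f p)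
    (hg : AnalyticAt ℂ g p) (hfp : theta τ (f p - 2 * η) ≠ 0) (hgp : theta τ (g p) ≠ 0)
    (γ δ α β : Fin 2) : AnalyticAt ℂ (fun s => rMat τ η (f s) (g s) γ δ α β) p := by
  have hθ : ∀ {f : ℂ → ℂ}, AnalyticAt ℂ f p → AnalyticAt ℂ (fun s => theta τ (f s)) p :=
    fun hf => (analyticAt_theta hτ _).fun_comp hf
  have ha : ∀ {g : ℂ → ℂ}, AnalyticAt ℂ g p → theta τ (g p) ≠ 0 →
      AnalyticAt ℂ (fun s => alphaFn τ η (f s) (g s)) p := fun hg hgp => by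
    refine AnalyticAt.div ?_ ((hθ hg).mul (hθ (hf.sub analyticAt_const))) (mul_ne_zero hgp hfp)
    exact (hθ (hg.add analyticAt_const)).mul (hθ hf)
  have hb : ∀ {g : ℂ → ℂ}, AnalyticAt ℂ g p → theta τ (g p) ≠ 0 →
      AnalyticAt ℂ (fun s => betaFn τ η (f s) (g s)) p := fun hg hgp => by
    refine AnalyticAt.div ?_ ((hθ hg).mul (hθ (hf.sub analyticAt_const))) (mul_ne_zero hgp hfp)
    exact ((hθ (hg.add hf)).mul analyticAt_const).neg
  have hgp' : theta τ (-g p) ≠ 0 := by rwa [theta_neg, neg_ne_zero]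
  unfold rMat
  split_ifs
  exacts [analyticAt_const, ha hg hgp, ha hg.neg hgp', hb hg hgp, hb hg.neg hgp', analyticAt_const]

theorem abs_sum_sgn_le {ι : Type*} (s : Finset ι) (K : ι → Fin 2) :
    |∑ i ∈ s, sgn (K i)| ≤ s.card := by
  have h : ∀ k : Fin 2, |sgn k| ≤ 1 := by decide
  simpa using (Finset.abs_sum_le_sum_abs _ _).trans (Finset.sum_le_card_nsmul s _ 1 fun i _ =>
      h (K i))

theorem analyticAt_fundEntry {n : ℕ} {τ η : ℂ} (hτ : 0 < τ.im) {z : Fin n → ℂ} {f g : ℂ → ℂ} {p : ℂ}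
    (hf : AnalyticAt ℂ f p) (hg : AnalyticAt ℂ g p) (hfp : ∀ j, theta τ (f p - z j - 2 * η) ≠ 0)
    (hgp : ∀ k : ℤ, |k| ≤ n → theta τ (g p + 2 * η * k) ≠ 0) (β α : Fin 2) (K' K : Fin n → Fin 2) :
    AnalyticAt ℂ (fun s => fundEntry τ η z (f s) (g s) β α K' K) p := by
  unfold fundEntry
  refine Finset.analyticAt_fun_sum _ fun σ _ => ?_
  split_ifs
  · refine Finset.analyticAt_fun_prod _ fun j _ => analyticAt_rMat hτ (hf.sub analyticAt_const)
      (hg.sub analyticAt_const) (hfp j) ?_ _ _ _ _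
    convert hgp (-∑ i ∈ Finset.Ioi j, sgn (K' i)) ?_ using 2
    · simp only [Pi.sub_apply]
      push_cast
      ring
    · rw [abs_neg]
      refine (abs_sum_sgn_le _ _).trans ?_
      exact_mod_cast (Finset.card_le_univ _).trans (by simp)
  · exact analyticAt_const

theorem analyticAt_fundBethe {n m : ℕ} {τ η : ℂ} (hτ : 0 < τ.im) {z : Fin n → ℂ} {c : ℂ}
    {ts : List ℂ} (hts : ∀ t ∈ ts, ∀ j, theta τ (t - z j - 2 * η) ≠ 0) {p : ℂ}
    (hp : ∀ k : ℤ, |k| ≤ n + ts.length → theta τ (p + 2 * η * k) ≠ 0) (K : Fin n → Fin 2) :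
    AnalyticAt ℂ (fun l => betheVector η (fun x l => fundL τ η z x l 0 1)
      (fun l => gFn τ η c m l • Finsupp.single 0 1) ts l K) p := by
  induction ts generalizing p K with
  | nil =>
    have hg : AnalyticAt ℂ (gFn τ η c m) p := by
      refine AnalyticAt.mul (by fun_prop) (Finset.analyticAt_fun_prod _ fun j _ => ?_)
      exact (analyticAt_theta hτ _).fun_comp (by fun_prop)
    exact hg.mul analyticAt_const
  | cons t ts ih =>
    simp only [betheVector, fundL_apply]
    refine Finset.analyticAt_fun_sum _ fun K' _ => AnalyticAt.mul ?_ ?_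
    · refine analyticAt_fundEntry hτ analyticAt_const analyticAt_id (hts t (by simp))
        (fun k hk => hp k ?_) _ _ _ _
      push_cast [List.length_cons]
      omega
    · refine AnalyticAt.fun_comp (f := fun l : ℂ => l + 2 * η)
        (g := fun l => betheVector η (fun x l => fundL τ η z x l 0 1)
          (fun l => gFn τ η c m l • Finsupp.single 0 1) ts l K')
        (ih (fun t ht => hts t (by simp [ht])) (fun k hk => ?_) K') (by fun_prop)
      convert hp (k + 1) ?_ using 2
      · push_cast; ring
      · push_cast [List.length_cons]
        have := abs_add_le k 1
        rw [abs_one] at this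
        omega

theorem vecRegularAt_of_analyticAt {ι : Type*} [Fintype ι] {v : ℂ → (ι →₀ ℂ)} {p : ℂ}
    (h : ∀ K, AnalyticAt ℂ (fun s => v s K) p) : VecRegularAt v p := by
  intro φ
  have : ∀ s, φ (v s) = ∑ K, v s K * φ (Finsupp.single K 1) := fun s => by
    conv_lhs => rw [← Finsupp.univ_sum_single (v s)]
    rw [map_sum]
    refine Finset.sum_congr rfl fun K _ => ?_
    rw [← smul_eq_mul, ← map_smul, Finsupp.smul_single_one]
  simp_rw [this]
  exact Finset.analyticAt_fun_sum _ fun K _ => (h K).mul analyticAt_const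

theorem vecRegularAt_fundL {n : ℕ} {τ η : ℂ} (hτ : 0 < τ.im) {z : Fin n → ℂ} {x l : ℂ}
    (hx : ∀ j, theta τ (x - z j - 2 * η) ≠ 0) (hl : ∀ k : ℤ, theta τ (l + 2 * η * k) ≠ 0)
    (β α : Fin 2) (u : (Fin n → Fin 2) →₀ ℂ) :
    VecRegularAt (fun s => fundL τ η z s l β α u) x := by
  refine vecRegularAt_of_analyticAt fun K => ?_
  simp only [fundL_apply]
  exact Finset.analyticAt_fun_sum _ fun K' _ => (analyticAt_fundEntry hτ analyticAt_id
    analyticAt_const hx (fun k _ => hl k) _ _ _ _).mul analyticAt_const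

theorem fundBethe_mem {n m : ℕ} {τ η : ℂ} {z : Fin n → ℂ} {c : ℂ} {t : Fin m → ℂ}
    (hm : n = 2 * m) (l : ℂ) : fundBethe τ η z c t l ∈ (fundH n).eigenspace (0 : ℂ) := by
  have hv : ∀ l, gFn τ η c m l • Finsupp.single (0 : Fin n → Fin 2) (1 : ℂ) ∈
      (fundH n).eigenspace (2 * ((m : ℤ) : ℂ)) := fun l => by
    rw [mem_eigenspace_fundH]
    intro K hK
    have : K = 0 := by
      by_contra h
      exact hK (by simp [Finsupp.single_eq_of_ne h])
    simp [this, hm]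
  have hb : ∀ (x l ν : ℂ), ∀ u ∈ (fundH n).eigenspace ν,
      fundL τ η z x l 0 1 u ∈ (fundH n).eigenspace (ν - 2) := fun x l ν u hu => by
    convert fundL_weight x l 0 1 ν u hu using 2
    simp only [sgn_zero, sgn_one]
    push_cast
    ring
  have := betheVector_mem (b := fun x l => fundL τ η z x l 0 1) (η := η) hb hv (List.ofFn t) l
  rwa [List.length_ofFn, sub_self, Int.cast_zero, mul_zero] at this

theorem fundBethe_zeros_countable {n m : ℕ} {τ η : ℂ} (hτ : 0 < τ.im) {z : Fin n → ℂ} {c : ℂ}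
    {t : Fin m → ℂ} (ht : ∀ i j, theta τ (t i - z j - 2 * η) ≠ 0)
    (hne : ¬ fundBethe τ η z c t =ᶠ[codiscrete ℂ] 0) :
    {l | fundBethe τ η z c t l = 0}.Countable := by
  refine countable_zeros_of_vecRegularAt (V := ⊤) (fun _ => trivial) ?_ hne
  have hev : ∀ᶠ l in codiscrete ℂ, ∀ k ∈ Finset.Icc (-((n + m : ℕ) : ℤ)) (n + m : ℕ),
      theta τ (l + 2 * η * k) ≠ 0 :=
    (Finset.eventually_all _).2 fun k _ => by
      refine mem_codiscrete.2 fun t => disjoint_principal_right.2 ?_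
      rw [compl_compl]
      exact eventually_theta_add_ne_zero hτ _ t
  filter_upwards [hev] with l hl
  refine vecRegularAt_of_analyticAt fun K => analyticAt_fundBethe hτ (fun s hs => ?_)
    (fun k hk => hl k ?_) K
  · obtain ⟨i, rfl⟩ := (List.mem_ofFn' _ _).1 hs
    exact ht i
  · rw [Finset.mem_Icc, ← abs_le]
    simpa using hk

theorem fundL_transfer_bethe {n m : ℕ} {τ η μ : ℂ} (hτ : 0 < τ.im) {z Λ : Fin n → ℂ}
    (hΛ : ∀ j, Λ j = 1) (hm : ∑ j, Λ j = 2 * (m : ℂ)) {c : ℂ} {t : Fin m → ℂ}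
    (ht : ∀ i j, i ≠ j → ∀ r s : ℤ, t i - t j ≠ r + s * τ) (hbae : BetheEquations τ η z Λ c t)
    (hμ : ∀ l ∈ latticeC η μ, theta τ l ≠ 0) {w : ℂ} (hw : ∀ k, theta τ (w - qPar η z Λ k) ≠ 0)
    {l : ℂ} (hl : l ∈ latticeC η μ) :
    fundL τ η z w l 0 0 (fundBethe τ η z c t (l - 2 * η)) +
      fundL τ η z w l 1 1 (fundBethe τ η z c t (l + 2 * η)) =
      regularizedEigenvalue τ η z Λ c t w • fundBethe τ η z c t l := by
  have hq : ∀ x, (∀ k, theta τ (x - qPar η z Λ k) ≠ 0) → ∀ j, theta τ (x - z j - 2 * η) ≠ 0 := by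
    intro x hx j
    convert hx j using 2
    rw [qPar, hΛ]
    ring
  have hB : {x | ∃ j, theta τ (x - z j - 2 * η) = 0}.Countable := by
    rw [Set.ofPred_exists]
    exact Set.countable_iUnion fun j => countable_theta_comp_zeros hτ fun a b h => by simpa using h
  exact (fundL_rllOn hτ z hμ).transfer_bethe hτ hB (fundL_highestWeightOn hΛ hm hμ _) ht hbae
    (fun i l hl k u _ => vecRegularAt_fundL hτ (hq _ (bethe_theta_ne hbae i).2.1)
      (fun k => hμ _ (latticeC_add_int hl k)) _ _ u)
    (fun l hl α u _ => vecRegularAt_fundL hτ (hq _ hw)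
      (fun k => hμ _ (latticeC_add_int hl k)) _ _ u) hl

/-! ### Interaction-round-a-face models -/

theorem idx_sgn (s : Fin 2) : idx (sgn s) = s := by
  fin_cases s <;> simp [idx]

theorem sgn_idx {s : ℤ} (hs : |s| = 1) : sgn (idx s) = s := by
  rcases (abs_eq zero_le_one).1 hs with rfl | rfl <;> simp [idx]

theorem abs_sgn (s : Fin 2) : |sgn s| = 1 := by
  fin_cases s <;> simp

theorem sum_Ioi_castSucc_sub_succ {n : ℕ} (b : Fin (n + 1) → ℤ) (j : Fin n) :
    ∑ i ∈ Finset.Ioi j, (b i.castSucc - b i.succ) = b j.succ - b (Fin.last n) := by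
  induction n with
  | zero => exact j.elim0
  | succ n ih =>
    have hsum : ∀ {n : ℕ} (b : Fin (n + 1) → ℤ),
        ∑ i : Fin n, (b i.castSucc - b i.succ) = b 0 - b (Fin.last n) := fun {n} b => by
      rw [Finset.sum_sub_distrib]
      linarith [Fin.sum_univ_succ b, Fin.sum_univ_castSucc b]
    refine Fin.cases ?_ (fun j => ?_) j
    · rw [Fin.sum_Ioi_zero]
      exact hsum fun i : Fin (n + 1) => b i.succ
    · rw [Fin.sum_Ioi_succ]
      exact ih (fun i => b i.succ) j

theorem exists_path {n : ℕ} (f : Fin n → ℤ) (hf : ∑ i, f i = 0) :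
    ∃ b : Fin (n + 1) → ℤ, b 0 = 0 ∧ b (Fin.last n) = 0 ∧ ∀ j, b j.castSucc - b j.succ = f j := by
  set g : ℕ → ℤ := fun i => if h : i < n then f ⟨i, h⟩ else 0 with hg
  refine ⟨fun j => -∑ i ∈ Finset.range j, g i, by simp, ?_, fun j => ?_⟩
  · change -∑ i ∈ Finset.range n, g i = 0
    rw [Finset.sum_range, neg_eq_zero, ← hf]
    exact Finset.sum_congr rfl fun i _ => by simp [hg]
  · simp only [Fin.val_castSucc, Fin.val_succ, Finset.sum_range_succ]
    simp [hg]

theorem irfTransfer_eq {n : ℕ} {τ η κ : ℂ} {z : Fin n → ℂ} {w : ℂ}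
    {ψ : ℂ → ((Fin n → Fin 2) →₀ ℂ)} {b : Fin (n + 1) → ℤ} (hb : IsClosedPath b) {l : ℂ}
    (hl : l = -2 * η * (κ + b 0)) :
    irfTransfer τ η κ z w (pathCoeff η κ ψ) b =
      (fundL τ η z w l 0 0 (ψ (l - 2 * η)) + fundL τ η z w l 1 1 (ψ (l + 2 * η)))
        fun j => idx (b j.castSucc - b j.succ) := by
  classical
  set K' : Fin n → Fin 2 := fun j => idx (b j.castSucc - b j.succ) with hK'
  have hsK' : ∀ j, sgn (K' j) = b j.castSucc - b j.succ := fun j => sgn_idx (hb.2 j)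
  have harg : ∀ j, l - 2 * η * ∑ i ∈ Finset.Ioi j, (sgn (K' i) : ℂ) =
      -2 * η * (κ + b j.succ) := fun j => by
    have h1 : ∑ i ∈ Finset.Ioi j, (sgn (K' i) : ℂ) = b j.succ - b 0 := by
      rw [hb.1]
      exact_mod_cast (Finset.sum_congr rfl fun i _ => hsK' i).trans (sum_Ioi_castSucc_sub_succ b j)
    rw [h1, hl]
    ring
  rw [Finsupp.add_apply, fundL_apply, fundL_apply]
  simp only [fundEntry, harg, Finset.sum_mul, ite_mul, zero_mul]
  have hcomm : ∀ f : (Fin n → Fin 2) → (Fin (n + 1) → Fin 2) → ℂ,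
      ∑ K, ∑ σ, f K σ = ∑ σ, ∑ K, f K σ := fun _ => Finset.sum_comm
  rw [hcomm, hcomm, ← Finset.sum_add_distrib, irfTransfer]
  refine Finset.sum_congr rfl fun σ _ => ?_
  set a : Fin (n + 1) → ℤ := fun j => b j + sgn (σ j) with ha
  have hterm : ∑ K, (∏ j, rMat τ η (w - z j) (-2 * η * (κ + b j.succ)) (σ j.castSucc) (K' j)
      (σ j.succ) (K j)) * ψ (-2 * η * (κ + a 0)) K =
      if ∀ j : Fin n, |a j.castSucc - a j.succ| = 1 then
        (∏ j : Fin n, boltzmann τ η κ (b j.castSucc) (a j.castSucc) (a j.succ) (b j.succ) (w - z j))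
          * pathCoeff η κ ψ a else 0 := by
    have hne : ∀ K : Fin n → Fin 2, (∏ j, rMat τ η (w - z j)
        (-2 * η * (κ + b j.succ)) (σ j.castSucc) (K' j)
        (σ j.succ) (K j)) ≠ 0 → ∀ j, sgn (K j) = a j.castSucc - a j.succ := fun K hK j => by
      have h1 := rMat_conservation (Finset.prod_ne_zero_iff.1 hK j (Finset.mem_univ j))
      rw [hsK'] at h1
      simp only [ha]
      linarith
    split_ifs with hpath
    · rw [Finset.sum_eq_single fun j => idx (a j.castSucc - a j.succ)]
      · congr 1
        refine Finset.prod_congr rfl fun j _ => ?_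
        rw [boltzmann]
        simp only [ha, add_sub_cancel_left, idx_sgn, hK']
      · intro K _ hK
        refine mul_eq_zero_of_left ?_ _
        by_contra h
        exact hK (funext fun j => by rw [← hne K h j, idx_sgn])
      · simp
    · refine Finset.sum_eq_zero fun K _ => mul_eq_zero_of_left ?_ _
      by_contra h
      exact hpath fun j => by rw [← hne K h j, abs_sgn]
  have hclosed : IsClosedPath a ↔ σ 0 = σ (Fin.last n) ∧
      ∀ j : Fin n, |a j.castSucc - a j.succ| = 1 := by
    refine and_congr_left' ?_
    simp only [ha, hb.1, add_right_inj]
    exact ⟨fun h => by rw [← idx_sgn (σ 0), h, idx_sgn], fun h => by rw [h]⟩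
  have ha0 : -2 * η * (κ + a 0) = l - 2 * η * sgn (σ 0) := by
    rw [hl, ha]
    push_cast
    ring
  rw [ha0] at hterm
  simp only [hclosed, ite_and]
  rw [← hterm]
  have h01 : ∀ s : Fin 2, s = 0 ∨ s = 1 := by decide
  rcases h01 (σ 0) with h0 | h0 <;> rcases h01 (σ (Fin.last n)) with h1 | h1 <;>
    simp [h0, h1]

theorem fundBethe_irf {n m : ℕ} {τ η : ℂ} (hτ : 0 < τ.im) (hη : η ≠ 0) {z Λ : Fin n → ℂ}
    (hΛ : ∀ j, Λ j = 1) (hm : ∑ j, Λ j = 2 * (m : ℂ)) {c : ℂ} {t : Fin m → ℂ}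
    (ht : ∀ i j, i ≠ j → ∀ r s : ℤ, t i - t j ≠ r + s * τ) (hbae : BetheEquations τ η z Λ c t) :
    ∃ K : Set ℂ, K.Countable ∧ ∀ κ ∉ K,
      (∀ w, (∀ k, theta τ (w - qPar η z Λ k) ≠ 0) → ∀ b, IsClosedPath b →
        irfTransfer τ η κ z w (pathCoeff η κ (fundBethe τ η z c t)) b
          = regularizedEigenvalue τ η z Λ c t w * pathCoeff η κ (fundBethe τ η z c t) b) ∧
      (¬ (fundBethe τ η z c t =ᶠ[codiscrete ℂ] 0) →
        ∃ b, IsClosedPath b ∧ pathCoeff η κ (fundBethe τ η z c t) b ≠ 0) := by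
  have hn : (n : ℂ) = 2 * m := by simpa [hΛ] using hm
  have h2η : -2 * η ≠ 0 := by simpa using hη
  have hinj : ∀ k : ℂ, Function.Injective fun κ : ℂ => -2 * η * (κ + k) := fun k a b h => by
    simpa [hη] using h
  refine ⟨(⋃ k : ℤ, {κ | theta τ (-2 * η * (κ + k)) = 0}) ∪
    {κ | ¬ (fundBethe τ η z c t =ᶠ[codiscrete ℂ] 0) ∧ fundBethe τ η z c t (-2 * η * κ) = 0},
    (Set.countable_iUnion fun k : ℤ => countable_theta_comp_zeros hτ (hinj (k : ℂ))).union ?_,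
        fun κ hκ => ?_⟩
  · by_cases hne : fundBethe τ η z c t =ᶠ[codiscrete ℂ] 0
    · simp [hne]
    · refine ((fundBethe_zeros_countable hτ (fun i j => ?_) hne).preimage
        (mul_right_injective₀ h2η)).mono fun κ hκ => hκ.2
      convert (bethe_theta_ne hbae i).2.1 j using 2
      rw [qPar, hΛ]
      ring
  simp only [Set.mem_union, Set.mem_iUnion, Set.mem_ofPred_eq, not_or, not_exists, not_and] at hκ
  have hμ : ∀ l ∈ latticeC η (-2 * η * κ), theta τ l ≠ 0 := by
    rintro l ⟨j, rfl⟩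
    convert hκ.1 (-j) using 2
    push_cast
    ring
  refine ⟨fun w hw b hb => ?_, fun hne => ?_⟩
  · rw [irfTransfer_eq hb rfl, fundL_transfer_bethe hτ hΛ hm ht hbae hμ hw
      ⟨-b 0, by push_cast; ring⟩]
    rfl
  · obtain ⟨K, hK⟩ := DFunLike.ne_iff.1 (hκ.2 hne)
    have hK0 : ∑ i, sgn (K i) = 0 := by
      exact_mod_cast mem_eigenspace_fundH.1 (fundBethe_mem (τ := τ) (z := z) (c := c) (t := t)
        (by exact_mod_cast hn) _) K hK
    obtain ⟨b, hb0, hbl, hb⟩ := exists_path (fun i => sgn (K i)) hK0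
    refine ⟨b, ⟨hb0.trans hbl.symm, fun j => by rw [hb, abs_sgn]⟩, ?_⟩
    simp only [pathCoeff, hb, idx_sgn, hb0]
    simpa using hK

end EllipticBethe

end

open EllipticBethe in
theorem mainTheorem9 (τ η : ℂ) (hτ : 0 < τ.im) (n m : ℕ) (z Λ : Fin n → ℂ)
    (hΛ : ∑ j, Λ j = 2 * (m : ℂ)) (c : ℂ) (t : Fin m → ℂ)
    (ht : ∀ i j, i ≠ j → ∀ r s : ℤ, t i - t j ≠ r + s * τ)
    (hbae : BetheEquations τ η z Λ c t) :
    ∃ ε : ℂ → ℂ,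
      -- the eigenvalue
      (∀ w, (∀ j, theta τ (t j - w) ≠ 0) → (∀ k, theta τ (w - qPar η z Λ k) ≠ 0) →
        ε w = betheEigenvalue τ η z Λ c t w) ∧
      -- every module with a highest weight vector
      (∀ (W : Type*) [AddCommGroup W] [Module ℂ W] (M : EModule τ η W) (v₀ : ℂ → W),
        M.IsHighestWeightVector z Λ v₀ → (∀ i, M.BDefinedAt (t i)) →
        ∃ E : Set ℂ, E.Countable ∧ ∀ μ ∉ E,
          {w | ¬ M.TransferDefinedOn μ w}.Countable ∧
          (∀ l ∈ latticeC η μ, VecRegularAt (M.bethe v₀ c t) l) ∧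
          ∃ ψ : M.FunZero μ, (∀ l, (ψ l : W) = M.bethe v₀ c t l) ∧
            (∀ w, M.TransferDefinedOn μ w → M.transfer μ w ψ = ε w • ψ) ∧
            (¬ (M.bethe v₀ c t =ᶠ[Filter.codiscrete ℂ] 0) → ψ ≠ 0)) ∧
      -- in tensor products of evaluation Verma modules, the Bethe vector does not vanish
      (theta τ (2 * η) ≠ 0 → ¬ (vermaBethe τ η z Λ c t =ᶠ[Filter.codiscrete ℂ] 0)) ∧
      -- interaction-round-a-face models
      (η ≠ 0 → (∀ j, Λ j = 1) →
        ∃ K : Set ℂ, K.Countable ∧ ∀ κ ∉ K,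
          (∀ w, (∀ k, theta τ (w - qPar η z Λ k) ≠ 0) → ∀ b, IsClosedPath b →
            irfTransfer τ η κ z w (pathCoeff η κ (fundBethe τ η z c t)) b
              = ε w * pathCoeff η κ (fundBethe τ η z c t) b) ∧
          (¬ (fundBethe τ η z c t =ᶠ[Filter.codiscrete ℂ] 0) →
            ∃ b, IsClosedPath b ∧ pathCoeff η κ (fundBethe τ η z c t) b ≠ 0)) :=
  ⟨regularizedEigenvalue τ η z Λ c t, fun _ h1 h2 => regularizedEigenvalue_eq hτ h1 h2,
    fun _ _ _ M v₀ hv hb => M.bethe_main hτ hΛ c t ht hbae v₀ hv hb,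
    vermaBethe_ne_zero hτ hΛ hbae, fun hη hΛ1 => fundBethe_irf hτ hη hΛ1 hΛ ht hbae⟩
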